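/- Let $M$ be a closed smooth manifold of dimension $n\ge 3$ with a smooth Riemannian metric $g$, let $2^*=\frac{2n}{n-2}$, and let $[g]=\{w^{4/(n-2)}g:\ w\in C^\infty(M),\ w>0\}$ be its conformal class. For $h\in[g]$ let $R_h$ be the scalar curvature and $dV_h$ the Riemannian measure of $h$, let $H^1(M,h)$ be the Sobolev space of $L^2$ functions with $L^2$ gradient, $H^1_+(M,h)=\{u\in H^1(M,h): u>0 \text{ a.e.}\}$, and $$\langle u,v\rangle_h=4\tfrac{n-1}{n-2}\int_M h(\nabla_h u,\nabla_h v)\,dV_h+\int_M R_h\,uv\,dV_h,\qquad \|u\|_h=\sqrt{\langle u,u\rangle_h}.$$ Assume that $$\mathcal Y(M,[g])=\inf_{u\in H^1_+(M,g)}\frac{\langle u,u\rangle_g}{\|u\|^2_{L^{2^*}(M,g)}}>0 .$$ Let $h\in[g]$, $1\le p\le 2^*-1$ and $u\in H^1_+(M,h)$. Then the problem of minimizing $\langle v,v\rangle_h$ over all $v\in H^1_+(M,h)$ with $v\ge u$ a.e. has a unique solution $T_h(u)$, and $0<\|T_h(u)\|_{L^{p+1}(M,h)}<\infty$. With $$I^h_p(u)=\frac{\langle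 u,u\rangle_h}{\|T_h(u)\|^2_{L^{p+1}(M,h)}}$$ one has $$I_p^h(u)-I_p^h(T_h(u))=\frac{1}{\|T_h(u)\|^2_{L^{p+1}(M,h)}}\left[\|u\|_h^2-\|T_h(u)\|_h^2\right]\ge 0 .$$ Moreover, if $I_p^h(u)=I_p^h(T_h(u))$, then $T_h(u)=u$. -/

import Mathlib

open MeasureTheory Filter
open scoped Manifold ContDiff Topology ENNReal Matrix

noncomputable section

namespace ConformalObstacle

/-- Smooth Riemannian metrics on the `n`-dimensional smooth manifold `M` (without boundary). -/
abbrev Metric (n : ℕ) (M : Type*) [TopologicalSpace M]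
    [ChartedSpace (EuclideanSpace ℝ (Fin n)) M] [IsManifold (𝓡 n) ∞ M] : Type _ :=
  Bundle.ContMDiffRiemannianMetric (𝓡 n) ∞ (EuclideanSpace ℝ (Fin n))
    (fun x : M => TangentSpace (𝓡 n) x)

/-- The exponent `2^* = 2n/(n-2)`. -/
def critExp (n : ℕ) : ℝ := 2 * n / (n - 2)

/-! ### Local coordinate formulas

`G` is the matrix `(g_ij)` of a metric in local coordinates, a function of `y ∈ ℝⁿ`. -/

section Coordinates

variable {n : ℕ}

/-- The partial derivative `∂_i f (y)`. -/
def pd (i : Fin n) (f : EuclideanSpace ℝ (Fin n) → ℝ) (y : EuclideanSpace ℝ (Fin n)) : ℝ :=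
  fderiv ℝ f y (EuclideanSpace.single i 1)

/-- The Christoffel symbols `Γ^k_ij = ½ g^{kl} (∂_i g_jl + ∂_j g_il - ∂_l g_ij)`. -/
def christoffel (G : EuclideanSpace ℝ (Fin n) → Matrix (Fin n) (Fin n) ℝ) (k i j : Fin n)
    (y : EuclideanSpace ℝ (Fin n)) : ℝ :=
  (1 / 2) * ∑ l, (G y)⁻¹ k l *
    (pd i (fun z => G z j l) y + pd j (fun z => G z i l) y - pd l (fun z => G z i j) y)

/-- The Ricci curvature
`R_jk = ∂_i Γ^i_jk - ∂_j Γ^i_ik + Γ^i_il Γ^l_jk - Γ^i_jl Γ^l_ik` (sum over `i`, `l`). -/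
def ricci (G : EuclideanSpace ℝ (Fin n) → Matrix (Fin n) (Fin n) ℝ) (j k : Fin n)
    (y : EuclideanSpace ℝ (Fin n)) : ℝ :=
  ∑ i, (pd i (christoffel G i j k) y - pd j (christoffel G i i k) y
    + ∑ l, (christoffel G i i l y * christoffel G l j k y
      - christoffel G i j l y * christoffel G l i k y))

/-- The scalar curvature `g^{jk} R_jk`. -/
def coordScalar (G : EuclideanSpace ℝ (Fin n) → Matrix (Fin n) (Fin n) ℝ)
    (y : EuclideanSpace ℝ (Fin n)) : ℝ :=
  ∑ j, ∑ k, (G y)⁻¹ j k * ricci G j k y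

end Coordinates

section Manifold

variable {n : ℕ} {M : Type*} [TopologicalSpace M] [ChartedSpace (EuclideanSpace ℝ (Fin n)) M]
  [IsManifold (𝓡 n) ∞ M]

/-- The matrix `g_ij(y) = g(∂_i, ∂_j)` of `g` in the chart around `x₀`, for `y` in the target of
the chart. -/
def coordMetric (g : Metric n M) (x₀ : M) (y : EuclideanSpace ℝ (Fin n)) :
    Matrix (Fin n) (Fin n) ℝ :=
  Matrix.of fun i j =>
    g.inner ((extChartAt (𝓡 n) x₀).symm y)
      (mfderiv 𝓘(ℝ, EuclideanSpace ℝ (Fin n)) (𝓡 n) (extChartAt (𝓡 n) x₀).symm y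
        (EuclideanSpace.single i 1 : EuclideanSpace ℝ (Fin n)))
      (mfderiv 𝓘(ℝ, EuclideanSpace ℝ (Fin n)) (𝓡 n) (extChartAt (𝓡 n) x₀).symm y
        (EuclideanSpace.single j 1 : EuclideanSpace ℝ (Fin n)))

/-- The scalar curvature `R_g` at `x` (computed in the chart around `x`; the value does not depend
on the chart). -/
def scalarCurvature (g : Metric n M) (x : M) : ℝ :=
  coordScalar (coordMetric g x) (extChartAt (𝓡 n) x x)

/-- The conformal class `[g] = {w^{4/(n-2)} g : w ∈ C^∞(M), w > 0}`. -/
def conformalClass (g : Metric n M) : Set (Metric n M) :=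
  {h | ∃ w : M → ℝ, ContMDiff (𝓡 n) 𝓘(ℝ, ℝ) ∞ w ∧ (∀ x, 0 < w x) ∧
    ∀ (x : M) (a b : TangentSpace (𝓡 n) x),
      h.inner x a b = w x ^ (4 / ((n : ℝ) - 2)) * g.inner x a b}

/-- `g` as a bilinear form on the tangent space at `x`. -/
def metricForm (g : Metric n M) (x : M) : LinearMap.BilinForm ℝ (TangentSpace (𝓡 n) x) :=
  LinearMap.mk₂ ℝ (fun a b => g.inner x a b) (by intros; simp) (by intros; simp)
    (by intros; simp) (by intros; simp)

theorem metricForm_nondegenerate (g : Metric n M) (x : M) : (metricForm g x).Nondegenerate := by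
  constructor
  · intro a ha
    by_contra h
    exact (g.pos x a h).ne' (ha a)
  · intro a ha
    by_contra h
    exact (g.pos x a h).ne' (ha a)

instance (x : M) : FiniteDimensional ℝ (TangentSpace (𝓡 n) x) :=
  inferInstanceAs (FiniteDimensional ℝ (EuclideanSpace ℝ (Fin n)))

/-- The gradient of a differentiable function: `g(∇f, a) = df(a)` for all tangent vectors `a`. -/
def gradient (g : Metric n M) (f : M → ℝ) (x : M) : TangentSpace (𝓡 n) x :=
  ((metricForm g x).toDual (metricForm_nondegenerate g x)).symm
    (mfderiv (𝓡 n) 𝓘(ℝ, ℝ) f x).toLinearMap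

theorem inner_gradient (g : Metric n M) (f : M → ℝ) (x : M) (a : TangentSpace (𝓡 n) x) :
    g.inner x (gradient g f x) a = mfderiv (𝓡 n) 𝓘(ℝ, ℝ) f x a :=
  LinearMap.BilinForm.apply_toDual_symm_apply (B := metricForm g x)
    (hB := metricForm_nondegenerate g x) (mfderiv (𝓡 n) 𝓘(ℝ, ℝ) f x).toLinearMap a

/-- The length `|a|_g` of a tangent vector. -/
def tangentNorm (g : Metric n M) (x : M) (a : TangentSpace (𝓡 n) x) : ℝ :=
  √(g.inner x a a)

variable [MeasurableSpace M]

/-- The measure `√(det g_ij) dy` of the chart around `x₀`, transported to `M`; it is carried by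
the domain of the chart. -/
def chartVolume (g : Metric n M) (x₀ : M) : Measure M :=
  (((volume : Measure (EuclideanSpace ℝ (Fin n))).restrict (extChartAt (𝓡 n) x₀).target).withDensity
    (fun y => ENNReal.ofReal √((coordMetric g x₀ y).det))).map (extChartAt (𝓡 n) x₀).symm

/-- The Riemannian measure `dV_g`: the smallest measure dominating `√(det g_ij) dy` in every
chart. As these local measures agree on overlaps, it coincides with each of them on the domain of
the corresponding chart. -/
def vol (g : Metric n M) : Measure M := ⨆ x₀ : M, chartVolume g x₀

/-- `X` is the (weak) gradient of `u ∈ L²(M, g)`: there are smooth functions `φ_k` with `φ_k → u`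
in `L²` and `∇φ_k → X` in `L²`. -/
def HasWeakGradient (g : Metric n M) (u : Lp ℝ 2 (vol g)) (X : Π x : M, TangentSpace (𝓡 n) x) :
    Prop :=
  ∃ φ : ℕ → M → ℝ, (∀ k, ContMDiff (𝓡 n) 𝓘(ℝ, ℝ) ∞ (φ k)) ∧
    Tendsto (fun k => eLpNorm (fun x => φ k x - u x) 2 (vol g)) atTop (𝓝 0) ∧
    (∀ k, MemLp (fun x => tangentNorm g x (gradient g (φ k) x - X x)) 2 (vol g)) ∧
    Tendsto (fun k => eLpNorm (fun x => tangentNorm g x (gradient g (φ k) x - X x)) 2 (vol g))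
      atTop (𝓝 0)

/-- The Sobolev space `H¹(M, g)`: the closure of `C^∞(M)` in the norm
`(‖u‖²_{L²} + ‖∇u‖²_{L²})^{1/2}`, as a set of elements of `L²(M, g)`. -/
def H1 (g : Metric n M) : Set (Lp ℝ 2 (vol g)) := {u | ∃ X, HasWeakGradient g u X}

/-- `H¹_+(M, g) = {u ∈ H¹(M, g) : u > 0}`. -/
def H1pos (g : Metric n M) : Set (Lp ℝ 2 (vol g)) := {u | u ∈ H1 g ∧ ∀ᵐ x ∂(vol g), 0 < u x}

open Classical in
/-- The weak gradient of `u ∈ H¹(M, g)`, unique up to equality almost everywhere. -/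
def weakGradient (g : Metric n M) (u : Lp ℝ 2 (vol g)) : Π x : M, TangentSpace (𝓡 n) x :=
  if hu : ∃ X, HasWeakGradient g u X then hu.choose else 0

/-- `⟨u, v⟩_g = 4 (n-1)/(n-2) ∫ g(∇u, ∇v) dV_g + ∫ R_g u v dV_g`. -/
def form (g : Metric n M) (u v : Lp ℝ 2 (vol g)) : ℝ :=
  4 * ((n : ℝ) - 1) / ((n : ℝ) - 2)
      * ∫ x, g.inner x (weakGradient g u x) (weakGradient g v x) ∂(vol g)
    + ∫ x, scalarCurvature g x * u x * v x ∂(vol g)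

/-- `‖u‖_g = √⟨u, u⟩_g`. -/
def formNorm (g : Metric n M) (u : Lp ℝ 2 (vol g)) : ℝ := √(form g u u)

/-- The norm of `L^q(M, g)`. -/
def normLp (g : Metric n M) (q : ℝ) (u : Lp ℝ 2 (vol g)) : ℝ :=
  lpNorm u (ENNReal.ofReal q) (vol g)

/-- The Yamabe functional `J^g(u) = ⟨u, u⟩_g / ‖u‖²_{L^{2^*}}`. -/
def yamabeFunctional (g : Metric n M) (u : Lp ℝ 2 (vol g)) : ℝ :=
  form g u u / normLp g (critExp n) u ^ 2

/-- The Yamabe invariant `𝒴(M, [g])`, the infimum of `J^g` over `H¹_+(M, g)`. -/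
def yamabeInvariant (g : Metric n M) : ℝ := ⨅ u : H1pos g, yamabeFunctional g u

/-- `v` solves the obstacle problem `min {⟨v, v⟩_h : v ∈ H¹_+(M, h), v ≥ u}`. -/
def IsObstacleSolution (h : Metric n M) (u v : Lp ℝ 2 (vol h)) : Prop :=
  (v ∈ H1pos h ∧ u ≤ v) ∧ ∀ z : Lp ℝ 2 (vol h), z ∈ H1pos h → u ≤ z → form h v v ≤ form h z z

/-- The state map `T_h`: a solution of the obstacle problem with obstacle `u`. -/
def obstacleMap (h : Metric n M) (u : Lp ℝ 2 (vol h)) : Lp ℝ 2 (vol h) :=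
  Classical.epsilon (IsObstacleSolution h u)

/-- The functional `I_p^h(u) = ⟨u, u⟩_h / ‖T_h(u)‖²_{L^{p+1}}`. -/
def controlFunctional (h : Metric n M) (p : ℝ) (u : Lp ℝ 2 (vol h)) : ℝ :=
  form h u u / normLp h (p + 1) (obstacleMap h u) ^ 2

end Manifold

end ConformalObstacle

end

open ConformalObstacle

/-! Everything rests on coercivity: for some c > 0 the form `form h w w` dominates c‖w‖² in L² for
all w in H¹(M,h) (`exists_coercive`). Granted this, the obstacle problem is the minimization of a
positive definite quadratic form over a closed convex set. The constraint v > 0 is automatic, since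
v lies above a positive obstacle. The parallelogram law makes minimizing sequences Cauchy and
minimizers unique (`exists_isObstacleSolution`, `IsObstacleSolution.eq`). A solution also solves the
problem with itself as obstacle, so T_h(T_h(u)) = T_h(u) and the two values of I_p^h have the same
denominator. The monotonicity formula is then an identity, its sign is minimality against the
competitor u, and equality turns u into a minimizer, hence into T_h(u).

Coercivity comes from the Yamabe hypothesis, which concerns the metric g and positive functions
only. The sign is removed by testing with √(φ² + ε²), which dominates |φ|, has no larger gradient,
and changes the curvature term by ε² ∫ R (`yamabeInvariant_mul_le_energy`). The passage to h =
e^{2f} g is conformal covariance: the h-energy of φ is the g-energy of e^{(n-2)f/2} φ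
(`energy_conformal`). Together these bound the L^{2*}(h) norm by the energy; no separate Sobolev
inequality is needed. Finite volume gives the L² bound, and Fatou's lemma carries the estimates from
smooth functions to H¹. The same bound makes the L^{p+1} norm of T_h(u) finite for p + 1 ≤ 2*.

Since curvature and volume are defined by coordinate formulas, covariance requires the chart
independence of the scalar curvature, its conformal transformation law, the behaviour of the volume,
and Green's formula. Since H¹ is defined as a closure and the weak gradient by choice, Green's
formula serves a second time: it shows that the Dirichlet form is closable, so that `form h u u` is
the limit of the energies along every approximating sequence (`IsApprox.tendsto_energy`). -/

noncomputable section

namespace ConformalObstacle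

/-! ### Connections and curvature under a change of coordinates -/

section LocalGeometry

variable {E F : Type*} [NormedAddCommGroup E] [NormedSpace ℝ E]
  [NormedAddCommGroup F] [NormedSpace ℝ F]

/-- `Γ` is the Levi-Civita connection of the field `B` of bilinear forms at `y`. -/
def Koszul (B : E → E →L[ℝ] E →L[ℝ] ℝ) (Γ : E → E →L[ℝ] E →L[ℝ] E) (y : E) : Prop :=
  ∀ a b c, 2 * B y (Γ y a b) c = fderiv ℝ B y a b c + fderiv ℝ B y b a c - fderiv ℝ B y c a b

/-- The curvature `R(a,b)c` of the connection `Γ`. -/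
def riem (Γ : E → E →L[ℝ] E →L[ℝ] E) (y a b c : E) : E :=
  fderiv ℝ Γ y a b c - fderiv ℝ Γ y b a c + Γ y a (Γ y b c) - Γ y b (Γ y a c)

theorem fderiv_apply₂ {T : F → E →L[ℝ] E →L[ℝ] E} {y : F} (h : DifferentiableAt ℝ T y) (a : F)
    (b c : E) : fderiv ℝ (fun z => T z b c) y a = fderiv ℝ T y a b c := by
  have := ((h.hasFDerivAt.clm_apply (hasFDerivAt_const b y)).clm_apply (hasFDerivAt_const c y))
  rw [this.fderiv]; simp

theorem fderiv_apply₂' {T : F → E →L[ℝ] E →L[ℝ] ℝ} {y : F} (h : DifferentiableAt ℝ T y) (a : F)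
    (b c : E) : fderiv ℝ (fun z => T z b c) y a = fderiv ℝ T y a b c := by
  have := ((h.hasFDerivAt.clm_apply (hasFDerivAt_const b y)).clm_apply (hasFDerivAt_const c y))
  rw [this.fderiv]; simp

theorem fderiv_pullback {B B' : E → E →L[ℝ] E →L[ℝ] ℝ} {ψ : E → E} {y : E}
    (hψ : ContDiffAt ℝ 2 ψ y) (hB : DifferentiableAt ℝ B (ψ y)) (hB' : DifferentiableAt ℝ B' y)
    (h : ∀ᶠ z in 𝓝 y, ∀ b c, B' z b c = B (ψ z) (fderiv ℝ ψ z b) (fderiv ℝ ψ z c)) (a b c : E) :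
    fderiv ℝ B' y a b c = fderiv ℝ B (ψ y) (fderiv ℝ ψ y a) (fderiv ℝ ψ y b) (fderiv ℝ ψ y c)
      + B (ψ y) (fderiv ℝ (fderiv ℝ ψ) y a b) (fderiv ℝ ψ y c)
      + B (ψ y) (fderiv ℝ ψ y b) (fderiv ℝ (fderiv ℝ ψ) y a c) := by
  have h1 : HasFDerivAt ψ (fderiv ℝ ψ y) y := (hψ.differentiableAt (by norm_num)).hasFDerivAt
  have h2 : HasFDerivAt (fderiv ℝ ψ) (fderiv ℝ (fderiv ℝ ψ) y) y :=
    ((hψ.fderiv_right (m := 1) (by norm_num)).differentiableAt (by norm_num)).hasFDerivAt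
  have h0 : HasFDerivAt (fun z => B (ψ z)) ((fderiv ℝ B (ψ y)).comp (fderiv ℝ ψ y)) y :=
    HasFDerivAt.comp (G := E →L[ℝ] E →L[ℝ] ℝ) (g := B) y hB.hasFDerivAt h1
  have h3 := (h0.clm_apply (h2.clm_apply (hasFDerivAt_const b y))).clm_apply
    (h2.clm_apply (hasFDerivAt_const c y))
  rw [← fderiv_apply₂' hB', (show (fun z => B' z b c) =ᶠ[𝓝 y] _ from
    h.mono fun z hz => hz b c).fderiv_eq]
  rw [h3.fderiv]
  simp
  ring

/-- Expand the Koszul formula of the pulled back form by the product rule. By symmetry of the second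
derivative, the six terms containing it collapse to twice B(D²ψ(a,b), Dψ c), the inhomogeneous term
of the transformation law. Surjectivity of Dψ makes testing against vectors Dψ c sufficient. -/
theorem koszul_pullback {B B' : E → E →L[ℝ] E →L[ℝ] ℝ} {Γ Γ' : E → E →L[ℝ] E →L[ℝ] E}
    {ψ : E → E} {y : E}
    (hψ : ContDiffAt ℝ 2 ψ y) (hB : DifferentiableAt ℝ B (ψ y)) (hB' : DifferentiableAt ℝ B' y)
    (h : ∀ᶠ z in 𝓝 y, ∀ b c, B' z b c = B (ψ z) (fderiv ℝ ψ z b) (fderiv ℝ ψ z c))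
    (hK : Koszul B Γ (ψ y)) (hK' : Koszul B' Γ' y)
    (hs : ∀ a b, B (ψ y) a b = B (ψ y) b a)
    (hn : ∀ v, (∀ w, B (ψ y) v w = 0) → v = 0)
    (hsurj : Function.Surjective (fderiv ℝ ψ y)) (a b : E) :
    fderiv ℝ ψ y (Γ' y a b) = Γ (ψ y) (fderiv ℝ ψ y a) (fderiv ℝ ψ y b)
      + fderiv ℝ (fderiv ℝ ψ) y a b := by
  have hsym : ∀ a b, fderiv ℝ (fderiv ℝ ψ) y a b = fderiv ℝ (fderiv ℝ ψ) y b a :=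
    fun a b => (hψ.isSymmSndFDerivAt (by simp)).eq a b
  rw [← sub_eq_zero]
  refine hn _ fun w => ?_
  obtain ⟨c, rfl⟩ := hsurj w
  have e1 := hK' a b c
  rw [fderiv_pullback hψ hB hB' h, fderiv_pullback hψ hB hB' h, fderiv_pullback hψ hB hB' h,
    h.self_of_nhds] at e1
  have e2 := hK (fderiv ℝ ψ y a) (fderiv ℝ ψ y b) (fderiv ℝ ψ y c)
  rw [hsym b a, hsym c a, hsym c b, hs (fderiv ℝ ψ y b) (fderiv ℝ (fderiv ℝ ψ) y a c)] at e1
  simp only [map_sub, map_add, FunLike.coe_sub, FunLike.coe_add, Pi.add_apply, Pi.sub_apply]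
  linarith

/-- Differentiating the transformation law of the connection and antisymmetrizing in a and b removes
the third derivative of ψ; the terms with second derivatives cancel against those from the quadratic
part of the curvature. The law must hold near y because it is differentiated. -/
theorem riem_pullback {Γ Γ' : E → E →L[ℝ] E →L[ℝ] E} {ψ : E → E} {y : E}
    (hψ : ContDiffAt ℝ 3 ψ y) (hΓ : DifferentiableAt ℝ Γ (ψ y)) (hΓ' : DifferentiableAt ℝ Γ' y)
    (h : ∀ᶠ z in 𝓝 y, ∀ a b, fderiv ℝ ψ z (Γ' z a b) =
      Γ (ψ z) (fderiv ℝ ψ z a) (fderiv ℝ ψ z b) + fderiv ℝ (fderiv ℝ ψ) z a b) (a b c : E) :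
    fderiv ℝ ψ y (riem Γ' y a b c) =
      riem Γ (ψ y) (fderiv ℝ ψ y a) (fderiv ℝ ψ y b) (fderiv ℝ ψ y c) := by
  have hψ' : ContDiffAt ℝ 2 (fderiv ℝ ψ) y := hψ.fderiv_right (by norm_num)
  have hsym : ∀ a b, fderiv ℝ (fderiv ℝ ψ) y a b = fderiv ℝ (fderiv ℝ ψ) y b a :=
    fun a b => ((hψ.of_le (by norm_num)).isSymmSndFDerivAt (n := 2) (by simp)).eq a b
  have hsym' : ∀ a b, fderiv ℝ (fderiv ℝ (fderiv ℝ ψ)) y a b =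
      fderiv ℝ (fderiv ℝ (fderiv ℝ ψ)) y b a :=
    fun a b => (hψ'.isSymmSndFDerivAt (n := 2) (by simp)).eq a b
  have h1 : HasFDerivAt ψ (fderiv ℝ ψ y) y := (hψ.differentiableAt (by norm_num)).hasFDerivAt
  have h2 : HasFDerivAt (fderiv ℝ ψ) (fderiv ℝ (fderiv ℝ ψ) y) y :=
    (hψ'.differentiableAt (by norm_num)).hasFDerivAt
  have h3 : HasFDerivAt (fderiv ℝ (fderiv ℝ ψ)) (fderiv ℝ (fderiv ℝ (fderiv ℝ ψ)) y) y :=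
    ((hψ'.fderiv_right (m := 1) (by norm_num)).differentiableAt (by norm_num)).hasFDerivAt
  have key : ∀ d a b, fderiv ℝ (fderiv ℝ ψ) y d (Γ' y a b) + fderiv ℝ ψ y (fderiv ℝ Γ' y d a b) =
      fderiv ℝ Γ (ψ y) (fderiv ℝ ψ y d) (fderiv ℝ ψ y a) (fderiv ℝ ψ y b)
      + Γ (ψ y) (fderiv ℝ (fderiv ℝ ψ) y d a) (fderiv ℝ ψ y b)
      + Γ (ψ y) (fderiv ℝ ψ y a) (fderiv ℝ (fderiv ℝ ψ) y d b)
      + fderiv ℝ (fderiv ℝ (fderiv ℝ ψ)) y d a b := by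
    intro d a b
    have l := h2.clm_apply ((hΓ'.hasFDerivAt.clm_apply (hasFDerivAt_const a y)).clm_apply
      (hasFDerivAt_const b y))
    have r := (((hΓ.hasFDerivAt.comp y h1).clm_apply
      (h2.clm_apply (hasFDerivAt_const a y))).clm_apply
      (h2.clm_apply (hasFDerivAt_const b y))).add
      ((h3.clm_apply (hasFDerivAt_const a y)).clm_apply (hasFDerivAt_const b y))
    have := congrArg (fun L => L d) ((l.congr_of_eventuallyEq
      (h.mono fun z hz => (hz a b).symm)).unique r)
    simp at this
    rw [add_comm, this]
    abel
  have h0 := h.self_of_nhds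
  have k1 := key a b c
  have k2 := key b a c
  rw [hsym' a b, hsym a b] at k1
  simp only [riem, map_add, map_sub, h0]
  linear_combination (norm := module) k1 - k2

/-- The endomorphism `a ↦ R(a,b)c`. -/
def riemLin (Γ : E → E →L[ℝ] E →L[ℝ] E) (y b c : E) : E →ₗ[ℝ] E where
  toFun a := riem Γ y a b c
  map_add' a a' := by simp [riem]; abel
  map_smul' t a := by simp [riem, smul_sub, smul_add]

/-- The Ricci curvature of the connection `Γ`. -/
def ric (Γ : E → E →L[ℝ] E →L[ℝ] E) (y b c : E) : ℝ := LinearMap.trace ℝ E (riemLin Γ y b c)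

/-- The curvature endomorphisms are conjugate under Dψ, and the trace is invariant under
conjugation. -/
theorem ric_pullback {Γ Γ' : E → E →L[ℝ] E →L[ℝ] E} {ψ : E → E} {y : E}
    (hψ : ContDiffAt ℝ 3 ψ y) (hΓ : DifferentiableAt ℝ Γ (ψ y)) (hΓ' : DifferentiableAt ℝ Γ' y)
    (h : ∀ᶠ z in 𝓝 y, ∀ a b, fderiv ℝ ψ z (Γ' z a b) =
      Γ (ψ z) (fderiv ℝ ψ z a) (fderiv ℝ ψ z b) + fderiv ℝ (fderiv ℝ ψ) z a b)
    (hbij : Function.Bijective (fderiv ℝ ψ y)) (b c : E) :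
    ric Γ' y b c = ric Γ (ψ y) (fderiv ℝ ψ y b) (fderiv ℝ ψ y c) := by
  let e : E ≃ₗ[ℝ] E := LinearEquiv.ofBijective (fderiv ℝ ψ y).toLinearMap hbij
  rw [ric, ric, ← LinearMap.trace_conj' (riemLin Γ' y b c) e]
  congr 1
  ext a
  obtain ⟨a, rfl⟩ := e.surjective a
  rw [LinearEquiv.conj_apply_apply, e.symm_apply_apply]
  exact riem_pullback hψ hΓ hΓ' h a b c

end LocalGeometry

/-! ### Levi-Civita connection and Ricci curvature under a conformal change -/

section ConformalChange

variable {E : Type*} [NormedAddCommGroup E] [NormedSpace ℝ E]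
  {B : E → E →L[ℝ] E →L[ℝ] ℝ} {Γ Γ' : E → E →L[ℝ] E →L[ℝ] E} {y : E}

theorem Koszul.unique (hK : Koszul B Γ y) (hK' : Koszul B Γ' y)
    (hn : ∀ v, (∀ w, B y v w = 0) → v = 0) (a b : E) : Γ y a b = Γ' y a b := by
  rw [← sub_eq_zero]
  refine hn _ fun c => ?_
  simp only [map_sub, FunLike.coe_sub, Pi.sub_apply]
  linarith [hK a b c, hK' a b c]

theorem fderiv_symm_of_symm (hB : DifferentiableAt ℝ B y)
    (hs : ∀ᶠ z in 𝓝 y, ∀ a b, B z a b = B z b a) (a b c : E) :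
    fderiv ℝ B y a b c = fderiv ℝ B y a c b := by
  rw [← fderiv_apply₂' hB, ← fderiv_apply₂' hB, Filter.EventuallyEq.fderiv_eq]
  exact hs.mono fun z hz => hz b c

theorem Koszul.symm (hK : Koszul B Γ y) (hB : DifferentiableAt ℝ B y)
    (hs : ∀ᶠ z in 𝓝 y, ∀ a b, B z a b = B z b a)
    (hn : ∀ v, (∀ w, B y v w = 0) → v = 0) (a b : E) : Γ y a b = Γ y b a := by
  rw [← sub_eq_zero]
  refine hn _ fun c => ?_
  simp only [map_sub, FunLike.coe_sub, Pi.sub_apply]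
  linarith [hK a b c, hK b a c, fderiv_symm_of_symm hB hs c a b]

/-- The Levi-Civita connection is compatible with the metric. -/
theorem Koszul.fderiv_eq (hK : Koszul B Γ y) (hB : DifferentiableAt ℝ B y)
    (hs : ∀ᶠ z in 𝓝 y, ∀ a b, B z a b = B z b a) (a b c : E) :
    fderiv ℝ B y a b c = B y (Γ y a b) c + B y b (Γ y a c) := by
  rw [hs.self_of_nhds b]
  linarith [hK a b c, hK a c b, fderiv_symm_of_symm hB hs a b c]

/-- The difference of the Levi-Civita connections of `e^{2f} B` and `B`, where `df = l` and the
gradient of `f` is `N`. -/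
def conformalShift (β : E →L[ℝ] E →L[ℝ] ℝ) (l : E →L[ℝ] ℝ) (N : E) : E →L[ℝ] E →L[ℝ] E :=
  l.smulRight (ContinuousLinearMap.id ℝ E) + (l.smulRight (ContinuousLinearMap.id ℝ E)).flip
    - ((ContinuousLinearMap.smulRightL ℝ E E).flip N).comp β

@[simp] theorem conformalShift_apply (β : E →L[ℝ] E →L[ℝ] ℝ) (l : E →L[ℝ] ℝ) (N a b : E) :
    conformalShift β l N a b = l a • b + l b • a - β a b • N := by
  simp [conformalShift]

/-- The derivative of e^{2f}B has the extra terms 2 df ⊗ B, which the shift absorbs: its pairing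
with c is df(a)B(b,c) + df(b)B(a,c) − df(c)B(a,b). -/
theorem Koszul.conformal {f : E → ℝ} (hK : Koszul B Γ y) (hB : DifferentiableAt ℝ B y)
    (hf : DifferentiableAt ℝ f y) {N : E}
    (hN : ∀ a, B y N a = fderiv ℝ f y a) {B' : E → E →L[ℝ] E →L[ℝ] ℝ}
    (hdB' : DifferentiableAt ℝ B' y) (hB' : ∀ᶠ z in 𝓝 y, B' z = Real.exp (2 * f z) • B z)
    (hΓ' : Γ' y = Γ y + conformalShift (B y) (fderiv ℝ f y) N) : Koszul B' Γ' y := by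
  have key : ∀ a b c, fderiv ℝ B' y a b c =
      Real.exp (2 * f y) * (2 * fderiv ℝ f y a * B y b c + fderiv ℝ B y a b c) := by
    intro a b c
    have hBc := (hB.hasFDerivAt.clm_apply (hasFDerivAt_const b y)).clm_apply (hasFDerivAt_const c y)
    have e := ((hf.hasFDerivAt.const_mul 2).exp).mul hBc
    have e' : HasFDerivAt (fun z => B' z b c) _ y := e.congr_of_eventuallyEq
      (hB'.mono fun z hz => by simp [hz])
    rw [← fderiv_apply₂' hdB', e'.fderiv]
    simp
    ring
  intro a b c
  rw [key, key, key, hΓ', hB'.self_of_nhds]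
  have := hK a b c
  simp [hN]
  linear_combination Real.exp (2 * f y) * this

/-- The covariant derivative of the vector field `N` as an endomorphism. -/
def covDeriv (Γ : E → E →L[ℝ] E →L[ℝ] E) (N : E → E) (y : E) : E →L[ℝ] E :=
  fderiv ℝ N y + (Γ y).flip (N y)

/-- The covariant Hessian of `f`. -/
def hess (Γ : E → E →L[ℝ] E →L[ℝ] E) (f : E → ℝ) (y : E) (a b : E) : ℝ :=
  fderiv ℝ (fderiv ℝ f) y a b - fderiv ℝ f y (Γ y a b)

/-- Differentiate B(N,c) = df(c); compatibility of the connection with B turns the derivative of B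
into connection terms. -/
theorem inner_covDeriv {f : E → ℝ} {N : E → E} (hK : Koszul B Γ y) (hB : DifferentiableAt ℝ B y)
    (hs : ∀ᶠ z in 𝓝 y, ∀ a b, B z a b = B z b a)
    (hf : ContDiffAt ℝ 2 f y) (hN : DifferentiableAt ℝ N y)
    (hfN : ∀ᶠ z in 𝓝 y, ∀ a, B z (N z) a = fderiv ℝ f z a) (a c : E) :
    B y (covDeriv Γ N y a) c = hess Γ f y a c := by
  have h2 : HasFDerivAt (fderiv ℝ f) (fderiv ℝ (fderiv ℝ f) y) y :=
    ((hf.fderiv_right (m := 1) (by norm_num)).differentiableAt (by norm_num)).hasFDerivAt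
  have l := (hB.hasFDerivAt.clm_apply hN.hasFDerivAt).clm_apply (hasFDerivAt_const c y)
  have r := h2.clm_apply (hasFDerivAt_const c y)
  have := congrArg (fun L => L a) ((r.congr_of_eventuallyEq (hfN.mono fun z hz => hz c)).unique l)
  simp at this
  rw [hess, this, hK.fderiv_eq hB hs, ← hfN.self_of_nhds]
  simp [covDeriv]
  ring

variable [FiniteDimensional ℝ E]

/-- Transformation of the Ricci curvature under a conformal change of the metric. -/
theorem ric_conformal {f : E → ℝ} {N : E → E} (hK : Koszul B Γ y) (hB : DifferentiableAt ℝ B y)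
    (hΓ : DifferentiableAt ℝ Γ y) (hdΓ' : DifferentiableAt ℝ Γ' y)
    (hs : ∀ᶠ z in 𝓝 y, ∀ a b, B z a b = B z b a)
    (hn : ∀ v, (∀ w, B y v w = 0) → v = 0)
    (hf : ContDiffAt ℝ 2 f y) (hN : DifferentiableAt ℝ N y)
    (hfN : ∀ᶠ z in 𝓝 y, ∀ a, B z (N z) a = fderiv ℝ f z a)
    (hΓ' : ∀ᶠ z in 𝓝 y, Γ' z = Γ z + conformalShift (B z) (fderiv ℝ f z) (N z)) (b c : E) :
    ric Γ' y b c = ric Γ y b c + (2 - Module.finrank ℝ E) * hess Γ f y b c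
      - LinearMap.trace ℝ E (covDeriv Γ N y) * B y b c
      + (Module.finrank ℝ E - 2) * (fderiv ℝ f y b * fderiv ℝ f y c
        - fderiv ℝ f y (N y) * B y b c) := by
  have hΓs := hK.symm hB hs hn
  have hs0 := hs.self_of_nhds
  have hN0 := hfN.self_of_nhds
  have h2 : HasFDerivAt (fderiv ℝ f) (fderiv ℝ (fderiv ℝ f) y) y :=
    ((hf.fderiv_right (m := 1) (by norm_num)).differentiableAt (by norm_num)).hasFDerivAt
  have hsym : ∀ a b, fderiv ℝ (fderiv ℝ f) y a b = fderiv ℝ (fderiv ℝ f) y b a :=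
    fun a b => (hf.isSymmSndFDerivAt (by simp)).eq a b
  have hcompat := hK.fderiv_eq hB hs
  -- the derivative of `Γ'`
  have hD : ∀ a b c, fderiv ℝ Γ' y a b c = fderiv ℝ Γ y a b c
      + (fderiv ℝ (fderiv ℝ f) y a b • c + fderiv ℝ (fderiv ℝ f) y a c • b
        - (fderiv ℝ B y a b c) • N y - B y b c • fderiv ℝ N y a) := by
    intro a b c
    have d : ∀ b, HasFDerivAt (fun z => fderiv ℝ f z b) _ y :=
      fun b => h2.clm_apply (hasFDerivAt_const b y)
    have hBc := (hB.hasFDerivAt.clm_apply (hasFDerivAt_const b y)).clm_apply (hasFDerivAt_const c y)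
    have hΓc := (hΓ.hasFDerivAt.clm_apply (hasFDerivAt_const b y)).clm_apply (hasFDerivAt_const c y)
    have e := hΓc.add ((((d b).smul (hasFDerivAt_const c y)).add
      ((d c).smul (hasFDerivAt_const b y))).sub (hBc.smul hN.hasFDerivAt))
    have e' : HasFDerivAt (fun z => Γ' z b c) _ y := e.congr_of_eventuallyEq
      (hΓ'.mono fun z hz => by simp [hz])
    rw [← fderiv_apply₂ hdΓ']
    rw [e'.fderiv]
    simp
    module
  -- The new curvature endomorphism is the old one plus rank-one maps, a multiple of the identity
  -- and a multiple of the covariant derivative of N. Each of these has an evident trace.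
  have hr : riemLin Γ' y b c = riemLin Γ y b c
      + ((fderiv ℝ (fderiv ℝ f) y).flip c - (fderiv ℝ f y).comp ((Γ y).flip c)
          : E →L[ℝ] ℝ).toLinearMap.smulRight b
      + ((B y).flip c).toLinearMap.smulRight (covDeriv Γ N y b + fderiv ℝ f y (N y) • b
          - fderiv ℝ f y b • N y)
      + (fderiv ℝ f y).toLinearMap.smulRight (B y b c • N y - fderiv ℝ f y c • b)
      + (fderiv ℝ f y b * fderiv ℝ f y c - fderiv ℝ f y (N y) * B y b c - hess Γ f y b c)
          • LinearMap.id
      - B y b c • (covDeriv Γ N y).toLinearMap := by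
    ext a
    simp [riemLin, riem, hD, hΓ'.self_of_nhds, hess, covDeriv, hcompat]
    rw [hΓs b a, hsym b a, hs0 a (Γ y b c), hs0 b (Γ y a c), hs0 a b, hs0 a (N y), hs0 b (N y)]
    simp only [hN0]
    module
  rw [ric, hr]
  simp only [map_add, map_sub, LinearMap.trace_smulRight, map_smul, LinearMap.trace_id, ric]
  have hH := inner_covDeriv hK hB hs hf hN hfN b c
  simp [hH, hN0]
  simp only [hess]
  ring

end ConformalChange

/-! ### Smoothness of determinants and inverses, Jacobi's formula -/

section MatrixCalculus

variable {ι X : Type*} [Fintype ι] [DecidableEq ι] [NormedAddCommGroup X] [NormedSpace ℝ X]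
  {A : X → Matrix ι ι ℝ} {s : Set X} {m : WithTop ℕ∞} {y : X}

theorem contDiffOn_det (h : ∀ i j, ContDiffOn ℝ m (fun z => A z i j) s) :
    ContDiffOn ℝ m (fun z => (A z).det) s := by
  simp only [Matrix.det_apply]
  exact ContDiffOn.sum fun σ _ => (contDiffOn_prod fun i _ => h _ _).const_smul _

/-- By Cramer's rule each entry is a quotient of determinants. -/
theorem contDiffOn_matrix_inv (h : ∀ i j, ContDiffOn ℝ m (fun z => A z i j) s)
    (hd : ∀ z ∈ s, (A z).det ≠ 0) (i j : ι) : ContDiffOn ℝ m (fun z => (A z)⁻¹ i j) s := by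
  simp only [Matrix.inv_def, Matrix.smul_apply, Ring.inverse_eq_inv', smul_eq_mul,
    Matrix.adjugate_apply]
  refine ((contDiffOn_det h).inv hd).mul (contDiffOn_det fun k l => ?_)
  by_cases hk : k = j
  · subst hk; simpa using contDiffOn_const
  · simpa [Matrix.updateRow_ne hk] using h k l

/-- Jacobi's formula for the derivative of the determinant. -/
theorem fderiv_det (h : ∀ i j, DifferentiableAt ℝ (fun z => A z i j) y) (v : X) :
    fderiv ℝ (fun z => (A z).det) y v =
      ∑ i, ∑ j, (A y).adjugate i j * fderiv ℝ (fun z => A z j i) y v := by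
  have hd : HasFDerivAt (fun z => (A z).det) (∑ σ : Equiv.Perm ι, (Equiv.Perm.sign σ) •
      ∑ i, (∏ j ∈ Finset.univ.erase i, A y (σ j) j) • fderiv ℝ (fun z => A z (σ i) i) y) y := by
    simp only [Matrix.det_apply]
    exact HasFDerivAt.fun_sum fun σ _ =>
      (HasFDerivAt.finsetProd fun i _ => (h (σ i) i).hasFDerivAt).const_smul _
  have hc : ∀ i, (∑ j, (A y).adjugate i j * fderiv ℝ (fun z => A z j i) y v)
      = ((A y).updateCol i (fun j => fderiv ℝ (fun z => A z j i) y v)).det := by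
    intro i
    rw [← Matrix.cramer_apply, Matrix.cramer_eq_adjugate_mulVec]
    rfl
  rw [hd.fderiv, Finset.sum_congr rfl fun i _ => hc i]
  simp only [Matrix.det_apply]
  rw [Finset.sum_comm]
  simp only [FunLike.coe_sum, Finset.sum_apply, FunLike.coe_smul, Pi.smul_apply, Finset.smul_sum]
  refine Finset.sum_congr rfl fun σ _ => Finset.sum_congr rfl fun i _ => ?_
  congr 1
  rw [← Finset.mul_prod_erase Finset.univ _ (Finset.mem_univ i), Matrix.updateCol_self, mul_comm,
    smul_eq_mul]
  congr 1
  exact Finset.prod_congr rfl fun j hj => by rw [Matrix.updateCol_ne (Finset.ne_of_mem_erase hj)]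

end MatrixCalculus

/-! ### Bilinear forms given by matrices and their metric traces -/

section Bilinear

variable {n : ℕ}

local notation "𝔼" => EuclideanSpace ℝ (Fin n)

theorem sum_apply_smul_single (a : 𝔼) : ∑ i, a i • (EuclideanSpace.single i 1 : 𝔼) = a := by
  ext j
  simp [Finset.sum_apply, Pi.single_apply]

/-- The bilinear form with matrix `A`. -/
def bilin (A : Matrix (Fin n) (Fin n) ℝ) : 𝔼 →L[ℝ] 𝔼 →L[ℝ] ℝ :=
  ∑ i, ∑ j, A i j • (EuclideanSpace.proj i : 𝔼 →L[ℝ] ℝ).smulRight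
    (EuclideanSpace.proj j : 𝔼 →L[ℝ] ℝ)

theorem bilin_apply (A : Matrix (Fin n) (Fin n) ℝ) (a b : 𝔼) :
    bilin A a b = ∑ i, ∑ j, A i j * (a i * b j) := by
  simp [bilin]

@[simp] theorem bilin_single (A : Matrix (Fin n) (Fin n) ℝ) (i j : Fin n) :
    bilin A (EuclideanSpace.single i 1) (EuclideanSpace.single j 1) = A i j := by
  simp [bilin_apply]

theorem bilin_single_right (A : Matrix (Fin n) (Fin n) ℝ) (a : 𝔼) (j : Fin n) :
    bilin A a (EuclideanSpace.single j 1) = ∑ i, A i j * a i := by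
  simp [bilin_apply]

theorem bilin_comm {A : Matrix (Fin n) (Fin n) ℝ} (h : A.IsSymm) (a b : 𝔼) :
    bilin A a b = bilin A b a := by
  rw [bilin_apply, bilin_apply, Finset.sum_comm]
  refine Finset.sum_congr rfl fun i _ => Finset.sum_congr rfl fun j _ => ?_
  rw [h.apply i j]; ring

theorem bilin_ext {β β' : 𝔼 →L[ℝ] 𝔼 →L[ℝ] ℝ}
    (h : ∀ i j, β (EuclideanSpace.single i 1) (EuclideanSpace.single j 1) =
      β' (EuclideanSpace.single i 1) (EuclideanSpace.single j 1)) : β = β' := by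
  ext a b
  rw [← sum_apply_smul_single a, ← sum_apply_smul_single b]
  simp [h]

/-- The trace of the bilinear form with coefficients `R` with respect to the metric matrix `A`. -/
def metricTrace (A : Matrix (Fin n) (Fin n) ℝ) (R : 𝔼 → 𝔼 → ℝ) : ℝ :=
  ∑ j, ∑ k, A⁻¹ j k * R (EuclideanSpace.single j 1) (EuclideanSpace.single k 1)

theorem trace_eq_sum (T : 𝔼 →ₗ[ℝ] 𝔼) :
    LinearMap.trace ℝ 𝔼 T = ∑ i, T (EuclideanSpace.single i 1) i := by
  rw [LinearMap.trace_eq_sum_inner T (EuclideanSpace.basisFun (Fin n) ℝ)]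
  simp [EuclideanSpace.inner_single_left]

/-- Raising an index turns the contraction with the inverse metric into the trace of an
endomorphism, which no longer depends on a basis. Both the coordinate invariance and the conformal
law of the scalar curvature are computed in this form. -/
theorem metricTrace_eq_trace {A : Matrix (Fin n) (Fin n) ℝ} (h : A.IsSymm) (hd : A.det ≠ 0)
    {R : 𝔼 → 𝔼 → ℝ} {T : 𝔼 →ₗ[ℝ] 𝔼} (hT : ∀ a b, bilin A (T a) b = R a b) :
    metricTrace A R = LinearMap.trace ℝ 𝔼 T := by
  rw [metricTrace, trace_eq_sum]
  refine Finset.sum_congr rfl fun j _ => ?_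
  simp only [← hT, bilin_single_right, Finset.mul_sum]
  rw [Finset.sum_comm]
  have hi : A * A⁻¹ = 1 := Matrix.mul_nonsing_inv A (isUnit_iff_ne_zero.mpr hd)
  have hs : ∀ k, A⁻¹ j k = A⁻¹ k j := fun k =>
    congrFun (congrFun (show (A⁻¹)ᵀ = A⁻¹ by rw [Matrix.transpose_nonsing_inv, h.eq]) k) j
  have : ∀ l, ∑ k, A⁻¹ j k * (A l k * T (EuclideanSpace.single j 1) l)
      = (A * A⁻¹) l j * T (EuclideanSpace.single j 1) l := by
    intro l
    rw [Matrix.mul_apply, Finset.sum_mul]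
    exact Finset.sum_congr rfl fun k _ => by rw [hs]; ring
  simp only [this, hi, Matrix.one_apply]
  simp

/-- The endomorphism which represents a bilinear form with respect to a metric. -/
theorem exists_represent {A : Matrix (Fin n) (Fin n) ℝ} (h : A.IsSymm) (hd : A.det ≠ 0)
    (R : 𝔼 →ₗ[ℝ] 𝔼 →ₗ[ℝ] ℝ) : ∃ T : 𝔼 →ₗ[ℝ] 𝔼, ∀ a b, bilin A (T a) b = R a b := by
  let T : 𝔼 →ₗ[ℝ] 𝔼 := ∑ l, ∑ k, (A⁻¹ l k) •
    (R.flip (EuclideanSpace.single k 1)).smulRight (EuclideanSpace.single l 1 : 𝔼)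
  have hi : A * A⁻¹ = 1 := Matrix.mul_nonsing_inv A (isUnit_iff_ne_zero.mpr hd)
  have hT : ∀ a l, T a l = ∑ k, A⁻¹ l k * R a (EuclideanSpace.single k 1) := by
    intro a l
    simp [T, Finset.sum_apply, Pi.single_apply]
  refine ⟨T, fun a b => ?_⟩
  have hb : ∀ j, bilin A (T a) (EuclideanSpace.single j 1) = R a (EuclideanSpace.single j 1) := by
    intro j
    rw [bilin_single_right]
    simp only [hT, Finset.mul_sum]
    rw [Finset.sum_comm]
    have : ∀ k, ∑ l, A l j * (A⁻¹ l k * R a (EuclideanSpace.single k 1))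
        = (A * A⁻¹) j k * R a (EuclideanSpace.single k 1) := by
      intro k
      rw [Matrix.mul_apply, Finset.sum_mul]
      exact Finset.sum_congr rfl fun l _ => by rw [h.apply j l]; ring
    simp only [this, hi, Matrix.one_apply]
    simp
  rw [← sum_apply_smul_single b]
  simp [hb]

end Bilinear

/-! ### Smooth metrics on open subsets of Euclidean space -/

section CoordinateMetric

variable {n : ℕ}

local notation "𝔼" => EuclideanSpace ℝ (Fin n)

theorem _root_.ContDiffOn.smul_const' {X V : Type*} [NormedAddCommGroup X] [NormedSpace ℝ X]
    [NormedAddCommGroup V] [NormedSpace ℝ V] {m : WithTop ℕ∞} {f : X → ℝ} {s : Set X}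
    (hf : ContDiffOn ℝ m f s) (c : V) : ContDiffOn ℝ m (fun z => f z • c) s :=
  hf.smul contDiffOn_const

theorem eq_of_isLinearMap {p q : 𝔼 → ℝ} (hp : IsLinearMap ℝ p) (hq : IsLinearMap ℝ q)
    (h : ∀ i, p (EuclideanSpace.single i 1) = q (EuclideanSpace.single i 1)) (a : 𝔼) :
    p a = q a := by
  have : hp.mk' p = hq.mk' q := by
    ext a
    rw [← sum_apply_smul_single a]
    simp [h]
  exact LinearMap.congr_fun this a

/-- `G` is the matrix of a smooth Riemannian metric on the open set `U`. -/
structure IsSmoothMetric (G : 𝔼 → Matrix (Fin n) (Fin n) ℝ) (U : Set 𝔼) : Prop where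
  isOpen : IsOpen U
  contDiffOn : ∀ i j, ContDiffOn ℝ ∞ (fun z => G z i j) U
  symm : ∀ z ∈ U, (G z).IsSymm
  pos : ∀ z ∈ U, ∀ a, a ≠ 0 → 0 < bilin (G z) a a

/-- The Christoffel symbols as a bilinear map. -/
def conn (G : 𝔼 → Matrix (Fin n) (Fin n) ℝ) (y : 𝔼) : 𝔼 →L[ℝ] 𝔼 →L[ℝ] 𝔼 :=
  ∑ k, ∑ i, ∑ j, christoffel G k i j y • (EuclideanSpace.proj i : 𝔼 →L[ℝ] ℝ).smulRight
    ((EuclideanSpace.proj j : 𝔼 →L[ℝ] ℝ).smulRight (EuclideanSpace.single k 1 : 𝔼))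

theorem conn_single (G : 𝔼 → Matrix (Fin n) (Fin n) ℝ) (y : 𝔼) (i j k : Fin n) :
    conn G y (EuclideanSpace.single i 1) (EuclideanSpace.single j 1) k = christoffel G k i j y := by
  simp [conn, Finset.sum_apply, Pi.single_apply]

theorem contDiffOn_pd {f : 𝔼 → ℝ} {U : Set 𝔼} (hU : IsOpen U) (hf : ContDiffOn ℝ ∞ f U)
    (i : Fin n) : ContDiffOn ℝ ∞ (pd i f) U :=
  (hf.fderiv_of_isOpen hU (by simp)).clm_apply contDiffOn_const

/-- The gradient of `f` in coordinates. -/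
def coordGrad (G : 𝔼 → Matrix (Fin n) (Fin n) ℝ) (f : 𝔼 → ℝ) (y : 𝔼) : 𝔼 :=
  WithLp.toLp 2 (fun i => ∑ j, (G y)⁻¹ i j * pd j f y)

/-- The Laplacian of `f` in coordinates. -/
def coordLap (G : 𝔼 → Matrix (Fin n) (Fin n) ℝ) (f : 𝔼 → ℝ) (y : 𝔼) : ℝ :=
  LinearMap.trace ℝ 𝔼 (covDeriv (conn G) (coordGrad G f) y)

namespace IsSmoothMetric

variable {G : EuclideanSpace ℝ (Fin n) → Matrix (Fin n) (Fin n) ℝ}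
  {U : Set (EuclideanSpace ℝ (Fin n))} {f : EuclideanSpace ℝ (Fin n) → ℝ}
  {y : EuclideanSpace ℝ (Fin n)}

theorem det_pos (hG : IsSmoothMetric G U) (hy : y ∈ U) : 0 < (G y).det := by
  refine Matrix.PosDef.det_pos (Matrix.PosDef.of_dotProduct_mulVec_pos ?_ fun {x} hx => ?_)
  · rw [Matrix.IsHermitian, Matrix.conjTranspose_eq_transpose_of_trivial]
    exact hG.symm y hy
  · have := hG.pos y hy (WithLp.toLp 2 x) (by simpa using hx)
    rw [bilin_apply] at this
    have e : star x ⬝ᵥ G y *ᵥ x = ∑ i, ∑ j, G y i j * (x i * x j) := by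
      simp only [dotProduct, Matrix.mulVec, Finset.mul_sum]
      refine Finset.sum_congr rfl fun i _ => Finset.sum_congr rfl fun j _ => ?_
      simp
      ring
    rw [e]
    exact this

theorem nondegenerate (hG : IsSmoothMetric G U) (hy : y ∈ U) (v : 𝔼)
    (h : ∀ w, bilin (G y) v w = 0) : v = 0 := by
  by_contra hv
  exact (hG.pos y hy v hv).ne' (h v)

theorem contDiffOn_inv (hG : IsSmoothMetric G U) (i j : Fin n) :
    ContDiffOn ℝ ∞ (fun z => (G z)⁻¹ i j) U :=
  contDiffOn_matrix_inv hG.contDiffOn (fun _ hz => (hG.det_pos hz).ne') i j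

theorem contDiffOn_christoffel (hG : IsSmoothMetric G U) (k i j : Fin n) :
    ContDiffOn ℝ ∞ (christoffel G k i j) U :=
  contDiffOn_const.mul (ContDiffOn.sum fun l _ => (hG.contDiffOn_inv k l).mul
    (((contDiffOn_pd hG.isOpen (hG.contDiffOn j l) i).add
      (contDiffOn_pd hG.isOpen (hG.contDiffOn i l) j)).sub
      (contDiffOn_pd hG.isOpen (hG.contDiffOn i j) l)))

theorem contDiffOn_bilin (hG : IsSmoothMetric G U) :
    ContDiffOn ℝ ∞ (fun z => bilin (G z)) U :=
  ContDiffOn.sum fun i _ => ContDiffOn.sum fun j _ => (hG.contDiffOn i j).smul_const' _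

theorem contDiffOn_conn (hG : IsSmoothMetric G U) : ContDiffOn ℝ ∞ (conn G) U :=
  ContDiffOn.sum fun k _ => ContDiffOn.sum fun i _ => ContDiffOn.sum fun j _ =>
    (hG.contDiffOn_christoffel k i j).smul_const' _

theorem differentiableAt_bilin (hG : IsSmoothMetric G U) (hy : y ∈ U) :
    DifferentiableAt ℝ (fun z => bilin (G z)) y :=
  (hG.contDiffOn_bilin.contDiffAt (hG.isOpen.mem_nhds hy)).differentiableAt (by simp)

theorem differentiableAt_conn (hG : IsSmoothMetric G U) (hy : y ∈ U) :
    DifferentiableAt ℝ (conn G) y :=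
  (hG.contDiffOn_conn.contDiffAt (hG.isOpen.mem_nhds hy)).differentiableAt (by simp)

theorem differentiableAt (hG : IsSmoothMetric G U) (hy : y ∈ U) (i j : Fin n) :
    DifferentiableAt ℝ (fun z => G z i j) y :=
  ((hG.contDiffOn i j).contDiffAt (hG.isOpen.mem_nhds hy)).differentiableAt (by simp)

theorem fderiv_bilin_single (hG : IsSmoothMetric G U) (hy : y ∈ U) (a : 𝔼) (i j : Fin n) :
    fderiv ℝ (fun z => bilin (G z)) y a (EuclideanSpace.single i 1) (EuclideanSpace.single j 1)
      = fderiv ℝ (fun z => G z i j) y a := by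
  rw [← fderiv_apply₂' (hG.differentiableAt_bilin hy)]
  simp

theorem mul_inv (hG : IsSmoothMetric G U) (hy : y ∈ U) : G y * (G y)⁻¹ = 1 :=
  Matrix.mul_nonsing_inv _ (isUnit_iff_ne_zero.mpr (hG.det_pos hy).ne')

theorem inv_mul (hG : IsSmoothMetric G U) (hy : y ∈ U) : (G y)⁻¹ * G y = 1 :=
  Matrix.nonsing_inv_mul _ (isUnit_iff_ne_zero.mpr (hG.det_pos hy).ne')

theorem eventually_symm (hG : IsSmoothMetric G U) (hy : y ∈ U) :
    ∀ᶠ z in 𝓝 y, ∀ a b, bilin (G z) a b = bilin (G z) b a :=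
  (hG.isOpen.eventually_mem hy).mono fun z hz => bilin_comm (hG.symm z hz)

/-- On basis vectors this is the definition of the Christoffel symbols multiplied by the metric;
both sides are linear in each argument, so the identity is extended one slot at a time. -/
theorem koszul (hG : IsSmoothMetric G U) (hy : y ∈ U) :
    Koszul (fun z => bilin (G z)) (conn G) y := by
  have key : ∀ i j m : Fin n, 2 * bilin (G y) (conn G y (EuclideanSpace.single i 1)
      (EuclideanSpace.single j 1)) (EuclideanSpace.single m 1) =
      pd i (fun z => G z j m) y + pd j (fun z => G z i m) y - pd m (fun z => G z i j) y := by
    intro i j m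
    rw [bilin_single_right]
    simp only [conn_single, christoffel, Finset.mul_sum]
    rw [Finset.sum_comm]
    have : ∀ l, ∑ k, 2 * (G y k m * (1 / 2 * ((G y)⁻¹ k l * (pd i (fun z => G z j l) y
        + pd j (fun z => G z i l) y - pd l (fun z => G z i j) y))))
        = (G y * (G y)⁻¹) m l * (pd i (fun z => G z j l) y
        + pd j (fun z => G z i l) y - pd l (fun z => G z i j) y) := by
      intro l
      rw [Matrix.mul_apply, Finset.sum_mul]
      exact Finset.sum_congr rfl fun k _ => by rw [(hG.symm y hy).apply m k]; ring
    simp only [this, hG.mul_inv hy, Matrix.one_apply]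
    simp
  intro a b c
  set D := fderiv ℝ (fun z => bilin (G z)) y with hD
  have h1 : ∀ i j (c : 𝔼), 2 * bilin (G y) (conn G y (EuclideanSpace.single i 1)
      (EuclideanSpace.single j 1)) c = D (EuclideanSpace.single i 1) (EuclideanSpace.single j 1) c
      + D (EuclideanSpace.single j 1) (EuclideanSpace.single i 1) c
      - D c (EuclideanSpace.single i 1) (EuclideanSpace.single j 1) := by
    intro i j c
    refine eq_of_isLinearMap
      (p := fun c => 2 * bilin (G y) (conn G y (EuclideanSpace.single i 1)
        (EuclideanSpace.single j 1)) c)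
      (q := fun c => D (EuclideanSpace.single i 1) (EuclideanSpace.single j 1) c
        + D (EuclideanSpace.single j 1) (EuclideanSpace.single i 1) c
        - D c (EuclideanSpace.single i 1) (EuclideanSpace.single j 1))
      ⟨?_, ?_⟩ ⟨?_, ?_⟩ (fun m => ?_) c
    iterate 4 (intros; simp; ring)
    simp only [key, hD, hG.fderiv_bilin_single hy, pd]
  have h2 : ∀ i (b c : 𝔼), 2 * bilin (G y) (conn G y (EuclideanSpace.single i 1) b) c
      = D (EuclideanSpace.single i 1) b c + D b (EuclideanSpace.single i 1) c
      - D c (EuclideanSpace.single i 1) b := by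
    intro i b c
    refine eq_of_isLinearMap
      (p := fun b => 2 * bilin (G y) (conn G y (EuclideanSpace.single i 1) b) c)
      (q := fun b => D (EuclideanSpace.single i 1) b c + D b (EuclideanSpace.single i 1) c
        - D c (EuclideanSpace.single i 1) b) ⟨?_, ?_⟩ ⟨?_, ?_⟩ (fun m => h1 i m c) b
    iterate 4 (intros; simp; ring)
  refine eq_of_isLinearMap (p := fun a => 2 * bilin (G y) (conn G y a b) c)
    (q := fun a => D a b c + D b a c - D c a b) ⟨?_, ?_⟩ ⟨?_, ?_⟩ (fun m => h2 m b c) a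
  iterate 4 (intros; simp; ring)

end IsSmoothMetric

end CoordinateMetric

/-! ### Scalar curvature and Laplacian in coordinates -/

section ScalarCurvature

variable {n : ℕ}

local notation "𝔼" => EuclideanSpace ℝ (Fin n)

/-- The Ricci curvature as a bilinear map. -/
def ricL {E : Type*} [NormedAddCommGroup E] [NormedSpace ℝ E] (Γ : E → E →L[ℝ] E →L[ℝ] E) (y : E) :
    E →ₗ[ℝ] E →ₗ[ℝ] ℝ :=
  LinearMap.mk₂ ℝ (ric Γ y)
    (fun b b' c => by
      rw [ric, ric, ric, ← map_add]; congr 1; ext a; simp [riemLin, riem]; abel)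
    (fun t b c => by
      rw [ric, ric, ← map_smul]; congr 1; ext a; simp [riemLin, riem]; module)
    (fun b c c' => by
      rw [ric, ric, ric, ← map_add]; congr 1; ext a; simp [riemLin, riem]; abel)
    (fun t b c => by
      rw [ric, ric, ← map_smul]; congr 1; ext a; simp [riemLin, riem]; module)

theorem conn_single_eq (G : 𝔼 → Matrix (Fin n) (Fin n) ℝ) (y : 𝔼) (i j : Fin n) :
    conn G y (EuclideanSpace.single i 1) (EuclideanSpace.single j 1) =
      ∑ k, christoffel G k i j y • (EuclideanSpace.single k 1 : 𝔼) := by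
  rw [← sum_apply_smul_single (conn G y _ _)]
  simp only [conn_single]

namespace IsSmoothMetric

variable {G G' : EuclideanSpace ℝ (Fin n) → Matrix (Fin n) (Fin n) ℝ}
  {U U' : Set (EuclideanSpace ℝ (Fin n))} {f : EuclideanSpace ℝ (Fin n) → ℝ}
  {y : EuclideanSpace ℝ (Fin n)}

theorem fderiv_conn_single (hG : IsSmoothMetric G U) (hy : y ∈ U) (i j k l : Fin n) :
    fderiv ℝ (conn G) y (EuclideanSpace.single i 1) (EuclideanSpace.single j 1)
      (EuclideanSpace.single k 1) l = pd i (christoffel G l j k) y := by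
  have h := hG.differentiableAt_conn hy
  have h1 := ((h.hasFDerivAt.clm_apply (hasFDerivAt_const (EuclideanSpace.single j (1 : ℝ)) y)).clm_apply
    (hasFDerivAt_const (EuclideanSpace.single k (1 : ℝ)) y))
  have h2 := (EuclideanSpace.proj l : 𝔼 →L[ℝ] ℝ).hasFDerivAt.comp y h1
  have h3 : christoffel G l j k = (EuclideanSpace.proj l : 𝔼 →L[ℝ] ℝ) ∘ fun z =>
      conn G z (EuclideanSpace.single j 1) (EuclideanSpace.single k 1) := by
    ext z
    simp [conn_single]
  rw [pd, h3, h2.fderiv]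
  simp

theorem ricci_eq (hG : IsSmoothMetric G U) (hy : y ∈ U) (j k : Fin n) :
    ricci G j k y = ric (conn G) y (EuclideanSpace.single j 1) (EuclideanSpace.single k 1) := by
  rw [ric, trace_eq_sum, ricci]
  refine Finset.sum_congr rfl fun i _ => ?_
  simp only [riemLin, riem, LinearMap.coe_mk, AddHom.coe_mk, PiLp.add_apply, PiLp.sub_apply,
    hG.fderiv_conn_single hy]
  rw [conn_single_eq G y j k, conn_single_eq G y i k]
  simp only [map_sum, map_smul, WithLp.ofLp_sum, Finset.sum_apply,
    WithLp.ofLp_smul, Pi.smul_apply, conn_single, smul_eq_mul, Finset.sum_sub_distrib]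
  simp only [mul_comm]
  ring

theorem coordScalar_eq (hG : IsSmoothMetric G U) (hy : y ∈ U) :
    coordScalar G y = metricTrace (G y) (ric (conn G) y) := by
  simp only [coordScalar, metricTrace, hG.ricci_eq hy]

/-- The scalar curvature is invariant under changes of coordinates. -/
theorem coordScalar_pullback (hG : IsSmoothMetric G U) (hG' : IsSmoothMetric G' U')
    {ψ : 𝔼 → 𝔼} (hψ : ContDiffOn ℝ ∞ ψ U') (hU : Set.MapsTo ψ U' U)
    (h : ∀ z ∈ U', ∀ a b, bilin (G' z) a b = bilin (G (ψ z)) (fderiv ℝ ψ z a) (fderiv ℝ ψ z b))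
    (hy : y ∈ U') : coordScalar G' y = coordScalar G (ψ y) := by
  -- A vector killed by Dψ would have length zero for G', so positivity gives injectivity.
  have hinj : ∀ z ∈ U', Function.Bijective (fderiv ℝ ψ z) := by
    intro z hz
    have : Function.Injective (fderiv ℝ ψ z).toLinearMap := by
      rw [← LinearMap.ker_eq_bot, LinearMap.ker_eq_bot']
      intro a ha
      by_contra h0
      have := hG'.pos z hz a h0
      rw [h z hz, show fderiv ℝ ψ z a = 0 from ha] at this
      simp at this
    exact ⟨this, LinearMap.surjective_of_injective this⟩
  have hc : ∀ z ∈ U', ContDiffAt ℝ ∞ ψ z := fun z hz => hψ.contDiffAt (hG'.isOpen.mem_nhds hz)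
  have hΓ : ∀ z ∈ U', ∀ a b, fderiv ℝ ψ z (conn G' z a b) =
      conn G (ψ z) (fderiv ℝ ψ z a) (fderiv ℝ ψ z b) + fderiv ℝ (fderiv ℝ ψ) z a b := by
    intro z hz
    exact koszul_pullback (contDiffAt_infty.1 (hc z hz) 2)
      (hG.differentiableAt_bilin (hU hz)) (hG'.differentiableAt_bilin hz)
      ((hG'.isOpen.eventually_mem hz).mono fun w hw => h w hw) (hG.koszul (hU hz)) (hG'.koszul hz)
      (hG.eventually_symm (hU hz)).self_of_nhds (hG.nondegenerate (hU hz)) (hinj z hz).2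
  have hric := ric_pullback (contDiffAt_infty.1 (hc y hy) 3)
    (hG.differentiableAt_conn (hU hy)) (hG'.differentiableAt_conn hy)
    ((hG'.isOpen.eventually_mem hy).mono fun w hw => hΓ w hw) (hinj y hy)
  rw [hG.coordScalar_eq (hU hy), hG'.coordScalar_eq hy]
  -- With the index raised, the Ricci forms in the two coordinate systems are represented by
  -- endomorphisms conjugate under Dψ.
  obtain ⟨T, hT⟩ := exists_represent (hG.symm _ (hU hy)) (hG.det_pos (hU hy)).ne'
    (ricL (conn G) (ψ y))
  replace hT : ∀ a b, bilin (G (ψ y)) (T a) b = ric (conn G) (ψ y) a b := hT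
  let e : 𝔼 ≃ₗ[ℝ] 𝔼 := LinearEquiv.ofBijective (fderiv ℝ ψ y).toLinearMap (hinj y hy)
  rw [metricTrace_eq_trace (hG.symm _ (hU hy)) (hG.det_pos (hU hy)).ne' hT,
    ← LinearMap.trace_conj' T e.symm]
  refine metricTrace_eq_trace (hG'.symm _ hy) (hG'.det_pos hy).ne' fun a b => ?_
  rw [h y hy, hric, LinearEquiv.conj_apply_apply]
  have he : ∀ a, fderiv ℝ ψ y (e.symm a) = a := e.apply_symm_apply
  rw [he]
  exact hT _ _

theorem contDiffOn_coordGrad (hG : IsSmoothMetric G U) (hf : ContDiffOn ℝ ∞ f U) :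
    ContDiffOn ℝ ∞ (coordGrad G f) U :=
  contDiffOn_euclidean.2 fun i => ContDiffOn.sum (s := Finset.univ) fun j _ =>
    (hG.contDiffOn_inv i j).mul (contDiffOn_pd hG.isOpen hf j)

theorem bilin_coordGrad (hG : IsSmoothMetric G U) (hy : y ∈ U) (f : 𝔼 → ℝ) (a : 𝔼) :
    bilin (G y) (coordGrad G f y) a = fderiv ℝ f y a := by
  refine eq_of_isLinearMap (p := fun a => bilin (G y) (coordGrad G f y) a)
    (q := fun a => fderiv ℝ f y a) ⟨by simp, by simp⟩ ⟨by simp, by simp⟩ (fun j => ?_) a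
  simp only [bilin_single_right, coordGrad, Finset.mul_sum]
  rw [Finset.sum_comm]
  have : ∀ k, ∑ i, G y i j * ((G y)⁻¹ i k * pd k f y) = (G y * (G y)⁻¹) j k * pd k f y := by
    intro k
    rw [Matrix.mul_apply, Finset.sum_mul]
    exact Finset.sum_congr rfl fun i _ => by rw [(hG.symm y hy).apply j i]; ring
  simp only [this, hG.mul_inv hy, Matrix.one_apply]
  simp [pd]

theorem bilin_smul (t : ℝ) (A : Matrix (Fin n) (Fin n) ℝ) : bilin (t • A) = t • bilin A :=
  bilin_ext fun i j => by simp

theorem conformal (hG : IsSmoothMetric G U) (hf : ContDiffOn ℝ ∞ f U)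
    (hG' : ∀ z ∈ U, G' z = Real.exp (2 * f z) • G z) : IsSmoothMetric G' U where
  isOpen := hG.isOpen
  contDiffOn i j := ContDiffOn.congr (((contDiffOn_const (c := (2 : ℝ))).mul hf).exp.mul (hG.contDiffOn i j))
    fun z hz => by simp [hG' z hz]
  symm z hz := by rw [hG' z hz]; exact (hG.symm z hz).smul _
  pos z hz a ha := by
    rw [hG' z hz, bilin_smul]
    exact mul_pos (Real.exp_pos _) (hG.pos z hz a ha)

/-- Transformation of the scalar curvature under a conformal change of the metric. -/
theorem coordScalar_conformal (hG : IsSmoothMetric G U) (hf : ContDiffOn ℝ ∞ f U)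
    (hG' : ∀ z ∈ U, G' z = Real.exp (2 * f z) • G z) (hy : y ∈ U) :
    coordScalar G' y = Real.exp (-(2 * f y)) * (coordScalar G y
      - 2 * ((n : ℝ) - 1) * coordLap G f y
      - ((n : ℝ) - 1) * ((n : ℝ) - 2) * fderiv ℝ f y (coordGrad G f y)) := by
  have hm := hG.conformal hf hG'
  have hfc : ∀ z ∈ U, ContDiffAt ℝ ∞ f z := fun z hz => hf.contDiffAt (hG.isOpen.mem_nhds hz)
  have hN : ∀ z ∈ U, DifferentiableAt ℝ (coordGrad G f) z := fun z hz =>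
    ((hG.contDiffOn_coordGrad hf).contDiffAt (hG.isOpen.mem_nhds hz)).differentiableAt (by simp)
  -- Both sides satisfy the Koszul formula of G', which determines the connection.
  have hΓ : ∀ z ∈ U, conn G' z =
      conn G z + conformalShift (bilin (G z)) (fderiv ℝ f z) (coordGrad G f z) := by
    intro z hz
    have := Koszul.conformal (Γ' := fun z => conn G z +
      conformalShift (bilin (G z)) (fderiv ℝ f z) (coordGrad G f z)) (hG.koszul hz)
      (hG.differentiableAt_bilin hz) ((hfc z hz).differentiableAt (by simp))
      (hG.bilin_coordGrad hz f) (hm.differentiableAt_bilin hz)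
      ((hG.isOpen.eventually_mem hz).mono fun w hw => by rw [hG' w hw, bilin_smul]) rfl
    ext1 a; ext1 b
    exact (hm.koszul hz).unique this (hm.nondegenerate hz) a b
  have hric := ric_conformal (Γ' := conn G') (f := f) (N := coordGrad G f) (hG.koszul hy)
    (hG.differentiableAt_bilin hy) (hG.differentiableAt_conn hy) (hm.differentiableAt_conn hy)
    (hG.eventually_symm hy) (hG.nondegenerate hy)
    (contDiffAt_infty.1 (hfc y hy) 2) (hN y hy)
    ((hG.isOpen.eventually_mem hy).mono fun w hw => hG.bilin_coordGrad hw f)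
    ((hG.isOpen.eventually_mem hy).mono fun w hw => hΓ w hw)
  have hsy := hG.symm y hy
  have hdy := (hG.det_pos hy).ne'
  have tH : metricTrace (G y) (hess (conn G) f y) = coordLap G f y :=
    metricTrace_eq_trace hsy hdy fun a b => inner_covDeriv (hG.koszul hy)
      (hG.differentiableAt_bilin hy) (hG.eventually_symm hy)
      (contDiffAt_infty.1 (hfc y hy) 2) (hN y hy)
      ((hG.isOpen.eventually_mem hy).mono fun w hw => hG.bilin_coordGrad hw f) a b
  have tB : metricTrace (G y) (fun a b => bilin (G y) a b) = n := by
    rw [metricTrace_eq_trace hsy hdy (T := LinearMap.id) (R := fun a b => bilin (G y) a b)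
      fun a b => rfl]
    simp
  have tN : metricTrace (G y) (fun a b => fderiv ℝ f y a * fderiv ℝ f y b)
      = fderiv ℝ f y (coordGrad G f y) := by
    rw [metricTrace_eq_trace hsy hdy
      (T := (fderiv ℝ f y).toLinearMap.smulRight (coordGrad G f y)) fun a b => ?_]
    · simp
    · simp [hG.bilin_coordGrad hy f]
  have hinv : (G' y)⁻¹ = Real.exp (-(2 * f y)) • (G y)⁻¹ := by
    refine Matrix.inv_eq_left_inv ?_
    rw [hG' y hy, Matrix.smul_mul, Matrix.mul_smul, hG.inv_mul hy, smul_smul, ← Real.exp_add]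
    simp
  have hlap : LinearMap.trace ℝ 𝔼 (covDeriv (conn G) (coordGrad G f) y) = coordLap G f y := rfl
  rw [hm.coordScalar_eq hy, hG.coordScalar_eq hy]
  have hfr : (Module.finrank ℝ 𝔼 : ℝ) = n := by simp
  rw [hfr] at hric
  have e : metricTrace (G' y) (ric (conn G') y) = Real.exp (-(2 * f y)) *
      (metricTrace (G y) (ric (conn G) y) + (2 - n) * metricTrace (G y) (hess (conn G) f y)
        - coordLap G f y * metricTrace (G y) (fun a b => bilin (G y) a b)
        + (n - 2) * (metricTrace (G y) (fun a b => fderiv ℝ f y a * fderiv ℝ f y b)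
          - fderiv ℝ f y (coordGrad G f y) * metricTrace (G y) (fun a b => bilin (G y) a b))) := by
    simp only [metricTrace, hric, hinv, hlap, Matrix.smul_apply, smul_eq_mul, Finset.mul_sum,
      ← Finset.sum_add_distrib, ← Finset.sum_sub_distrib]
    refine Finset.sum_congr rfl fun i _ => Finset.sum_congr rfl fun j _ => ?_
    ring
  rw [e, tH, tB, tN]
  ring

/-- The divergence form of the Laplacian. It holds because Jacobi's formula makes the logarithmic
derivative of √det G equal to the contracted Christoffel symbol. It yields both the integration by
parts and the smoothness of the Laplacian. -/
theorem sqrt_det_mul_coordLap (hG : IsSmoothMetric G U) (hf : ContDiffOn ℝ ∞ f U) (hy : y ∈ U) :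
    ∑ i, pd i (fun z => √((G z).det) * coordGrad G f z i) y = √((G y).det) * coordLap G f y := by
  have hN : DifferentiableAt ℝ (coordGrad G f) y :=
    ((hG.contDiffOn_coordGrad hf).contDiffAt (hG.isOpen.mem_nhds hy)).differentiableAt (by simp)
  have hd : DifferentiableAt ℝ (fun z => (G z).det) y :=
    ((contDiffOn_det hG.contDiffOn).contDiffAt (hG.isOpen.mem_nhds hy)).differentiableAt (by simp)
  have hdp := hG.det_pos hy
  have hNi : ∀ i, HasFDerivAt (fun z => coordGrad G f z i)
      ((EuclideanSpace.proj i : 𝔼 →L[ℝ] ℝ).comp (fderiv ℝ (coordGrad G f) y)) y := fun i =>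
    (EuclideanSpace.proj i : 𝔼 →L[ℝ] ℝ).hasFDerivAt.comp y hN.hasFDerivAt
  have hsq := hd.hasFDerivAt.sqrt hdp.ne'
  have hpd : ∀ i, pd i (fun z => √((G z).det) * coordGrad G f z i) y =
      √((G y).det) * (fderiv ℝ (coordGrad G f) y (EuclideanSpace.single i 1) i
        + (∑ k, christoffel G k k i y) * coordGrad G f y i) := by
    intro i
    -- In the contraction, the first and third derivative terms cancel by symmetry of G and of its
    -- inverse.
    have hΓ : ∑ k, christoffel G k k i y
        = (1 / 2) * ∑ k, ∑ l, (G y)⁻¹ k l * pd i (fun z => G z l k) y := by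
      simp only [christoffel, ← Finset.mul_sum]
      congr 1
      have e1 : ∀ k l, (G y)⁻¹ k l * (pd k (fun z => G z i l) y + pd i (fun z => G z k l) y
          - pd l (fun z => G z k i) y) = (G y)⁻¹ k l * pd k (fun z => G z i l) y
          + (G y)⁻¹ k l * pd i (fun z => G z k l) y - (G y)⁻¹ k l * pd l (fun z => G z k i) y := by
        intros; ring
      simp only [e1, Finset.sum_add_distrib, Finset.sum_sub_distrib]
      have hsymm : ∀ k l, (G y)⁻¹ k l = (G y)⁻¹ l k := fun k l =>
        congrFun (congrFun (show ((G y)⁻¹)ᵀ = (G y)⁻¹ by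
          rw [Matrix.transpose_nonsing_inv, (hG.symm y hy).eq]) l) k
      have hGs : ∀ m k l, pd m (fun z => G z k l) y = pd m (fun z => G z l k) y := by
        intro m k l
        rw [pd, pd, Filter.EventuallyEq.fderiv_eq]
        exact (hG.isOpen.eventually_mem hy).mono fun z hz => (hG.symm z hz).apply l k
      have e2 : ∑ k, ∑ l, (G y)⁻¹ k l * pd l (fun z => G z k i) y
          = ∑ k, ∑ l, (G y)⁻¹ k l * pd k (fun z => G z i l) y := by
        rw [Finset.sum_comm]
        refine Finset.sum_congr rfl fun k _ => Finset.sum_congr rfl fun l _ => ?_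
        rw [hsymm, hGs]
      rw [e2]
      have e3 : ∑ k, ∑ l, (G y)⁻¹ k l * pd i (fun z => G z k l) y
          = ∑ k, ∑ l, (G y)⁻¹ k l * pd i (fun z => G z l k) y :=
        Finset.sum_congr rfl fun k _ => Finset.sum_congr rfl fun l _ => by rw [hGs]
      rw [e3]
      ring
    have hdet : fderiv ℝ (fun z => (G z).det) y (EuclideanSpace.single i 1)
        = (G y).det * ∑ k, ∑ l, (G y)⁻¹ k l * pd i (fun z => G z l k) y := by
      rw [fderiv_det (hG.differentiableAt hy)]
      simp only [Finset.mul_sum]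
      refine Finset.sum_congr rfl fun k _ => Finset.sum_congr rfl fun l _ => ?_
      rw [Matrix.inv_def, Matrix.smul_apply, Ring.inverse_eq_inv', smul_eq_mul, pd]
      field_simp
    have hprod : HasFDerivAt (fun z => √((G z).det) * coordGrad G f z i) _ y := hsq.mul (hNi i)
    rw [pd, hprod.fderiv, hΓ]
    simp [hdet]
    have hs : √((G y).det) ≠ 0 := (Real.sqrt_pos.2 hdp).ne'
    have hs2 : (G y).det = √((G y).det) * √((G y).det) := (Real.mul_self_sqrt hdp.le).symm
    generalize (∑ k, ∑ l, (G y)⁻¹ k l * pd i (fun z => G z l k) y) = S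
    field_simp
    rw [Real.sq_sqrt hdp.le]
    ring
  simp only [hpd, ← Finset.mul_sum, coordLap, trace_eq_sum]
  congr 1
  rw [Finset.sum_add_distrib]
  have hc : ∀ i, (covDeriv (conn G) (coordGrad G f) y : 𝔼 →ₗ[ℝ] 𝔼) (EuclideanSpace.single i 1) i
      = fderiv ℝ (coordGrad G f) y (EuclideanSpace.single i 1) i
        + ∑ k, christoffel G i i k y * coordGrad G f y k := by
    intro i
    have : conn G y (EuclideanSpace.single i 1) (coordGrad G f y) i
        = ∑ k, christoffel G i i k y * coordGrad G f y k := by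
      conv_lhs => rw [← sum_apply_smul_single (coordGrad G f y)]
      simp [conn_single, mul_comm]
    rw [← this]
    simp [covDeriv]
  simp only [hc, Finset.sum_add_distrib]
  congr 1
  rw [Finset.sum_comm]
  exact Finset.sum_congr rfl fun i _ => Finset.sum_mul _ _ _

end IsSmoothMetric

end ScalarCurvature

/-! ### Charts: coordinate frames, the metric matrix and transition maps -/

section Charts

variable {n : ℕ} {M : Type*} [TopologicalSpace M] [ChartedSpace (EuclideanSpace ℝ (Fin n)) M]
  [IsManifold (𝓡 n) ∞ M]

local notation "𝔼" => EuclideanSpace ℝ (Fin n)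

/-- The differential of the chart around `x₀`. -/
def dchart (x₀ x : M) : TangentSpace (𝓡 n) x →L[ℝ] EuclideanSpace ℝ (Fin n) :=
  mfderiv (𝓡 n) 𝓘(ℝ, EuclideanSpace ℝ (Fin n)) (extChartAt (𝓡 n) x₀) x

/-- The differential of the inverse of the chart around `x₀`. -/
def frame (x₀ : M) (y : EuclideanSpace ℝ (Fin n)) :
    EuclideanSpace ℝ (Fin n) →L[ℝ] TangentSpace (𝓡 n) ((extChartAt (𝓡 n) x₀).symm y) :=
  mfderiv 𝓘(ℝ, EuclideanSpace ℝ (Fin n)) (𝓡 n) (extChartAt (𝓡 n) x₀).symm y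

theorem mdifferentiableAt_chart_symm (x₀ : M) {y : 𝔼} (hy : y ∈ (extChartAt (𝓡 n) x₀).target) :
    MDifferentiableAt 𝓘(ℝ, 𝔼) (𝓡 n) (extChartAt (𝓡 n) x₀).symm y := by
  have : IsManifold (𝓡 n) 1 M := IsManifold.of_le (n := ∞) (by simp)
  have := mdifferentiableWithinAt_extChartAt_symm hy
  rwa [ModelWithCorners.range_eq_univ, mdifferentiableWithinAt_univ] at this

theorem mdifferentiableAt_chart (x₀ : M) {x : M} (hx : x ∈ (extChartAt (𝓡 n) x₀).source) :
    MDifferentiableAt (𝓡 n) 𝓘(ℝ, 𝔼) (extChartAt (𝓡 n) x₀) x := by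
  have : IsManifold (𝓡 n) 1 M := IsManifold.of_le (n := ∞) (by simp)
  exact mdifferentiableAt_extChartAt (by rwa [extChartAt_source] at hx)

theorem dchart_frame (x₀ : M) {y : 𝔼} (hy : y ∈ (extChartAt (𝓡 n) x₀).target) (a : 𝔼) :
    dchart x₀ ((extChartAt (𝓡 n) x₀).symm y) (frame x₀ y a) = a := by
  have : IsManifold (𝓡 n) 1 M := IsManifold.of_le (n := ∞) (by simp)
  have := mfderiv_extChartAt_comp_mfderivWithin_extChartAt_symm hy
  rw [ModelWithCorners.range_eq_univ, mfderivWithin_univ] at this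
  exact congrArg (fun L => L a) this

theorem frame_dchart (x₀ : M) {y : 𝔼} (hy : y ∈ (extChartAt (𝓡 n) x₀).target)
    (a : TangentSpace (𝓡 n) ((extChartAt (𝓡 n) x₀).symm y)) :
    frame x₀ y (dchart x₀ ((extChartAt (𝓡 n) x₀).symm y) a) = a := by
  have : IsManifold (𝓡 n) 1 M := IsManifold.of_le (n := ∞) (by simp)
  have := mfderivWithin_extChartAt_symm_comp_mfderiv_extChartAt hy
  rw [ModelWithCorners.range_eq_univ, mfderivWithin_univ] at this
  exact congrArg (fun L => L a) this

theorem dchart_surjective (x₀ : M) {x : M} (hx : x ∈ (extChartAt (𝓡 n) x₀).source) :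
    Function.Surjective (dchart (n := n) x₀ x) := by
  rw [← (extChartAt (𝓡 n) x₀).left_inv hx]
  exact fun a => ⟨_, dchart_frame x₀ ((extChartAt (𝓡 n) x₀).map_source hx) a⟩

theorem bilin_coordMetric (g : Metric n M) (x₀ : M) (y a b : 𝔼) :
    bilin (coordMetric g x₀ y) a b =
      g.inner ((extChartAt (𝓡 n) x₀).symm y) (frame x₀ y a) (frame x₀ y b) := by
  have e : ∀ i j, g.inner ((extChartAt (𝓡 n) x₀).symm y) (frame x₀ y (EuclideanSpace.single i 1))
      (frame x₀ y (EuclideanSpace.single j 1)) = coordMetric g x₀ y i j := fun _ _ => rfl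
  conv_rhs => rw [← sum_apply_smul_single a, ← sum_apply_smul_single b]
  simp only [map_sum, map_smul, FunLike.coe_sum, Finset.sum_apply, FunLike.coe_smul, Pi.smul_apply,
    smul_eq_mul, bilin_apply, Finset.mul_sum]
  rw [Finset.sum_comm]
  refine Finset.sum_congr rfl fun i _ => Finset.sum_congr rfl fun j _ => ?_
  rw [e]
  ring

/-- The metric in terms of its coordinate expression. -/
theorem inner_eq_bilin (g : Metric n M) (x₀ : M) {x : M}
    (hx : x ∈ (extChartAt (𝓡 n) x₀).source) (a b : TangentSpace (𝓡 n) x) :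
    g.inner x a b = bilin (coordMetric g x₀ (extChartAt (𝓡 n) x₀ x)) (dchart x₀ x a)
      (dchart x₀ x b) := by
  -- The tangent space depends on the base point, so the point is generalized to a variable z that
  -- can be substituted by the image of the inverse chart.
  have key : ∀ z, z = x → ∀ a b : TangentSpace (𝓡 n) z,
      z = (extChartAt (𝓡 n) x₀).symm (extChartAt (𝓡 n) x₀ x) →
      g.inner z a b = bilin (coordMetric g x₀ (extChartAt (𝓡 n) x₀ x)) (dchart x₀ z a)
        (dchart x₀ z b) := by
    intro z _ a b hz
    subst hz
    rw [bilin_coordMetric, frame_dchart, frame_dchart] <;>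
    exact (extChartAt (𝓡 n) x₀).map_source hx
  exact key x rfl a b ((extChartAt (𝓡 n) x₀).left_inv hx).symm

/-- The frame is the tangent map of the inverse chart applied to a constant vector field. -/
theorem contMDiffOn_frame (x₀ : M) (a : 𝔼) :
    ContMDiffOn 𝓘(ℝ, 𝔼) (𝓡 n).tangent ∞
      (fun y => Bundle.TotalSpace.mk' 𝔼 ((extChartAt (𝓡 n) x₀).symm y) (frame x₀ y a)
        : 𝔼 → TangentBundle (𝓡 n) M) (extChartAt (𝓡 n) x₀).target := by
  have ho : IsOpen (extChartAt (𝓡 n) x₀).target := isOpen_extChartAt_target x₀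
  have : IsManifold (𝓡 n) 1 M := IsManifold.of_le (n := ∞) (by simp)
  have h1 := (contMDiffOn_extChartAt_symm (I := 𝓡 n) (n := ∞) x₀).contMDiffOn_tangentMapWithin
    (m := ∞) (by simp) ho.uniqueMDiffOn
  have h2 : ContMDiffOn 𝓘(ℝ, 𝔼) 𝓘(ℝ, 𝔼).tangent ∞
      (fun y => (⟨y, a⟩ : TangentBundle 𝓘(ℝ, 𝔼) 𝔼)) (extChartAt (𝓡 n) x₀).target :=
    contMDiffOn_vectorSpace_iff_contDiffOn.2 contDiffOn_const
  have h3 := h1.comp h2 (fun y hy => hy)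
  refine h3.congr fun y hy => ?_
  simp only [Function.comp_def, tangentMapWithin, frame]
  rw [mfderivWithin_of_isOpen ho hy]
  rfl

theorem contDiffOn_coordMetric (g : Metric n M) (x₀ : M) (i j : Fin n) :
    ContDiffOn ℝ ∞ (fun y => coordMetric g x₀ y i j) (extChartAt (𝓡 n) x₀).target := by
  have : IsManifold (𝓡 n) 1 M := IsManifold.of_le (n := ∞) (by simp)
  have h1 := g.contMDiff.comp_contMDiffOn (contMDiffOn_extChartAt_symm (I := 𝓡 n) (n := ∞) x₀)
  have h2 := ContMDiffOn.clm_bundle_apply₂ (F₁ := 𝔼) (F₂ := 𝔼) (F₃ := ℝ)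
    (E₁ := fun x : M => TangentSpace (𝓡 n) x) (E₂ := fun x : M => TangentSpace (𝓡 n) x)
    (E₃ := fun _ : M => ℝ) (b := (extChartAt (𝓡 n) x₀).symm)
    (ψ := fun y => g.inner ((extChartAt (𝓡 n) x₀).symm y))
    h1 (contMDiffOn_frame x₀ (EuclideanSpace.single i 1))
    (contMDiffOn_frame x₀ (EuclideanSpace.single j 1))
  intro y hy
  have h3 := h2 y hy
  rw [Bundle.contMDiffWithinAt_totalSpace] at h3
  exact h3.2.contDiffWithinAt

theorem isSmoothMetric_coordMetric (g : Metric n M) (x₀ : M) :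
    IsSmoothMetric (coordMetric g x₀) (extChartAt (𝓡 n) x₀).target where
  isOpen := isOpen_extChartAt_target x₀
  contDiffOn := contDiffOn_coordMetric g x₀
  symm y _ := Matrix.IsSymm.ext fun i j => g.symm _ _ _
  pos y hy a ha := by
    rw [bilin_coordMetric]
    refine g.pos _ _ fun h => ha ?_
    rw [← dchart_frame x₀ hy a, h, map_zero]

/-- The coordinate change from the chart around `x₀` to the chart around `x₁`. -/
def coordChange (x₀ x₁ : M) (y : EuclideanSpace ℝ (Fin n)) : EuclideanSpace ℝ (Fin n) :=
  extChartAt (𝓡 n) x₁ ((extChartAt (𝓡 n) x₀).symm y)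

/-- The domain of the coordinate change. -/
def coordOverlap (x₀ x₁ : M) : Set (EuclideanSpace ℝ (Fin n)) :=
  (extChartAt (𝓡 n) x₀).target ∩ (extChartAt (𝓡 n) x₀).symm ⁻¹' (extChartAt (𝓡 n) x₁).source

theorem isOpen_coordOverlap (x₀ x₁ : M) : IsOpen (coordOverlap (n := n) x₀ x₁) :=
  (continuousOn_extChartAt_symm x₀).isOpen_inter_preimage (isOpen_extChartAt_target x₀)
    (isOpen_extChartAt_source x₁)

theorem contDiffOn_coordChange (x₀ x₁ : M) :
    ContDiffOn ℝ ∞ (coordChange x₀ x₁) (coordOverlap (n := n) x₀ x₁) := by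
  rw [← contMDiffOn_iff_contDiffOn]
  have h := (contMDiffOn_extChartAt (I := 𝓡 n) (n := ∞) (x := x₁)).comp
    ((contMDiffOn_extChartAt_symm (I := 𝓡 n) (n := ∞) x₀).mono
      (Set.inter_subset_left (t := (extChartAt (𝓡 n) x₀).symm ⁻¹' (extChartAt (𝓡 n) x₁).source)))
    (fun y hy => by simpa using hy.2)
  exact h

theorem fderiv_coordChange (x₀ x₁ : M) {y : 𝔼} (hy : y ∈ coordOverlap x₀ x₁) (a : 𝔼) :
    fderiv ℝ (coordChange x₀ x₁) y a = dchart x₁ ((extChartAt (𝓡 n) x₀).symm y) (frame x₀ y a) := by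
  have h := mfderiv_comp y (mdifferentiableAt_chart x₁ hy.2) (mdifferentiableAt_chart_symm x₀ hy.1)
  rw [← mfderiv_eq_fderiv]
  exact congrArg (fun L => L a) h

theorem bilin_coordChange (g : Metric n M) (x₀ x₁ : M) {y : 𝔼} (hy : y ∈ coordOverlap x₀ x₁)
    (a b : 𝔼) : bilin (coordMetric g x₀ y) a b = bilin (coordMetric g x₁ (coordChange x₀ x₁ y))
      (fderiv ℝ (coordChange x₀ x₁) y a) (fderiv ℝ (coordChange x₀ x₁) y b) := by
  rw [bilin_coordMetric, fderiv_coordChange x₀ x₁ hy, fderiv_coordChange x₀ x₁ hy,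
    inner_eq_bilin g x₁ hy.2]
  rfl

end Charts

/-! ### Smoothness of coordinate curvature, volume density and Laplacian -/

section CoordinateSmoothness

variable {n : ℕ}

local notation "𝔼" => EuclideanSpace ℝ (Fin n)

namespace IsSmoothMetric

variable {G : EuclideanSpace ℝ (Fin n) → Matrix (Fin n) (Fin n) ℝ}
  {U V : Set (EuclideanSpace ℝ (Fin n))} {f : EuclideanSpace ℝ (Fin n) → ℝ}

theorem mono (hG : IsSmoothMetric G U) (hV : IsOpen V) (h : V ⊆ U) : IsSmoothMetric G V where
  isOpen := hV
  contDiffOn i j := (hG.contDiffOn i j).mono h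
  symm z hz := hG.symm z (h hz)
  pos z hz := hG.pos z (h hz)

theorem contDiffOn_coordScalar (hG : IsSmoothMetric G U) : ContDiffOn ℝ ∞ (coordScalar G) U := by
  have hc := hG.contDiffOn_christoffel
  refine ContDiffOn.sum fun j _ => ContDiffOn.sum fun k _ => (hG.contDiffOn_inv j k).mul ?_
  refine ContDiffOn.sum fun i _ => ((contDiffOn_pd hG.isOpen (hc i j k) i).sub
    (contDiffOn_pd hG.isOpen (hc i i k) j)).add (ContDiffOn.sum fun l _ => ?_)
  exact ((hc i i l).mul (hc l j k)).sub ((hc i j l).mul (hc l i k))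

theorem contDiffOn_sqrt_det (hG : IsSmoothMetric G U) :
    ContDiffOn ℝ ∞ (fun z => √((G z).det)) U :=
  (contDiffOn_det hG.contDiffOn).sqrt fun _ hz => (hG.det_pos hz).ne'

/-- The divergence form, divided by √det G, is visibly smooth. -/
theorem contDiffOn_coordLap (hG : IsSmoothMetric G U) (hf : ContDiffOn ℝ ∞ f U) :
    ContDiffOn ℝ ∞ (coordLap G f) U := by
  have h1 : ContDiffOn ℝ ∞ (fun y => (√((G y).det))⁻¹ *
      ∑ i, pd i (fun z => √((G z).det) * coordGrad G f z i) y) U := by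
    refine (hG.contDiffOn_sqrt_det.inv fun z hz => (Real.sqrt_pos.2 (hG.det_pos hz)).ne').mul
      (ContDiffOn.sum fun i _ => contDiffOn_pd hG.isOpen (hG.contDiffOn_sqrt_det.mul ?_) i)
    exact contDiffOn_euclidean.1 (hG.contDiffOn_coordGrad hf) i
  refine h1.congr fun y hy => ?_
  rw [hG.sqrt_det_mul_coordLap hf hy, inv_mul_cancel_left₀]
  exact (Real.sqrt_pos.2 (hG.det_pos hy)).ne'

end IsSmoothMetric

end CoordinateSmoothness

/-! ### Functions, gradients and scalar curvature read in charts -/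

section Charts

variable {n : ℕ} {M : Type*} [TopologicalSpace M] [ChartedSpace (EuclideanSpace ℝ (Fin n)) M]
  [IsManifold (𝓡 n) ∞ M]

local notation "𝔼" => EuclideanSpace ℝ (Fin n)

/-- The coordinate expression of the function `f` in the chart around `x₀`. -/
def coordExpr (n : ℕ) {M : Type*} [TopologicalSpace M] [ChartedSpace (EuclideanSpace ℝ (Fin n)) M]
    (x₀ : M) (f : M → ℝ) (y : EuclideanSpace ℝ (Fin n)) : ℝ :=
  f ((extChartAt (𝓡 n) x₀).symm y)

theorem contDiffOn_coordExpr {f : M → ℝ} (hf : ContMDiff (𝓡 n) 𝓘(ℝ, ℝ) ∞ f) (x₀ : M) :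
    ContDiffOn ℝ ∞ (coordExpr n x₀ f) (extChartAt (𝓡 n) x₀).target := by
  rw [← contMDiffOn_iff_contDiffOn]
  exact hf.comp_contMDiffOn (contMDiffOn_extChartAt_symm x₀)

theorem fderiv_coordExpr {f : M → ℝ} (x₀ : M) {y : 𝔼} (hy : y ∈ (extChartAt (𝓡 n) x₀).target)
    (hf : MDifferentiableAt (𝓡 n) 𝓘(ℝ, ℝ) f ((extChartAt (𝓡 n) x₀).symm y)) (b : 𝔼) :
    fderiv ℝ (coordExpr n x₀ f) y b =
      mfderiv (𝓡 n) 𝓘(ℝ, ℝ) f ((extChartAt (𝓡 n) x₀).symm y) (frame x₀ y b) := by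
  have h := mfderiv_comp y hf (mdifferentiableAt_chart_symm x₀ hy)
  rw [← mfderiv_eq_fderiv]
  exact congrArg (fun L => L b) h

theorem mfderiv_eq_coord {f : M → ℝ} (x₀ : M) {x : M} (hx : x ∈ (extChartAt (𝓡 n) x₀).source)
    (hf : MDifferentiableAt (𝓡 n) 𝓘(ℝ, ℝ) f x) (a : TangentSpace (𝓡 n) x) :
    mfderiv (𝓡 n) 𝓘(ℝ, ℝ) f x a =
      fderiv ℝ (coordExpr n x₀ f) (extChartAt (𝓡 n) x₀ x) (dchart x₀ x a) := by
  have key : ∀ z, z = x → ∀ a : TangentSpace (𝓡 n) z, MDifferentiableAt (𝓡 n) 𝓘(ℝ, ℝ) f z →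
      z = (extChartAt (𝓡 n) x₀).symm (extChartAt (𝓡 n) x₀ x) →
      mfderiv (𝓡 n) 𝓘(ℝ, ℝ) f z a =
        fderiv ℝ (coordExpr n x₀ f) (extChartAt (𝓡 n) x₀ x) (dchart x₀ z a) := by
    intro z _ a hf hz
    subst hz
    rw [fderiv_coordExpr x₀ ((extChartAt (𝓡 n) x₀).map_source hx) hf, frame_dchart]
    exact (extChartAt (𝓡 n) x₀).map_source hx
  exact key x rfl a hf ((extChartAt (𝓡 n) x₀).left_inv hx).symm

theorem dchart_gradient (g : Metric n M) {f : M → ℝ} (x₀ : M) {x : M}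
    (hx : x ∈ (extChartAt (𝓡 n) x₀).source) (hf : MDifferentiableAt (𝓡 n) 𝓘(ℝ, ℝ) f x) :
    dchart x₀ x (gradient g f x) =
      coordGrad (coordMetric g x₀) (coordExpr n x₀ f) (extChartAt (𝓡 n) x₀ x) := by
  have hG := isSmoothMetric_coordMetric g x₀
  have hy := (extChartAt (𝓡 n) x₀).map_source hx
  rw [← sub_eq_zero]
  refine hG.nondegenerate hy _ fun b => ?_
  obtain ⟨a, rfl⟩ := dchart_surjective x₀ hx b
  rw [map_sub, FunLike.coe_sub, Pi.sub_apply, sub_eq_zero, hG.bilin_coordGrad hy,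
    ← inner_eq_bilin g x₀ hx, inner_gradient, mfderiv_eq_coord x₀ hx hf]

/-- The pairing `g(∇f₁, ∇f₂)`. -/
def gradInner (g : Metric n M) (f₁ f₂ : M → ℝ) (x : M) : ℝ :=
  g.inner x (gradient g f₁ x) (gradient g f₂ x)

theorem gradInner_eq_coord (g : Metric n M) {f₁ f₂ : M → ℝ} (x₀ : M) {x : M}
    (hx : x ∈ (extChartAt (𝓡 n) x₀).source) (hf₁ : MDifferentiableAt (𝓡 n) 𝓘(ℝ, ℝ) f₁ x)
    (hf₂ : MDifferentiableAt (𝓡 n) 𝓘(ℝ, ℝ) f₂ x) :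
    gradInner g f₁ f₂ x = fderiv ℝ (coordExpr n x₀ f₁) (extChartAt (𝓡 n) x₀ x)
      (coordGrad (coordMetric g x₀) (coordExpr n x₀ f₂) (extChartAt (𝓡 n) x₀ x)) := by
  rw [gradInner, inner_gradient, mfderiv_eq_coord x₀ hx hf₁, dchart_gradient g x₀ hx hf₂]

theorem continuous_of_coord {f : M → ℝ} (F : M → 𝔼 → ℝ)
    (hF : ∀ x₀, ContinuousOn (F x₀) (extChartAt (𝓡 n) x₀).target)
    (h : ∀ x₀, ∀ x ∈ (extChartAt (𝓡 n) x₀).source, f x = F x₀ (extChartAt (𝓡 n) x₀ x)) :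
    Continuous f := by
  refine continuous_iff_continuousAt.2 fun x₀ => ?_
  have hm := extChartAt_source_mem_nhds (I := 𝓡 n) x₀
  have hc : ContinuousOn (fun x => F x₀ (extChartAt (𝓡 n) x₀ x)) (extChartAt (𝓡 n) x₀).source :=
    (hF x₀).comp (continuousOn_extChartAt x₀) (extChartAt (𝓡 n) x₀).mapsTo
  exact (hc.continuousAt hm).congr (Filter.eventually_of_mem hm fun x hx => (h x₀ x hx).symm)

theorem _root_.ContMDiff.mdiffAt {f : M → ℝ} (hf : ContMDiff (𝓡 n) 𝓘(ℝ, ℝ) ∞ f) (x : M) :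
    MDifferentiableAt (𝓡 n) 𝓘(ℝ, ℝ) f x := hf.mdifferentiable (by simp) x

theorem continuous_gradInner (g : Metric n M) {f₁ f₂ : M → ℝ}
    (hf₁ : ContMDiff (𝓡 n) 𝓘(ℝ, ℝ) ∞ f₁) (hf₂ : ContMDiff (𝓡 n) 𝓘(ℝ, ℝ) ∞ f₂) :
    Continuous (gradInner g f₁ f₂) := by
  refine continuous_of_coord (fun x₀ y => fderiv ℝ (coordExpr n x₀ f₁) y
    (coordGrad (coordMetric g x₀) (coordExpr n x₀ f₂) y)) (fun x₀ => ?_)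
    fun x₀ x hx => gradInner_eq_coord g x₀ hx (hf₁.mdiffAt x) (hf₂.mdiffAt x)
  have hG := isSmoothMetric_coordMetric g x₀
  exact (((contDiffOn_coordExpr hf₁ x₀).fderiv_of_isOpen (m := ∞) hG.isOpen (by simp)).clm_apply
    (hG.contDiffOn_coordGrad (contDiffOn_coordExpr hf₂ x₀))).continuousOn

/-- The scalar curvature may be computed in any chart. -/
theorem scalarCurvature_eq_coord (g : Metric n M) (x₀ : M) {x : M}
    (hx : x ∈ (extChartAt (𝓡 n) x₀).source) :
    scalarCurvature g x = coordScalar (coordMetric g x₀) (extChartAt (𝓡 n) x₀ x) := by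
  have hG' := (isSmoothMetric_coordMetric g x).mono (isOpen_coordOverlap x x₀)
    Set.inter_subset_left
  have h := (isSmoothMetric_coordMetric g x₀).coordScalar_pullback hG'
    (contDiffOn_coordChange x x₀) (fun y hy => (extChartAt (𝓡 n) x₀).map_source hy.2)
    (fun z hz => bilin_coordChange g x x₀ hz) (y := extChartAt (𝓡 n) x x)
    ⟨mem_extChartAt_target x, by simpa using hx⟩
  rw [scalarCurvature, h, coordChange, extChartAt_to_inv]

theorem continuous_scalarCurvature (g : Metric n M) : Continuous (scalarCurvature g) :=
  continuous_of_coord (fun x₀ => coordScalar (coordMetric g x₀))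
    (fun x₀ => (isSmoothMetric_coordMetric g x₀).contDiffOn_coordScalar.continuousOn)
    fun x₀ _ hx => scalarCurvature_eq_coord g x₀ hx

/-! ### Conformal change on the manifold -/

section Conformal

variable {g h : Metric n M} {f : M → ℝ}

theorem coordMetric_conformal
    (hh : ∀ (x : M) (a b : TangentSpace (𝓡 n) x),
      h.inner x a b = Real.exp (2 * f x) * g.inner x a b) (x₀ : M) (y : 𝔼) :
    coordMetric h x₀ y = Real.exp (2 * coordExpr n x₀ f y) • coordMetric g x₀ y := by
  ext i j
  simp only [coordMetric, Matrix.of_apply, hh, Matrix.smul_apply, smul_eq_mul]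
  rfl

theorem gradient_conformal
    (hh : ∀ (x : M) (a b : TangentSpace (𝓡 n) x),
      h.inner x a b = Real.exp (2 * f x) * g.inner x a b) (φ : M → ℝ) (x : M) :
    gradient h φ x = Real.exp (-(2 * f x)) • gradient g φ x := by
  rw [← sub_eq_zero]
  refine (metricForm_nondegenerate h x).1 _ fun a => ?_
  change h.inner x _ a = 0
  rw [map_sub, FunLike.coe_sub, Pi.sub_apply, inner_gradient, map_smul, FunLike.coe_smul,
    Pi.smul_apply, hh, inner_gradient, smul_eq_mul]
  have key : ∀ t : ℝ, t - Real.exp (-(2 * f x)) * (Real.exp (2 * f x) * t) = 0 := fun t => by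
    rw [← mul_assoc, ← Real.exp_add]
    simp
  exact key _

theorem gradInner_conformal
    (hh : ∀ (x : M) (a b : TangentSpace (𝓡 n) x),
      h.inner x a b = Real.exp (2 * f x) * g.inner x a b) (φ ψ : M → ℝ) (x : M) :
    gradInner h φ ψ x = Real.exp (-(2 * f x)) * gradInner g φ ψ x := by
  rw [gradInner, inner_gradient, gradInner, ← inner_gradient g, gradient_conformal hh, map_smul,
    smul_eq_mul]

/-- Transformation of the scalar curvature under a conformal change of the metric, with the
Laplacian computed in any chart. -/
theorem scalarCurvature_conformal
    (hh : ∀ (x : M) (a b : TangentSpace (𝓡 n) x),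
      h.inner x a b = Real.exp (2 * f x) * g.inner x a b)
    (hf : ContMDiff (𝓡 n) 𝓘(ℝ, ℝ) ∞ f) (x₀ : M) {x : M}
    (hx : x ∈ (extChartAt (𝓡 n) x₀).source) :
    scalarCurvature h x = Real.exp (-(2 * f x)) * (scalarCurvature g x
      - 2 * ((n : ℝ) - 1) * coordLap (coordMetric g x₀) (coordExpr n x₀ f) (extChartAt (𝓡 n) x₀ x)
      - ((n : ℝ) - 1) * ((n : ℝ) - 2) * gradInner g f f x) := by
  have hy := (extChartAt (𝓡 n) x₀).map_source hx
  rw [scalarCurvature_eq_coord h x₀ hx, scalarCurvature_eq_coord g x₀ hx,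
    gradInner_eq_coord g x₀ hx (hf.mdiffAt x) (hf.mdiffAt x),
    (isSmoothMetric_coordMetric g x₀).coordScalar_conformal (contDiffOn_coordExpr hf x₀)
      (fun z _ => coordMetric_conformal hh x₀ z) hy]
  simp only [coordExpr, (extChartAt (𝓡 n) x₀).left_inv hx]

end Conformal

end Charts

/-! ### The Riemannian measure -/

section Volume

variable {n : ℕ}

local notation "𝔼" => EuclideanSpace ℝ (Fin n)

/-- In matrices A' = Jᵀ A J, where J is the matrix of L. -/
theorem det_eq_of_pullback {A A' : Matrix (Fin n) (Fin n) ℝ}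
    {L : EuclideanSpace ℝ (Fin n) →L[ℝ] EuclideanSpace ℝ (Fin n)}
    (h : ∀ a b, bilin A' a b = bilin A (L a) (L b)) : A'.det = L.det ^ 2 * A.det := by
  let b := (EuclideanSpace.basisFun (Fin n) ℝ).toBasis
  let J := LinearMap.toMatrix b b L.toLinearMap
  have hJ : ∀ k i, J k i = L (EuclideanSpace.single i 1) k := by
    intro k i
    simp [J, b, LinearMap.toMatrix_apply]
  have hA : A' = Jᵀ * A * J := by
    ext i j
    rw [← bilin_single A', h, bilin_apply]
    simp only [Matrix.mul_apply, Matrix.transpose_apply, hJ, Finset.sum_mul]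
    rw [Finset.sum_comm]
    exact Finset.sum_congr rfl fun k _ => Finset.sum_congr rfl fun l _ => by ring
  have hd : J.det = L.det := LinearMap.det_toMatrix b L.toLinearMap
  rw [hA, Matrix.det_mul, Matrix.det_mul, Matrix.det_transpose, hd]
  ring

variable {M : Type*} [TopologicalSpace M] [ChartedSpace (EuclideanSpace ℝ (Fin n)) M]
  [IsManifold (𝓡 n) ∞ M] [MeasurableSpace M] [BorelSpace M]

omit [IsManifold (𝓡 n) ∞ M] in
theorem aemeasurable_chart_symm (x₀ : M) :
    AEMeasurable (extChartAt (𝓡 n) x₀).symm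
      ((volume : Measure 𝔼).restrict (extChartAt (𝓡 n) x₀).target) :=
  (continuousOn_extChartAt_symm x₀).aemeasurable (isOpen_extChartAt_target x₀).measurableSet

omit [IsManifold (𝓡 n) ∞ M] in
theorem measurableSet_target_inter_preimage (x₀ : M) {A : Set M} (hA : MeasurableSet A) :
    MeasurableSet ((extChartAt (𝓡 n) x₀).target ∩ (extChartAt (𝓡 n) x₀).symm ⁻¹' A) := by
  have h := (continuousOn_iff_continuous_domRestrict.1
    (continuousOn_extChartAt_symm (I := 𝓡 n) x₀)).measurable hA
  have := (MeasurableEmbedding.subtype_coe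
    (isOpen_extChartAt_target (I := 𝓡 n) x₀).measurableSet).measurableSet_image.2 h
  convert this using 1
  exact (Subtype.image_preimage_coe _ _).symm

theorem aemeasurable_density (g : Metric n M) (x₀ : M) :
    AEMeasurable (fun y => ENNReal.ofReal √((coordMetric g x₀ y).det))
      ((volume : Measure 𝔼).restrict (extChartAt (𝓡 n) x₀).target) :=
  ((isSmoothMetric_coordMetric g x₀).contDiffOn_sqrt_det.continuousOn.aemeasurable
    (isOpen_extChartAt_target x₀).measurableSet).ennreal_ofReal

theorem lintegral_chartVolume (g : Metric n M) (x₀ : M) {f : M → ℝ≥0∞} (hf : Measurable f) :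
    ∫⁻ x, f x ∂chartVolume g x₀ = ∫⁻ y in (extChartAt (𝓡 n) x₀).target,
      ENNReal.ofReal √((coordMetric g x₀ y).det) * f ((extChartAt (𝓡 n) x₀).symm y) := by
  have h := aemeasurable_chart_symm (n := n) x₀
  rw [chartVolume, lintegral_map' hf.aemeasurable
    (h.mono_ac (withDensity_absolutelyContinuous _ _))]
  exact lintegral_withDensity_eq_lintegral_mul₀ (aemeasurable_density g x₀) (hf.comp_aemeasurable h)

theorem chartVolume_apply (g : Metric n M) (x₀ : M) {A : Set M} (hA : MeasurableSet A) :
    chartVolume g x₀ A = ∫⁻ y in (extChartAt (𝓡 n) x₀).target ∩ (extChartAt (𝓡 n) x₀).symm ⁻¹' A,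
      ENNReal.ofReal √((coordMetric g x₀ y).det) := by
  have ht := (isOpen_extChartAt_target (I := 𝓡 n) x₀).measurableSet
  rw [← lintegral_indicator_one hA, lintegral_chartVolume g x₀ (measurable_one.indicator hA),
    ← lintegral_indicator ht, ← lintegral_indicator]
  · congr 1
    ext y
    by_cases h1 : y ∈ (extChartAt (𝓡 n) x₀).target <;>
    by_cases h2 : (extChartAt (𝓡 n) x₀).symm y ∈ A <;>
    simp only [Set.indicator, Set.mem_inter_iff, Set.mem_preimage, h1, h2, if_true, if_false,
      and_true, and_false, Pi.one_apply, mul_one, mul_zero]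
  · exact measurableSet_target_inter_preimage x₀ hA

/-- Under a transition map √det g is multiplied by the absolute Jacobian, which is the factor in the
change of variables formula. Only an inequality results, since A may leave the domain of the chart
around x₁. -/
theorem chartVolume_inter_le (g : Metric n M) (x₀ x₁ : M) {A : Set M} (hA : MeasurableSet A) :
    chartVolume g x₁ (A ∩ (extChartAt (𝓡 n) x₀).source) ≤ chartVolume g x₀ A := by
  have hs₀ := (isOpen_extChartAt_source (I := 𝓡 n) x₀).measurableSet
  have hs₁ := (isOpen_extChartAt_source (I := 𝓡 n) x₁).measurableSet
  rw [chartVolume_apply g x₁ (hA.inter hs₀), chartVolume_apply g x₀ hA]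
  set s : Set 𝔼 := (extChartAt (𝓡 n) x₀).target ∩
    (extChartAt (𝓡 n) x₀).symm ⁻¹' (A ∩ (extChartAt (𝓡 n) x₁).source) with hs
  have hso : s ⊆ coordOverlap x₀ x₁ := fun y hy => ⟨hy.1, hy.2.2⟩
  have himg : (extChartAt (𝓡 n) x₁).target ∩
      (extChartAt (𝓡 n) x₁).symm ⁻¹' (A ∩ (extChartAt (𝓡 n) x₀).source)
      = coordChange x₀ x₁ '' s := by
    ext z
    constructor
    · rintro ⟨h1, h2, h3⟩
      refine ⟨extChartAt (𝓡 n) x₀ ((extChartAt (𝓡 n) x₁).symm z),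
        ⟨(extChartAt (𝓡 n) x₀).map_source h3, ?_⟩, ?_⟩
      · rw [Set.mem_preimage, (extChartAt (𝓡 n) x₀).left_inv h3]
        exact ⟨h2, (extChartAt (𝓡 n) x₁).map_target h1⟩
      · rw [coordChange, (extChartAt (𝓡 n) x₀).left_inv h3, (extChartAt (𝓡 n) x₁).right_inv h1]
    · rintro ⟨y, ⟨h1, h2, h3⟩, rfl⟩
      refine ⟨(extChartAt (𝓡 n) x₁).map_source h3, ?_⟩
      rw [Set.mem_preimage, coordChange, (extChartAt (𝓡 n) x₁).left_inv h3]
      exact ⟨h2, (extChartAt (𝓡 n) x₀).map_target h1⟩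
  have hd : ∀ y ∈ s, HasFDerivWithinAt (coordChange x₀ x₁) (fderiv ℝ (coordChange x₀ x₁) y) s y :=
    fun y hy => ((((contDiffOn_coordChange x₀ x₁).contDiffAt
      ((isOpen_coordOverlap x₀ x₁).mem_nhds (hso hy))).differentiableAt
      (by simp)).hasFDerivAt).hasFDerivWithinAt
  have hinj : Set.InjOn (coordChange x₀ x₁) s := by
    intro y hy z hz h
    have h1 := (extChartAt (𝓡 n) x₁).injOn (hso hy).2 (hso hz).2 h
    exact (extChartAt (𝓡 n) x₀).symm.injOn (hso hy).1 (hso hz).1 h1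
  have hsm : MeasurableSet s := measurableSet_target_inter_preimage x₀ (hA.inter hs₁)
  rw [himg, lintegral_image_eq_lintegral_abs_det_fderiv_mul volume hsm hd hinj]
  calc _ = ∫⁻ y in s, ENNReal.ofReal √((coordMetric g x₀ y).det) := by
        refine setLIntegral_congr_fun hsm fun y hy => ?_
        rw [det_eq_of_pullback (bilin_coordChange g x₀ x₁ (hso hy)),
          Real.sqrt_mul (sq_nonneg _), Real.sqrt_sq_eq_abs, ENNReal.ofReal_mul (abs_nonneg _)]
    _ ≤ _ := by
        refine lintegral_mono_set ?_
        exact fun y hy => ⟨hy.1, hy.2.1⟩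

theorem chartVolume_le_vol (g : Metric n M) (x₀ : M) : chartVolume g x₀ ≤ vol g :=
  le_iSup (chartVolume g) x₀

/-- A supremum of measures is not computed set by set. Instead every chart measure is dominated by
the single measure `chartVolume g x₀` plus the part of the volume outside the chart, hence so is the
supremum, and the second part does not charge A. -/
theorem vol_apply_of_subset (g : Metric n M) (x₀ : M) {A : Set M} (hA : MeasurableSet A)
    (h : A ⊆ (extChartAt (𝓡 n) x₀).source) : vol g A = chartVolume g x₀ A := by
  have hs₀ := (isOpen_extChartAt_source (I := 𝓡 n) x₀).measurableSet
  refine le_antisymm ?_ (chartVolume_le_vol g x₀ A)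
  have hle : vol g ≤ chartVolume g x₀ + (vol g).restrict (extChartAt (𝓡 n) x₀).sourceᶜ := by
    refine iSup_le fun x₁ => Measure.le_iff.2 fun B hB => ?_
    rw [← measure_inter_add_sdiff B hs₀, Measure.add_apply, Measure.restrict_apply hB]
    exact add_le_add (chartVolume_inter_le g x₀ x₁ hB) (chartVolume_le_vol g x₁ _)
  refine (hle A).trans ?_
  rw [Measure.add_apply, Measure.restrict_apply hA, ← Set.sdiff_eq, Set.sdiff_eq_empty.2 h]
  simp

theorem vol_restrict_source (g : Metric n M) (x₀ : M) :
    (vol g).restrict (extChartAt (𝓡 n) x₀).source = chartVolume g x₀ := by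
  have hs₀ := (isOpen_extChartAt_source (I := 𝓡 n) x₀).measurableSet
  ext A hA
  rw [Measure.restrict_apply hA, vol_apply_of_subset g x₀ (hA.inter hs₀) Set.inter_subset_right,
    chartVolume_apply g x₀ (hA.inter hs₀), chartVolume_apply g x₀ hA]
  congr 2
  ext y
  exact ⟨fun h => ⟨h.1, h.2.1⟩, fun h => ⟨h.1, h.2, (extChartAt (𝓡 n) x₀).map_target h.1⟩⟩

/-- Integration of a function supported in the domain of a chart. -/
theorem integral_vol_eq_coord (g : Metric n M) (x₀ : M) {F : M → ℝ} (hF : Measurable F)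
    (hs : ∀ x ∉ (extChartAt (𝓡 n) x₀).source, F x = 0) :
    ∫ x, F x ∂vol g = ∫ y in (extChartAt (𝓡 n) x₀).target,
      √((coordMetric g x₀ y).det) * F ((extChartAt (𝓡 n) x₀).symm y) := by
  rw [← setIntegral_eq_integral_of_forall_compl_eq_zero hs, vol_restrict_source, chartVolume,
    integral_map ((aemeasurable_chart_symm x₀).mono_ac (withDensity_absolutelyContinuous _ _))
    hF.aestronglyMeasurable,
    integral_withDensity_eq_integral_toReal_smul₀ (aemeasurable_density g x₀) (by simp)]
  simp [ENNReal.toReal_ofReal (Real.sqrt_nonneg _)]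

/-- The density √det g is continuous, so it is integrable on a compact coordinate neighbourhood. -/
theorem vol_lt_top_of_compact (g : Metric n M) [T2Space M] (x₀ : M) : ∃ s ∈ 𝓝 x₀, vol g s < ⊤ := by
  have ht := isOpen_extChartAt_target (I := 𝓡 n) x₀
  obtain ⟨K, hK, hyK, hKt⟩ := exists_compact_subset ht (mem_extChartAt_target x₀)
  have hsm := (hK.image_of_continuousOn ((continuousOn_extChartAt_symm x₀).mono hKt)).measurableSet
  have hss : (extChartAt (𝓡 n) x₀).symm '' K ⊆ (extChartAt (𝓡 n) x₀).source := by
    rintro _ ⟨y, hy, rfl⟩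
    exact (extChartAt (𝓡 n) x₀).map_target (hKt hy)
  refine ⟨(extChartAt (𝓡 n) x₀).symm '' K, ?_, ?_⟩
  · have h1 : (extChartAt (𝓡 n) x₀) ⁻¹' K ∈ 𝓝 x₀ :=
      (continuousAt_extChartAt x₀).preimage_mem_nhds (mem_interior_iff_mem_nhds.1 hyK)
    filter_upwards [h1, extChartAt_source_mem_nhds (I := 𝓡 n) x₀] with x hx hx'
    exact ⟨_, hx, (extChartAt (𝓡 n) x₀).left_inv hx'⟩
  · rw [vol_apply_of_subset g x₀ hsm hss, chartVolume_apply g x₀ hsm]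
    have : (extChartAt (𝓡 n) x₀).target ∩
        (extChartAt (𝓡 n) x₀).symm ⁻¹' ((extChartAt (𝓡 n) x₀).symm '' K) ⊆ K := by
      rintro y ⟨hy, z, hz, h⟩
      rwa [← (extChartAt (𝓡 n) x₀).symm.injOn (hKt hz) hy h]
    refine (lintegral_mono_set this).trans_lt ?_
    have hi : IntegrableOn (fun y => √((coordMetric g x₀ y).det)) K :=
      ((isSmoothMetric_coordMetric g x₀).contDiffOn_sqrt_det.continuousOn.mono
        hKt).integrableOn_compact hK
    exact hi.lintegral_lt_top

instance instIsFiniteMeasureVol [T2Space M] [CompactSpace M] (g : Metric n M) :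
    IsFiniteMeasure (vol g) := by
  have : IsLocallyFiniteMeasure (vol g) := ⟨vol_lt_top_of_compact g⟩
  infer_instance

omit [MeasurableSpace M] [BorelSpace M] [IsManifold (𝓡 n) ∞ M] in
theorem exists_finset_chart_cover [CompactSpace M] :
    ∃ t : Finset M, ⋃ x : t, (extChartAt (𝓡 n) (x : M)).source = Set.univ := by
  obtain ⟨t, ht⟩ := isCompact_univ.elim_finite_subcover
    (fun x : M => (extChartAt (𝓡 n) x).source) (isOpen_extChartAt_source (I := 𝓡 n))
    (fun x _ => Set.mem_iUnion.2 ⟨x, mem_extChartAt_source x⟩)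
  refine ⟨t, Set.eq_univ_of_forall fun x => ?_⟩
  obtain ⟨i, hi, hx⟩ := Set.mem_iUnion₂.1 (ht (Set.mem_univ x))
  exact Set.mem_iUnion.2 ⟨⟨i, hi⟩, hx⟩

/-- Transformation of the volume under a conformal change of the metric. -/
theorem vol_conformal [CompactSpace M] {g h : Metric n M} {f : M → ℝ} (hf : Continuous f)
    (hh : ∀ (x : M) (a b : TangentSpace (𝓡 n) x),
      h.inner x a b = Real.exp (2 * f x) * g.inner x a b) :
    vol h = (vol g).withDensity (fun x => ENNReal.ofReal (Real.exp (n * f x))) := by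
  have hm : Measurable (fun x => ENNReal.ofReal (Real.exp (n * f x))) :=
    (hf.measurable.const_mul _).exp.ennreal_ofReal
  obtain ⟨t, ht⟩ := exists_finset_chart_cover (n := n) (M := M)
  refine (Measure.ext_iff_of_iUnion_eq_univ ht).2 fun x₀ => ?_
  have hs₀ := (isOpen_extChartAt_source (I := 𝓡 n) (x₀ : M)).measurableSet
  rw [restrict_withDensity hs₀, vol_restrict_source, vol_restrict_source]
  ext A hA
  rw [withDensity_apply _ hA, ← lintegral_indicator hA, lintegral_chartVolume g x₀ (hm.indicator hA),
    ← lintegral_indicator_one hA, lintegral_chartVolume h x₀ (measurable_one.indicator hA)]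
  refine lintegral_congr fun y => ?_
  -- The determinant scales by e^{2nf}, so its root scales by e^{nf}.
  rw [coordMetric_conformal hh, Matrix.det_smul, Fintype.card_fin, ← Real.exp_nat_mul,
    show (n : ℝ) * (2 * coordExpr n (x₀ : M) f y) = 2 * (n * coordExpr n (x₀ : M) f y) by ring,
    two_mul, Real.exp_add, ← sq, Real.sqrt_mul (sq_nonneg _), Real.sqrt_sq (Real.exp_pos _).le,
    ENNReal.ofReal_mul (Real.exp_pos _).le]
  by_cases hy : (extChartAt (𝓡 n) (x₀ : M)).symm y ∈ A
  · rw [Set.indicator_of_mem hy, Set.indicator_of_mem hy, Pi.one_apply, mul_one, mul_comm]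
    rfl
  · rw [Set.indicator_of_notMem hy, Set.indicator_of_notMem hy, mul_zero, mul_zero]

end Volume

/-! ### The divergence theorem in a chart -/

section Divergence

variable {n : ℕ}

local notation "𝔼" => EuclideanSpace ℝ (Fin n)

/-- The divergence theorem for a compactly supported function and a smooth vector field. -/
theorem integral_fderiv_apply {U : Set 𝔼} (hU : IsOpen U) {F : 𝔼 → ℝ} (hF : ContDiff ℝ ∞ F)
    (hc : HasCompactSupport F) (hs : tsupport F ⊆ U) {V : 𝔼 → 𝔼} (hV : ContDiffOn ℝ ∞ V U) :
    ∫ y, fderiv ℝ F y (V y) = - ∫ y, F y * ∑ i, pd i (fun z => V z i) y := by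
  have hVi := contDiffOn_euclidean.1 hV
  have hp : ∀ i, Continuous (pd i F) := fun i =>
    (hF.continuous_fderiv (by simp)).clm_apply continuous_const
  have hps : ∀ i, tsupport (pd i F) ⊆ tsupport F := fun i =>
    tsupport_fderiv_apply_subset ℝ (f := F) _
  -- The field V is controlled only on U, but a product with a function supported in the support of
  -- F is continuous on the whole space with compact support.
  have hcont : ∀ (A B : 𝔼 → ℝ), Continuous A → tsupport A ⊆ tsupport F → ContinuousOn B U →
      Integrable (fun y => A y * B y) := by
    intro A B hA hAs hB
    have hsub : tsupport (fun y => A y * B y) ⊆ tsupport F :=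
      (tsupport_mul_subset_left).trans hAs
    exact ((hA.continuousOn.mul hB).continuous_of_tsupport_subset hU
      (hsub.trans hs)).integrable_of_hasCompactSupport (hc.mono' (subset_tsupport _ |>.trans hsub))
  have h1 : ∀ i, Integrable (fun y => pd i F y * V y i) := fun i =>
    hcont _ _ (hp i) (hps i) (hVi i).continuousOn
  have h2 : ∀ i, Integrable (fun y => F y * pd i (fun z => V z i) y) := fun i =>
    hcont _ _ hF.continuous le_rfl (contDiffOn_pd hU (hVi i) i).continuousOn
  have h3 : ∀ i, Integrable (fun y => F y * V y i) := fun i =>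
    hcont _ _ hF.continuous le_rfl (hVi i).continuousOn
  have key : ∀ i, ∫ y, pd i F y * V y i = - ∫ y, F y * pd i (fun z => V z i) y := by
    intro i
    have h1' := h1 i
    have h2' := h2 i
    have h3' := h3 i
    simp only [pd, mul_comm _ (V _ i)] at h1' ⊢
    simp only [pd, mul_comm (F _)] at h2' h3' ⊢
    exact integral_mul_fderiv_eq_neg_fderiv_mul_of_integrable (μ := volume)
      (f := fun y => V y i) (g := F) (v := EuclideanSpace.single i (1 : ℝ)) h2' h1' h3'
      (fun x hx => ((hVi i).contDiffAt (hU.mem_nhds (hs hx))).differentiableAt (by simp))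
      (fun x _ => hF.differentiable (by simp) x)
  have e1 : ∀ y, fderiv ℝ F y (V y) = ∑ i, pd i F y * V y i := by
    intro y
    conv_lhs => rw [← sum_apply_smul_single (V y)]
    simp [pd, mul_comm]
  simp only [e1, Finset.mul_sum]
  rw [integral_finsetSum _ fun i _ => h1 i, integral_finsetSum _ fun i _ => h2 i,
    ← Finset.sum_neg_distrib]
  exact Finset.sum_congr rfl fun i _ => key i

variable {M : Type*} [TopologicalSpace M] [ChartedSpace (EuclideanSpace ℝ (Fin n)) M]
  [IsManifold (𝓡 n) ∞ M] [MeasurableSpace M] [BorelSpace M] [T2Space M] [CompactSpace M]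

/-- The Laplacian of `f`, computed in the chart around `x₀`. -/
def chartLap (g : Metric n M) (x₀ : M) (f : M → ℝ) (x : M) : ℝ :=
  coordLap (coordMetric g x₀) (coordExpr n x₀ f) (extChartAt (𝓡 n) x₀ x)

omit [MeasurableSpace M] [BorelSpace M] [T2Space M] [CompactSpace M] in
theorem continuousOn_chartLap (g : Metric n M) (x₀ : M) {f : M → ℝ}
    (hf : ContMDiff (𝓡 n) 𝓘(ℝ, ℝ) ∞ f) :
    ContinuousOn (chartLap g x₀ f) (extChartAt (𝓡 n) x₀).source :=
  ((isSmoothMetric_coordMetric g x₀).contDiffOn_coordLap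
    (contDiffOn_coordExpr hf x₀)).continuousOn.comp (continuousOn_extChartAt x₀)
    (extChartAt (𝓡 n) x₀).mapsTo

omit [MeasurableSpace M] [BorelSpace M] [T2Space M] [CompactSpace M] in
theorem gradInner_eq_zero_of_notMem (g : Metric n M) {F f : M → ℝ} {x : M} (hx : x ∉ tsupport F) :
    gradInner g F f x = 0 := by
  have h : F =ᶠ[𝓝 x] fun _ => (0 : ℝ) := notMem_tsupport_iff_eventuallyEq.1 hx
  rw [gradInner, inner_gradient, h.mfderiv_eq, mfderiv_const]
  rfl

/-- In coordinates this is the divergence theorem for the field √det g · ∇f, whose divergence is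
√det g times the Laplacian. -/
theorem integral_gradInner_of_tsupport_subset (g : Metric n M) (x₀ : M) {F f : M → ℝ}
    (hF : ContMDiff (𝓡 n) 𝓘(ℝ, ℝ) ∞ F) (hf : ContMDiff (𝓡 n) 𝓘(ℝ, ℝ) ∞ f)
    (hs : tsupport F ⊆ (extChartAt (𝓡 n) x₀).source) :
    ∫ x, gradInner g F f x ∂vol g = - ∫ x, F x * chartLap g x₀ f x ∂vol g := by
  classical
  set φ := extChartAt (𝓡 n) x₀ with hφ
  have hso : IsOpen φ.source := isOpen_extChartAt_source x₀
  have hto : IsOpen φ.target := isOpen_extChartAt_target x₀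
  have hG := isSmoothMetric_coordMetric g x₀
  have hFc := contDiffOn_coordExpr hF x₀
  have hfc := contDiffOn_coordExpr hf x₀
  have hcl : Continuous (fun x => F x * chartLap g x₀ f x) :=
    ContinuousOn.continuous_of_tsupport_subset
      (hF.continuous.continuousOn.mul (continuousOn_chartLap g x₀ hf)) hso
      (tsupport_mul_subset_left.trans hs)
  -- the coordinate expression of `F`, extended by zero
  let F₀ : 𝔼 → ℝ := φ.target.indicator (coordExpr n x₀ F)
  let K : Set 𝔼 := φ '' tsupport F
  have hK : IsCompact K := (isClosed_tsupport F).isCompact.image_of_continuousOn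
    ((continuousOn_extChartAt x₀).mono hs)
  have hKt : K ⊆ φ.target := by
    rintro _ ⟨x, hx, rfl⟩
    exact φ.map_source (hs hx)
  have hF₀s : tsupport F₀ ⊆ K := by
    refine closure_minimal (fun y hy => ?_) hK.isClosed
    have hyt : y ∈ φ.target := by
      by_contra h
      exact hy (Set.indicator_of_notMem h _)
    refine ⟨φ.symm y, subset_tsupport F ?_, φ.right_inv hyt⟩
    rw [Function.mem_support]
    intro h
    exact hy (by simp only [F₀, Set.indicator_of_mem hyt]; exact h)
  have hF₀e : ∀ y ∈ φ.target, F₀ =ᶠ[𝓝 y] coordExpr n x₀ F := fun y hy =>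
    Filter.eventually_of_mem (hto.mem_nhds hy) fun z hz => Set.indicator_of_mem hz _
  have hF₀ : ContDiff ℝ ∞ F₀ := by
    rw [contDiff_iff_contDiffAt]
    intro y
    by_cases hy : y ∈ φ.target
    · exact (hFc.contDiffAt (hto.mem_nhds hy)).congr_of_eventuallyEq (hF₀e y hy)
    · have : F₀ =ᶠ[𝓝 y] fun _ => (0 : ℝ) :=
        notMem_tsupport_iff_eventuallyEq.1 fun h => hy (hKt (hF₀s h))
      exact contDiffAt_const.congr_of_eventuallyEq this
  let V : 𝔼 → 𝔼 := fun y => √((coordMetric g x₀ y).det) •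
    coordGrad (coordMetric g x₀) (coordExpr n x₀ f) y
  have hV : ContDiffOn ℝ ∞ V φ.target := hG.contDiffOn_sqrt_det.smul (hG.contDiffOn_coordGrad hfc)
  have main := integral_fderiv_apply hto hF₀ (HasCompactSupport.intro hK fun y hy =>
    image_eq_zero_of_notMem_tsupport fun h => hy (hF₀s h)) (hF₀s.trans hKt) hV
  rw [integral_vol_eq_coord g x₀ (continuous_gradInner g hF hf).measurable
    (fun x hx => gradInner_eq_zero_of_notMem g fun h => hx (hs h)),
    integral_vol_eq_coord g x₀ hcl.measurable
    (fun x hx => by rw [image_eq_zero_of_notMem_tsupport fun h => hx (hs h), zero_mul])]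
  have e1 : ∀ y ∉ φ.target, fderiv ℝ F₀ y (V y) = 0 := by
    intro y hy
    have : F₀ =ᶠ[𝓝 y] fun _ => (0 : ℝ) :=
      notMem_tsupport_iff_eventuallyEq.1 fun h => hy (hKt (hF₀s h))
    rw [this.fderiv_eq]
    simp
  have e2 : ∀ y ∉ φ.target, F₀ y * ∑ i, pd i (fun z => V z i) y = 0 := by
    intro y hy
    rw [show F₀ y = 0 from Set.indicator_of_notMem hy _, zero_mul]
  rw [← setIntegral_eq_integral_of_forall_compl_eq_zero e1,
    ← setIntegral_eq_integral_of_forall_compl_eq_zero e2] at main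
  convert main using 1
  · refine setIntegral_congr_fun hto.measurableSet fun y hy => ?_
    have hx := φ.map_target hy
    have hr : extChartAt (𝓡 n) x₀ ((extChartAt (𝓡 n) x₀).symm y) = y := φ.right_inv hy
    show _ * gradInner g F f (φ.symm y) = _
    rw [gradInner_eq_coord g x₀ hx (hF.mdiffAt _) (hf.mdiffAt _), hr, (hF₀e y hy).fderiv_eq,
      map_smul, smul_eq_mul]
  · congr 1
    refine setIntegral_congr_fun hto.measurableSet fun y hy => ?_
    have hr : extChartAt (𝓡 n) x₀ ((extChartAt (𝓡 n) x₀).symm y) = y := φ.right_inv hy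
    have hi : F₀ y = F (φ.symm y) := Set.indicator_of_mem hy _
    have := hG.sqrt_det_mul_coordLap hfc hy
    simp only [V, PiLp.smul_apply, smul_eq_mul, this, hi, chartLap]
    rw [show extChartAt (𝓡 n) x₀ (φ.symm y) = y from hr]
    ring

end Divergence

/-! ### Green's formula and conformal covariance of the energy -/

section Green

variable {n : ℕ} {M : Type*} [TopologicalSpace M] [ChartedSpace (EuclideanSpace ℝ (Fin n)) M]
  [IsManifold (𝓡 n) ∞ M]

theorem gradInner_comm (g : Metric n M) (F f : M → ℝ) (x : M) :
    gradInner g F f x = gradInner g f F x := g.symm x _ _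

theorem differentiableAt_coordExpr {f : M → ℝ} (hf : ContMDiff (𝓡 n) 𝓘(ℝ, ℝ) ∞ f) (x : M) :
    DifferentiableAt ℝ (coordExpr n x f) (extChartAt (𝓡 n) x x) :=
  ((contDiffOn_coordExpr hf x).contDiffAt ((isOpen_extChartAt_target x).mem_nhds
    (mem_extChartAt_target x))).differentiableAt (by simp)

theorem gradInner_mul_left (g : Metric n M) {F₁ F₂ f : M → ℝ}
    (h₁ : ContMDiff (𝓡 n) 𝓘(ℝ, ℝ) ∞ F₁) (h₂ : ContMDiff (𝓡 n) 𝓘(ℝ, ℝ) ∞ F₂)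
    (hf : ContMDiff (𝓡 n) 𝓘(ℝ, ℝ) ∞ f) (x : M) :
    gradInner g (fun x => F₁ x * F₂ x) f x
      = F₁ x * gradInner g F₂ f x + F₂ x * gradInner g F₁ f x := by
  have hx := mem_extChartAt_source (I := 𝓡 n) x
  have hp : ContMDiff (𝓡 n) 𝓘(ℝ, ℝ) ∞ (fun x => F₁ x * F₂ x) := h₁.mul h₂
  rw [gradInner_eq_coord g x hx (hp.mdiffAt x) (hf.mdiffAt x),
    gradInner_eq_coord g x hx (h₁.mdiffAt x) (hf.mdiffAt x),
    gradInner_eq_coord g x hx (h₂.mdiffAt x) (hf.mdiffAt x)]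
  have := ((differentiableAt_coordExpr h₁ x).hasFDerivAt.mul
    (differentiableAt_coordExpr h₂ x).hasFDerivAt).fderiv
  have e : coordExpr n x (fun x => F₁ x * F₂ x) = coordExpr n x F₁ * coordExpr n x F₂ := rfl
  rw [e, this]
  have e₁ : coordExpr n x F₁ (extChartAt (𝓡 n) x x) = F₁ x :=
    congrArg F₁ ((extChartAt (𝓡 n) x).left_inv hx)
  have e₂ : coordExpr n x F₂ (extChartAt (𝓡 n) x x) = F₂ x :=
    congrArg F₂ ((extChartAt (𝓡 n) x).left_inv hx)
  simp only [e₁, e₂, FunLike.coe_add, Pi.add_apply, FunLike.coe_smul, Pi.smul_apply, smul_eq_mul]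

theorem gradInner_comp_left (g : Metric n M) {F f : M → ℝ} {G : ℝ → ℝ} (hG : ContDiff ℝ ∞ G)
    (hF : ContMDiff (𝓡 n) 𝓘(ℝ, ℝ) ∞ F) (hf : ContMDiff (𝓡 n) 𝓘(ℝ, ℝ) ∞ f) (x : M) :
    gradInner g (fun x => G (F x)) f x = deriv G (F x) * gradInner g F f x := by
  have hx := mem_extChartAt_source (I := 𝓡 n) x
  have hp : ContMDiff (𝓡 n) 𝓘(ℝ, ℝ) ∞ (fun x => G (F x)) := hG.contMDiff.comp hF
  rw [gradInner_eq_coord g x hx (hp.mdiffAt x) (hf.mdiffAt x),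
    gradInner_eq_coord g x hx (hF.mdiffAt x) (hf.mdiffAt x)]
  have e₁ : coordExpr n x F (extChartAt (𝓡 n) x x) = F x :=
    congrArg F ((extChartAt (𝓡 n) x).left_inv hx)
  have hd : HasDerivAt G (deriv G (F x)) (coordExpr n x F (extChartAt (𝓡 n) x x)) := by
    rw [e₁]
    exact (hG.differentiable (by simp) _).hasDerivAt
  have := (hd.comp_hasFDerivAt _ (differentiableAt_coordExpr hF x).hasFDerivAt).fderiv
  have e : coordExpr n x (fun x => G (F x)) = G ∘ coordExpr n x F := rfl
  rw [e, this]
  simp only [FunLike.coe_smul, Pi.smul_apply, smul_eq_mul]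

theorem gradInner_sum_left (g : Metric n M) {ι : Type*} (s : Finset ι) {F : ι → M → ℝ}
    {f : M → ℝ} (hF : ∀ i, ContMDiff (𝓡 n) 𝓘(ℝ, ℝ) ∞ (F i)) (hf : ContMDiff (𝓡 n) 𝓘(ℝ, ℝ) ∞ f)
    (x : M) : gradInner g (fun x => ∑ i ∈ s, F i x) f x = ∑ i ∈ s, gradInner g (F i) f x := by
  have hx := mem_extChartAt_source (I := 𝓡 n) x
  have hp : ContMDiff (𝓡 n) 𝓘(ℝ, ℝ) ∞ (fun x => ∑ i ∈ s, F i x) :=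
    contMDiff_finsetSum fun i _ => hF i
  rw [gradInner_eq_coord g x hx (hp.mdiffAt x) (hf.mdiffAt x)]
  have e : coordExpr n x (fun x => ∑ i ∈ s, F i x) = fun y => ∑ i ∈ s, coordExpr n x (F i) y := rfl
  rw [e, fderiv_fun_sum fun i _ => differentiableAt_coordExpr (hF i) x]
  simp only [FunLike.coe_sum, Finset.sum_apply]
  exact Finset.sum_congr rfl fun i _ =>
    (gradInner_eq_coord g x hx ((hF i).mdiffAt x) (hf.mdiffAt x)).symm

variable [MeasurableSpace M] [BorelSpace M] [T2Space M] [CompactSpace M]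

theorem _root_.Continuous.integrable_vol {f : M → ℝ} (hf : Continuous f) (g : Metric n M) :
    Integrable f (vol g) :=
  hf.integrable_of_hasCompactSupport (HasCompactSupport.of_compactSpace f)

/-- Green's formula; the Laplacian is patched together from charts. -/
theorem exists_laplacian (g : Metric n M) {f : M → ℝ} (hf : ContMDiff (𝓡 n) 𝓘(ℝ, ℝ) ∞ f) :
    ∃ L : M → ℝ, Continuous L ∧
      (∀ F : M → ℝ, ContMDiff (𝓡 n) 𝓘(ℝ, ℝ) ∞ F →
        ∫ x, gradInner g F f x ∂vol g = - ∫ x, F x * L x ∂vol g) ∧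
      ∀ L' : M → ℝ, (∀ x₀, ∀ x ∈ (extChartAt (𝓡 n) x₀).source, chartLap g x₀ f x = L' x) →
        L = L' := by
  obtain ⟨t, ht⟩ := exists_finset_chart_cover (n := n) (M := M)
  obtain ⟨ρ, hρ⟩ := SmoothPartitionOfUnity.exists_isSubordinate (𝓡 n) (s := Set.univ)
    isClosed_univ (fun i : t => (extChartAt (𝓡 n) (i : M)).source)
    (fun i => isOpen_extChartAt_source _) (by rw [← ht])
  have hsum : ∀ x, ∑ i, ρ i x = 1 := fun x => by
    rw [← ρ.sum_eq_one (Set.mem_univ x), finsum_eq_sum_of_fintype]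
  have hρs : ∀ i, ContMDiff (𝓡 n) 𝓘(ℝ, ℝ) ∞ (ρ i) := fun i => (ρ i).contMDiff
  have hc : ∀ i : t, Continuous fun x => ρ i x * chartLap g (i : M) f x := fun i =>
    ContinuousOn.continuous_of_tsupport_subset
      ((hρs i).continuous.continuousOn.mul (continuousOn_chartLap g _ hf))
      (isOpen_extChartAt_source _) (tsupport_mul_subset_left.trans (hρ i))
  -- Each ρ_i F is supported in one chart, so Green's formula for this patched function needs no
  -- compatibility between charts.
  refine ⟨fun x => ∑ i, ρ i x * chartLap g (i : M) f x, continuous_finsetSum _ fun i _ => hc i,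
    fun F hF => ?_, fun L' hL' => ?_⟩
  · have hFi : ∀ i, ContMDiff (𝓡 n) 𝓘(ℝ, ℝ) ∞ fun x => ρ i x * F x := fun i => (hρs i).mul hF
    have e : F = fun x => ∑ i, ρ i x * F x := by
      funext x
      rw [← Finset.sum_mul, hsum, one_mul]
    have e₁ : ∀ x, gradInner g F f x = ∑ i, gradInner g (fun x => ρ i x * F x) f x := by
      intro x
      rw [← gradInner_sum_left g _ hFi hf, ← e]
    have e₂ : ∀ x, F x * ∑ i, ρ i x * chartLap g (i : M) f x
        = ∑ i, ρ i x * F x * chartLap g (i : M) f x := by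
      intro x
      rw [Finset.mul_sum]
      exact Finset.sum_congr rfl fun i _ => by ring
    simp only [e₁, e₂]
    rw [integral_finsetSum _ fun i _ => (continuous_gradInner g (hFi i) hf).integrable_vol g,
      integral_finsetSum _ fun i _ => ?_, ← Finset.sum_neg_distrib]
    · exact Finset.sum_congr rfl fun i _ => integral_gradInner_of_tsupport_subset g _ (hFi i) hf
        (tsupport_mul_subset_left.trans (hρ i))
    · refine Continuous.integrable_vol ?_ g
      have := (hc i).mul hF.continuous
      refine this.congr fun x => ?_
      simp only [Pi.mul_apply]
      ring
  · funext x
    rw [← one_mul (L' x), ← hsum x, Finset.sum_mul]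
    refine Finset.sum_congr rfl fun i _ => ?_
    by_cases hx : x ∈ (extChartAt (𝓡 n) (i : M)).source
    · rw [hL' _ x hx]
    · rw [image_eq_zero_of_notMem_tsupport fun h => hx (hρ i h), zero_mul, zero_mul]

/-- The quadratic form `4 (n-1)/(n-2) ∫ |∇φ|² + ∫ R φ²` on smooth functions. -/
def energy (g : Metric n M) (φ : M → ℝ) : ℝ :=
  4 * ((n : ℝ) - 1) / ((n : ℝ) - 2) * ∫ x, gradInner g φ φ x ∂vol g
    + ∫ x, scalarCurvature g x * φ x * φ x ∂vol g

omit [T2Space M] [BorelSpace M] [MeasurableSpace M] [CompactSpace M] in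
theorem contMDiff_exp_mul {f : M → ℝ} (hf : ContMDiff (𝓡 n) 𝓘(ℝ, ℝ) ∞ f) (k : ℝ) :
    ContMDiff (𝓡 n) 𝓘(ℝ, ℝ) ∞ fun x => Real.exp (k * f x) :=
  (show ContDiff ℝ ∞ fun t : ℝ => Real.exp (k * t) by fun_prop).contMDiff.comp hf

omit [T2Space M] [BorelSpace M] [MeasurableSpace M] [CompactSpace M] in
theorem gradInner_exp_mul_left (g : Metric n M) {f φ : M → ℝ}
    (hf : ContMDiff (𝓡 n) 𝓘(ℝ, ℝ) ∞ f) (hφ : ContMDiff (𝓡 n) 𝓘(ℝ, ℝ) ∞ φ) (k : ℝ) (x : M) :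
    gradInner g (fun x => Real.exp (k * f x)) φ x = k * Real.exp (k * f x) * gradInner g f φ x := by
  rw [gradInner_comp_left g (G := fun t : ℝ => Real.exp (k * t)) (by fun_prop) hf hφ]
  congr 1
  have : HasDerivAt (fun t : ℝ => Real.exp (k * t)) (Real.exp (k * f x) * (k * 1)) (f x) :=
    ((hasDerivAt_id _).const_mul k).exp
  rw [this.deriv]
  ring

theorem integral_vol_conformal {g h : Metric n M} {f : M → ℝ} (hf : Continuous f)
    (hh : ∀ (x : M) (a b : TangentSpace (𝓡 n) x),
      h.inner x a b = Real.exp (2 * f x) * g.inner x a b) (F : M → ℝ) :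
    ∫ x, F x ∂vol h = ∫ x, Real.exp (n * f x) * F x ∂vol g := by
  rw [vol_conformal hf hh, integral_withDensity_eq_integral_toReal_smul (by fun_prop)
    (Eventually.of_forall fun x => ENNReal.ofReal_lt_top)]
  refine integral_congr_ae (Eventually.of_forall fun x => ?_)
  simp only [ENNReal.toReal_ofReal (Real.exp_pos _).le, smul_eq_mul]

/-- Conformal covariance of the energy. -/
theorem energy_conformal (hn : 3 ≤ n) {g h : Metric n M} {f φ : M → ℝ}
    (hf : ContMDiff (𝓡 n) 𝓘(ℝ, ℝ) ∞ f)
    (hh : ∀ (x : M) (a b : TangentSpace (𝓡 n) x),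
      h.inner x a b = Real.exp (2 * f x) * g.inner x a b)
    (hφ : ContMDiff (𝓡 n) 𝓘(ℝ, ℝ) ∞ φ) :
    energy h φ = energy g fun x => Real.exp (((n : ℝ) - 2) / 2 * f x) * φ x := by
  have hn' : (3 : ℝ) ≤ n := by exact_mod_cast hn
  have hn2 : (n : ℝ) - 2 ≠ 0 := by linarith
  have hn1 : (n : ℝ) - 1 ≠ 0 := by linarith
  set k : ℝ := ((n : ℝ) - 2) / 2 with hk
  obtain ⟨L, hL, hgreen, huniq⟩ := exists_laplacian g hf
  have hLc : ∀ x₀, ∀ x ∈ (extChartAt (𝓡 n) x₀).source, scalarCurvature h x =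
      Real.exp (-(2 * f x)) * (scalarCurvature g x - 2 * ((n : ℝ) - 1) * chartLap g x₀ f x
      - ((n : ℝ) - 1) * ((n : ℝ) - 2) * gradInner g f f x) :=
    fun x₀ x hx => scalarCurvature_conformal hh hf x₀ hx
  have hexp : ∀ x, Real.exp (2 * f x) * Real.exp (-(2 * f x)) = 1 := fun x => by
    rw [← Real.exp_add]; simp
  -- Solving the curvature law for the Laplacian expresses it by quantities that do not refer to the
  -- chart. Thus the chart independence of the Laplacian is inherited from that of the scalar
  -- curvature, and L is the Laplacian computed in any chart.
  have hLeq : ∀ x₀, ∀ x ∈ (extChartAt (𝓡 n) x₀).source, chartLap g x₀ f x =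
      (scalarCurvature g x - ((n : ℝ) - 1) * ((n : ℝ) - 2) * gradInner g f f x
        - Real.exp (2 * f x) * scalarCurvature h x) / (2 * ((n : ℝ) - 1)) := by
    intro x₀ x hx
    rw [hLc x₀ x hx, ← mul_assoc, hexp]
    field_simp
    ring
  have hLx : ∀ x, scalarCurvature h x = Real.exp (-(2 * f x)) * (scalarCurvature g x
      - 2 * ((n : ℝ) - 1) * L x - ((n : ℝ) - 1) * ((n : ℝ) - 2) * gradInner g f f x) := by
    intro x
    have hx := mem_extChartAt_source (I := 𝓡 n) x
    rw [hLc x x hx, (congrFun (huniq _ hLeq) x).trans (hLeq x x hx).symm]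
  have hw := contMDiff_exp_mul hf k
  have hw2 := contMDiff_exp_mul hf ((n : ℝ) - 2)
  have hwφ : ContMDiff (𝓡 n) 𝓘(ℝ, ℝ) ∞ fun x => Real.exp (k * f x) * φ x := hw.mul hφ
  have hφ2 : ContMDiff (𝓡 n) 𝓘(ℝ, ℝ) ∞ fun x => φ x * φ x := hφ.mul hφ
  have hF : ContMDiff (𝓡 n) 𝓘(ℝ, ℝ) ∞ fun x => Real.exp (((n : ℝ) - 2) * f x) * (φ x * φ x) :=
    hw2.mul hφ2
  have hc1 := (continuous_gradInner g hwφ hwφ)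
  have hR := continuous_scalarCurvature g
  have hRh := continuous_scalarCurvature h
  have hc2 : Continuous fun x => scalarCurvature g x * (Real.exp (k * f x) * φ x)
      * (Real.exp (k * f x) * φ x) := (hR.mul hwφ.continuous).mul hwφ.continuous
  have hfc := hf.continuous
  have hφc := hφ.continuous
  have hc3 : Continuous fun x => Real.exp (n * f x) * gradInner h φ φ x :=
    (by fun_prop : Continuous fun x => Real.exp (n * f x)).mul (continuous_gradInner h hφ hφ)
  have hc4 : Continuous fun x => Real.exp (n * f x) * (scalarCurvature h x * φ x * φ x) := by
    fun_prop
  have hc5 := continuous_gradInner g hF hf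
  have hc6 : Continuous fun x => Real.exp (((n : ℝ) - 2) * f x) * (φ x * φ x) * L x := by fun_prop
  have e := hgreen _ hF
  have i1 : Integrable (fun x => 4 * ((n : ℝ) - 1) / ((n : ℝ) - 2) *
      gradInner g (fun x => Real.exp (k * f x) * φ x) (fun x => Real.exp (k * f x) * φ x) x +
      scalarCurvature g x * (Real.exp (k * f x) * φ x) * (Real.exp (k * f x) * φ x)) (vol g) :=
    ((hc1.integrable_vol g).const_mul _).add (hc2.integrable_vol g)
  have i2 : Integrable (fun x => 4 * ((n : ℝ) - 1) / ((n : ℝ) - 2) *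
      (Real.exp (n * f x) * gradInner h φ φ x) +
      Real.exp (n * f x) * (scalarCurvature h x * φ x * φ x)) (vol g) :=
    ((hc3.integrable_vol g).const_mul _).add (hc4.integrable_vol g)
  rw [energy, energy, integral_vol_conformal hf.continuous hh,
    integral_vol_conformal hf.continuous hh, ← integral_const_mul, ← integral_const_mul,
    ← integral_add ((hc3.integrable_vol g).const_mul _) (hc4.integrable_vol g),
    ← integral_add ((hc1.integrable_vol g).const_mul _) (hc2.integrable_vol g), eq_comm,
    ← sub_eq_zero, ← integral_sub i1 i2]
  -- Green's formula with F = e^{(n-2)f} φ². Pointwise, the two energy densities differ by 2(n-1)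
  -- times this integrand.
  have e0 : 2 * ((n : ℝ) - 1) * ∫ x, (gradInner g (fun x => Real.exp (((n : ℝ) - 2) * f x)
      * (φ x * φ x)) f x + Real.exp (((n : ℝ) - 2) * f x) * (φ x * φ x) * L x) ∂vol g = 0 := by
    rw [integral_add (hc5.integrable_vol g) (hc6.integrable_vol g), e]
    ring
  rw [← integral_const_mul] at e0
  rw [← e0]
  refine integral_congr_ae (Eventually.of_forall fun x => ?_)
  have s1 : gradInner g (fun x => Real.exp (k * f x) * φ x) (fun x => Real.exp (k * f x) * φ x) x =
      Real.exp (k * f x) * (Real.exp (k * f x) * gradInner g φ φ x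
        + φ x * (k * Real.exp (k * f x) * gradInner g f φ x))
      + φ x * (k * Real.exp (k * f x) * (Real.exp (k * f x) * gradInner g f φ x
        + φ x * (k * Real.exp (k * f x) * gradInner g f f x))) := by
    rw [gradInner_mul_left g hw hφ hwφ, gradInner_comm g φ, gradInner_mul_left g hw hφ hφ,
      gradInner_exp_mul_left g hf hφ, gradInner_exp_mul_left g hf hwφ,
      gradInner_comm g f fun x => Real.exp (k * f x) * φ x, gradInner_mul_left g hw hφ hf,
      gradInner_exp_mul_left g hf hf, gradInner_comm g φ f]
  have s2 : gradInner g (fun x => Real.exp (((n : ℝ) - 2) * f x) * (φ x * φ x)) f x =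
      Real.exp (((n : ℝ) - 2) * f x) * (φ x * gradInner g f φ x + φ x * gradInner g f φ x)
      + φ x * φ x * (((n : ℝ) - 2) * Real.exp (((n : ℝ) - 2) * f x) * gradInner g f f x) := by
    rw [gradInner_mul_left g hw2 hφ2 hf, gradInner_mul_left g hφ hφ hf,
      gradInner_exp_mul_left g hf hf, gradInner_comm g φ f]
  have t1 : Real.exp (((n : ℝ) - 2) * f x) = Real.exp (k * f x) * Real.exp (k * f x) := by
    rw [← Real.exp_add]; congr 1; rw [hk]; ring
  have t2 : Real.exp (n * f x) * Real.exp (-(2 * f x)) =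
      Real.exp (k * f x) * Real.exp (k * f x) := by
    rw [← t1, ← Real.exp_add]; congr 1; ring
  have t3 : ∀ a : ℝ, Real.exp (n * f x) * (Real.exp (-(2 * f x)) * a) =
      Real.exp (k * f x) * Real.exp (k * f x) * a := fun a => by rw [← t2]; ring
  have t4 : Real.exp (n * f x) * (scalarCurvature h x * φ x * φ x) =
      Real.exp (k * f x) * Real.exp (k * f x) * ((scalarCurvature g x
      - 2 * ((n : ℝ) - 1) * L x - ((n : ℝ) - 1) * ((n : ℝ) - 2) * gradInner g f f x)
        * φ x * φ x) := by
    rw [hLx, ← t2]; ring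
  simp only [t4, s1, s2, gradInner_conformal hh, t3, t1]
  rw [hk]
  field_simp
  ring

end Green

/-- The triangle inequality for a nonnegative quadratic polynomial `a + t b + t² c`. -/
theorem sqrt_add_le_of_forall_nonneg {a b c : ℝ} (h : ∀ t : ℝ, 0 ≤ a + t * b + t ^ 2 * c) :
    √(a + b + c) ≤ √a + √c := by
  have ha : 0 ≤ a := by simpa using h 0
  have hd : discrim c b a ≤ 0 := discrim_le_zero fun t => by
    have := h t
    nlinarith
  have hc : 0 ≤ c := by
    by_contra hc
    push Not at hc
    -- If c were negative, the polynomial would be negative at this point, which is chosen so large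
    -- that t²c outweighs a + t b.
    have := h ((a + 1 + |b|) / (-c) + 1)
    set s := (a + 1 + |b|) / (-c) with hs
    have h1 : s * c = -(a + 1 + |b|) := by rw [hs, div_neg, neg_mul, div_mul_cancel₀ _ hc.ne]
    have h2 : 0 ≤ s := by rw [hs]; exact div_nonneg (by positivity) (by linarith)
    nlinarith [neg_abs_le b, le_abs_self b, abs_nonneg b, mul_nonneg h2 (abs_nonneg b),
      mul_nonneg h2 (sub_nonneg.2 (le_abs_self b)), mul_nonneg h2 ha]
  have hb : b ≤ 2 * (√a * √c) := by
    refine le_trans (le_abs_self b) (abs_le_of_sq_le_sq ?_ (by positivity))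
    rw [discrim] at hd
    rw [mul_pow, mul_pow, Real.sq_sqrt ha, Real.sq_sqrt hc]
    linarith
  refine (Real.sqrt_le_left (by positivity)).2 ?_
  rw [add_sq, Real.sq_sqrt ha, Real.sq_sqrt hc]
  linarith

/-! ### Pointwise norms, the Dirichlet form and the curvature potential -/

section GradientAlgebra

variable {n : ℕ} {M : Type*} [TopologicalSpace M] [ChartedSpace (EuclideanSpace ℝ (Fin n)) M]
  [IsManifold (𝓡 n) ∞ M]

theorem gradient_eq_of_inner (g : Metric n M) {f : M → ℝ} {x : M} {v : TangentSpace (𝓡 n) x}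
    (h : ∀ a : TangentSpace (𝓡 n) x, g.inner x v a = mfderiv (𝓡 n) 𝓘(ℝ, ℝ) f x a) :
    gradient g f x = v := by
  rw [← sub_eq_zero]
  refine (metricForm_nondegenerate g x).1 _ fun a => ?_
  change g.inner x _ a = 0
  rw [map_sub, FunLike.coe_sub, Pi.sub_apply, inner_gradient, h]
  exact sub_self (G := ℝ) _

theorem gradient_add (g : Metric n M) {f₁ f₂ : M → ℝ} {x : M}
    (h₁ : MDifferentiableAt (𝓡 n) 𝓘(ℝ, ℝ) f₁ x) (h₂ : MDifferentiableAt (𝓡 n) 𝓘(ℝ, ℝ) f₂ x) :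
    gradient g (f₁ + f₂) x = gradient g f₁ x + gradient g f₂ x := by
  refine gradient_eq_of_inner g fun a => ?_
  rw [map_add, FunLike.coe_add, Pi.add_apply, inner_gradient, inner_gradient, mfderiv_add h₁ h₂]
  rfl

theorem gradient_smul (g : Metric n M) (c : ℝ) {f : M → ℝ} {x : M}
    (hf : MDifferentiableAt (𝓡 n) 𝓘(ℝ, ℝ) f x) :
    gradient g (c • f) x = c • gradient g f x := by
  refine gradient_eq_of_inner g fun a => ?_
  rw [map_smul, FunLike.coe_smul, Pi.smul_apply, inner_gradient, const_smul_mfderiv hf c]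
  rfl

theorem inner_self_nonneg (g : Metric n M) (x : M) (a : TangentSpace (𝓡 n) x) :
    0 ≤ g.inner x a a := by
  rcases eq_or_ne a 0 with rfl | h
  · simp
  · exact (g.pos x a h).le

theorem tangentNorm_nonneg (g : Metric n M) (x : M) (a : TangentSpace (𝓡 n) x) :
    0 ≤ tangentNorm g x a := Real.sqrt_nonneg _

theorem tangentNorm_sq (g : Metric n M) (x : M) (a : TangentSpace (𝓡 n) x) :
    tangentNorm g x a ^ 2 = g.inner x a a := Real.sq_sqrt (inner_self_nonneg g x a)

theorem tangentNorm_neg (g : Metric n M) (x : M) (a : TangentSpace (𝓡 n) x) :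
    tangentNorm g x (-a) = tangentNorm g x a := by
  simp [tangentNorm]

theorem tangentNorm_add_le (g : Metric n M) (x : M) (a b : TangentSpace (𝓡 n) x) :
    tangentNorm g x (a + b) ≤ tangentNorm g x a + tangentNorm g x b := by
  have e : ∀ t : ℝ, g.inner x (a + t • b) (a + t • b) = g.inner x a a
      + t * (2 * g.inner x a b) + t ^ 2 * g.inner x b b := by
    intro t
    simp only [map_add, map_smul, FunLike.coe_add, FunLike.coe_smul, Pi.add_apply, Pi.smul_apply,
      smul_eq_mul, g.symm x b a]
    ring
  have h := sqrt_add_le_of_forall_nonneg (a := g.inner x a a) (b := 2 * g.inner x a b)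
    (c := g.inner x b b) fun t => by
      rw [← e]
      exact inner_self_nonneg g x _
  have e1 := e 1
  rw [one_smul, one_mul, one_pow, one_mul] at e1
  rw [tangentNorm, e1]
  exact h

theorem tangentNorm_sub_comm (g : Metric n M) (x : M) (a b : TangentSpace (𝓡 n) x) :
    tangentNorm g x (a - b) = tangentNorm g x (b - a) := by
  rw [← tangentNorm_neg, neg_sub]

theorem tangentNorm_sub_le (g : Metric n M) (x : M) (a b c : TangentSpace (𝓡 n) x) :
    tangentNorm g x (a - c) ≤ tangentNorm g x (a - b) + tangentNorm g x (b - c) := by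
  have := tangentNorm_add_le g x (a - b) (b - c)
  rwa [sub_add_sub_cancel] at this

theorem abs_tangentNorm_sub_le (g : Metric n M) (x : M) (a b : TangentSpace (𝓡 n) x) :
    |tangentNorm g x a - tangentNorm g x b| ≤ tangentNorm g x (a - b) := by
  have h₁ := tangentNorm_add_le g x (a - b) b
  have h₂ := tangentNorm_add_le g x (b - a) a
  rw [sub_add_cancel] at h₁ h₂
  rw [tangentNorm_sub_comm g x b a] at h₂
  exact abs_sub_le_iff.2 ⟨by linarith, by linarith⟩

/-- Completeness of the tangent spaces. -/
theorem exists_tangentNorm_tendsto (g : Metric n M) (x : M) (a : ℕ → TangentSpace (𝓡 n) x)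
    (ha : Summable fun j => tangentNorm g x (a (j + 1) - a j)) :
    ∃ X : TangentSpace (𝓡 n) x, ∀ b : TangentSpace (𝓡 n) x,
      Tendsto (fun j => tangentNorm g x (b - a j)) atTop (𝓝 (tangentNorm g x (b - X))) := by
  let L : EuclideanSpace ℝ (Fin n) →L[ℝ] EuclideanSpace ℝ (Fin n) →L[ℝ] ℝ := g.inner x
  let N : EuclideanSpace ℝ (Fin n) → ℝ := fun v => √(L v v)
  have hN : Continuous N := Real.continuous_sqrt.comp (L.continuous.clm_apply continuous_id)
  have hb := g.isVonNBounded x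
  have hb' : Bornology.IsVonNBounded ℝ {v : EuclideanSpace ℝ (Fin n) | L v v < 1} := hb
  rw [NormedSpace.isVonNBounded_iff] at hb'
  obtain ⟨C, hC⟩ := hb'.exists_norm_le
  -- The unit ball of the metric at x is bounded by C in the Euclidean norm. Rescaling v to metric
  -- length 1/2, inside the open ball, gives the factor 2C.
  have hle : ∀ v : EuclideanSpace ℝ (Fin n), ‖v‖ ≤ 2 * C * N v := by
    intro v
    rcases eq_or_ne v 0 with rfl | hv
    · simp [N]
    have hLpos : 0 < L v v := g.pos x v hv
    have hpos : 0 < N v := Real.sqrt_pos.2 hLpos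
    have hNN : L v v = N v * N v := (Real.mul_self_sqrt hLpos.le).symm
    have hm := hC ((1 / (2 * N v)) • v) (by
      change L ((1 / (2 * N v)) • v) ((1 / (2 * N v)) • v) < 1
      rw [map_smul, map_smul, FunLike.coe_smul, Pi.smul_apply, hNN, smul_eq_mul, smul_eq_mul]
      field_simp
      norm_num)
    rw [norm_smul, Real.norm_of_nonneg (by positivity), one_div, inv_mul_le_iff₀ (by positivity)]
      at hm
    linarith
  let a' : ℕ → EuclideanSpace ℝ (Fin n) := a
  have hs : Summable fun j => dist (a' j) (a' (j + 1)) := by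
    refine Summable.of_nonneg_of_le (fun j => dist_nonneg) (fun j => ?_) (ha.mul_left (2 * C))
    rw [dist_comm, dist_eq_norm]
    exact hle _
  obtain ⟨X, hX⟩ := cauchySeq_tendsto_of_complete (cauchySeq_of_summable_dist hs)
  refine ⟨X, fun b => ?_⟩
  let b' : EuclideanSpace ℝ (Fin n) := b
  have : Tendsto (fun j => N (b' - a' j)) atTop (𝓝 (N (b' - X))) :=
    (hN.tendsto _).comp (tendsto_const_nhds.sub hX)
  exact this

variable (n M) in
/-- The space `C^∞(M)`. -/
abbrev Smooth : Type _ := ContMDiffMap (𝓡 n) 𝓘(ℝ, ℝ) M ℝ ∞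

theorem Smooth.mdiff (φ : Smooth n M) (x : M) : MDifferentiableAt (𝓡 n) 𝓘(ℝ, ℝ) φ x :=
  φ.contMDiff.mdiffAt x

theorem gradient_sub (g : Metric n M) (φ ψ : Smooth n M) (x : M) :
    gradient g ⇑(φ - ψ) x = gradient g φ x - gradient g ψ x := by
  have e : ⇑(φ - ψ) = ⇑φ + (-1 : ℝ) • ⇑ψ := by
    funext y
    simp [sub_eq_add_neg]
  have hd : MDifferentiableAt (𝓡 n) 𝓘(ℝ, ℝ) ((-1 : ℝ) • ⇑ψ) x := (ψ.mdiff x).const_smul _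
  rw [e, gradient_add g (φ.mdiff x) hd, gradient_smul g _ (ψ.mdiff x)]
  module

variable [MeasurableSpace M] [BorelSpace M] [T2Space M] [CompactSpace M]

/-- The Dirichlet form `∫ g(∇φ, ∇ψ)`. -/
def dirichlet (g : Metric n M) : LinearMap.BilinForm ℝ (Smooth n M) :=
  LinearMap.mk₂ ℝ (fun φ ψ => ∫ x, gradInner g φ ψ x ∂vol g)
    (fun φ₁ φ₂ ψ => by
      rw [← integral_add ((continuous_gradInner g φ₁.contMDiff ψ.contMDiff).integrable_vol g)
        ((continuous_gradInner g φ₂.contMDiff ψ.contMDiff).integrable_vol g)]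
      refine integral_congr_ae (Eventually.of_forall fun x => ?_)
      simp only [gradInner]
      rw [ContMDiffMap.coe_add, gradient_add g (φ₁.mdiff x) (φ₂.mdiff x), map_add]
      rfl)
    (fun c φ ψ => by
      rw [smul_eq_mul, ← integral_const_mul]
      refine integral_congr_ae (Eventually.of_forall fun x => ?_)
      simp only [gradInner]
      rw [ContMDiffMap.coe_smul, gradient_smul g c (φ.mdiff x), map_smul]
      rfl)
    (fun ψ φ₁ φ₂ => by
      rw [← integral_add ((continuous_gradInner g ψ.contMDiff φ₁.contMDiff).integrable_vol g)
        ((continuous_gradInner g ψ.contMDiff φ₂.contMDiff).integrable_vol g)]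
      refine integral_congr_ae (Eventually.of_forall fun x => ?_)
      simp only [gradInner]
      rw [ContMDiffMap.coe_add, gradient_add g (φ₁.mdiff x) (φ₂.mdiff x), map_add])
    (fun c ψ φ => by
      rw [smul_eq_mul, ← integral_const_mul]
      refine integral_congr_ae (Eventually.of_forall fun x => ?_)
      simp only [gradInner]
      rw [ContMDiffMap.coe_smul, gradient_smul g c (φ.mdiff x), map_smul]
      rfl)

theorem dirichlet_apply (g : Metric n M) (φ ψ : Smooth n M) :
    dirichlet g φ ψ = ∫ x, gradInner g φ ψ x ∂vol g := rfl

theorem dirichlet_comm (g : Metric n M) (φ ψ : Smooth n M) :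
    dirichlet g φ ψ = dirichlet g ψ φ := by
  simp only [dirichlet_apply, gradInner_comm g φ ψ]

theorem dirichlet_self_nonneg (g : Metric n M) (φ : Smooth n M) : 0 ≤ dirichlet g φ φ :=
  integral_nonneg fun x => inner_self_nonneg g x _

theorem exists_bound_scalarCurvature (g : Metric n M) : ∃ C : ℝ, 0 ≤ C ∧
    ∀ x, |scalarCurvature g x| ≤ C := by
  obtain ⟨C, hC⟩ := (isCompact_univ (X := M)).exists_bound_of_continuousOn
    (continuous_scalarCurvature g).continuousOn
  exact ⟨max C 0, le_max_right _ _, fun x => (hC x trivial).trans (le_max_left _ _)⟩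

theorem Smooth.memLp (g : Metric n M) (φ : Smooth n M) (p : ℝ≥0∞) : MemLp φ p (vol g) :=
  φ.contMDiff.continuous.memLp_of_hasCompactSupport (HasCompactSupport.of_compactSpace _)

/-- Smooth functions as elements of `L²`. -/
def toL2 (g : Metric n M) : Smooth n M →ₗ[ℝ] Lp ℝ 2 (vol g) where
  toFun φ := (φ.memLp g 2).toLp φ
  map_add' _ _ := rfl
  map_smul' _ _ := rfl

theorem coeFn_toL2 (g : Metric n M) (φ : Smooth n M) : toL2 g φ =ᵐ[vol g] φ :=
  MemLp.coeFn_toLp (φ.memLp g 2)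

omit [T2Space M] in
-- The integrand is dominated by C|u||v|, whose integral is an L² inner product, so Cauchy–Schwarz
-- applies. Hence the curvature term is a bounded bilinear form on L² and only the Dirichlet part
-- requires derivatives.
theorem abs_integral_scalarCurvature_le (g : Metric n M) {C : ℝ} (hC0 : 0 ≤ C)
    (hC : ∀ x, |scalarCurvature g x| ≤ C) (u v : Lp ℝ 2 (vol g)) :
    Integrable (fun x => scalarCurvature g x * u x * v x) (vol g) ∧
      ‖∫ x, scalarCurvature g x * u x * v x ∂vol g‖ ≤ C * ‖u‖ * ‖v‖ := by
  have hm : AEStronglyMeasurable (fun x => scalarCurvature g x * u x * v x) (vol g) :=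
    ((continuous_scalarCurvature g).measurable.aestronglyMeasurable.mul
      (Lp.aestronglyMeasurable u)).mul (Lp.aestronglyMeasurable v)
  have hi : Integrable (fun x => C * inner ℝ ((|u| : Lp ℝ 2 (vol g)) x) ((|v| : Lp ℝ 2 (vol g)) x))
      (vol g) := (L2.integrable_inner _ _).const_mul C
  have hle : ∀ᵐ x ∂vol g, ‖scalarCurvature g x * u x * v x‖ ≤
      C * inner ℝ ((|u| : Lp ℝ 2 (vol g)) x) ((|v| : Lp ℝ 2 (vol g)) x) := by
    filter_upwards [Lp.coeFn_abs u, Lp.coeFn_abs v] with x hu hv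
    rw [hu, hv, norm_mul, norm_mul, Real.norm_eq_abs, Real.norm_eq_abs, Real.norm_eq_abs]
    simp only [RCLike.inner_apply, conj_trivial]
    rw [mul_assoc, mul_comm |v x|]
    exact mul_le_mul_of_nonneg_right (hC x) (by positivity)
  refine ⟨hi.mono' hm hle, (norm_integral_le_of_norm_le hi hle).trans ?_⟩
  rw [integral_const_mul, ← L2.inner_def, mul_assoc]
  refine mul_le_mul_of_nonneg_left ?_ hC0
  refine (real_inner_le_norm _ _).trans ?_
  rw [norm_abs_eq_norm, norm_abs_eq_norm]

/-- The potential term `∫ R u v` on `L²`. -/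
def potential (g : Metric n M) : Lp ℝ 2 (vol g) →L[ℝ] Lp ℝ 2 (vol g) →L[ℝ] ℝ :=
  LinearMap.mkContinuous₂ (LinearMap.mk₂ ℝ
    (fun u v : Lp ℝ 2 (vol g) => ∫ x, scalarCurvature g x * u x * v x ∂vol g)
    (fun u₁ u₂ v => by
      obtain ⟨C, hC0, hC⟩ := exists_bound_scalarCurvature g
      rw [← integral_add (abs_integral_scalarCurvature_le g hC0 hC u₁ v).1
        (abs_integral_scalarCurvature_le g hC0 hC u₂ v).1]
      refine integral_congr_ae ?_
      filter_upwards [Lp.coeFn_add u₁ u₂] with x hx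
      rw [hx, Pi.add_apply]
      ring)
    (fun c u v => by
      rw [smul_eq_mul, ← integral_const_mul]
      refine integral_congr_ae ?_
      filter_upwards [Lp.coeFn_smul c u] with x hx
      rw [hx, Pi.smul_apply, smul_eq_mul]
      ring)
    (fun v u₁ u₂ => by
      obtain ⟨C, hC0, hC⟩ := exists_bound_scalarCurvature g
      rw [← integral_add (abs_integral_scalarCurvature_le g hC0 hC v u₁).1
        (abs_integral_scalarCurvature_le g hC0 hC v u₂).1]
      refine integral_congr_ae ?_
      filter_upwards [Lp.coeFn_add u₁ u₂] with x hx
      rw [hx, Pi.add_apply]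
      ring)
    (fun c v u => by
      rw [smul_eq_mul, ← integral_const_mul]
      refine integral_congr_ae ?_
      filter_upwards [Lp.coeFn_smul c u] with x hx
      rw [hx, Pi.smul_apply, smul_eq_mul]
      ring)) (exists_bound_scalarCurvature g).choose
    (fun u v => (abs_integral_scalarCurvature_le g
      (exists_bound_scalarCurvature g).choose_spec.1
      (exists_bound_scalarCurvature g).choose_spec.2 u v).2)

theorem potential_apply (g : Metric n M) (u v : Lp ℝ 2 (vol g)) :
    potential g u v = ∫ x, scalarCurvature g x * u x * v x ∂vol g := rfl

theorem potential_comm (g : Metric n M) (u v : Lp ℝ 2 (vol g)) :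
    potential g u v = potential g v u := by
  simp only [potential_apply]
  exact integral_congr_ae (Eventually.of_forall fun x => by ring)

end GradientAlgebra

theorem integral_sq_eq_toReal_eLpNorm_sq {α : Type*} [MeasurableSpace α] {μ : Measure α} {f : α → ℝ}
    (hf : MemLp f 2 μ) : ∫ x, f x ^ 2 ∂μ = (eLpNorm f 2 μ).toReal ^ 2 := by
  rw [← Lp.norm_toLp f hf, ← real_inner_self_eq_norm_sq, L2.inner_def]
  refine integral_congr_ae ?_
  filter_upwards [hf.coeFn_toLp] with x hx
  rw [hx]
  simp [sq]

theorem tendsto_apply_self {E : Type*} [NormedAddCommGroup E] [NormedSpace ℝ E]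
    (B : E →L[ℝ] E →L[ℝ] ℝ) {ι : Type*} {l : Filter ι} {u : E} {v : ι → E}
    (h : Tendsto v l (𝓝 u)) :
    Tendsto (fun k => B (v k) (v k)) l (𝓝 (B u u)) :=
  (B.continuous₂.tendsto (u, u)).comp (h.prodMk_nhds h)

/-! ### H¹ through approximating sequences; closability of the Dirichlet form -/

section Approximation

variable {n : ℕ} {M : Type*} [TopologicalSpace M] [ChartedSpace (EuclideanSpace ℝ (Fin n)) M]
  [IsManifold (𝓡 n) ∞ M] [MeasurableSpace M] [BorelSpace M] [T2Space M] [CompactSpace M]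

/-- The length of the gradient of a smooth function. -/
def gradLength (g : Metric n M) (φ : Smooth n M) (x : M) : ℝ := tangentNorm g x (gradient g φ x)

omit [MeasurableSpace M] [BorelSpace M] [T2Space M] [CompactSpace M] in
theorem continuous_gradLength (g : Metric n M) (φ : Smooth n M) : Continuous (gradLength g φ) :=
  Real.continuous_sqrt.comp (continuous_gradInner g φ.contMDiff φ.contMDiff)

theorem memLp_gradLength (g : Metric n M) (φ : Smooth n M) : MemLp (gradLength g φ) 2 (vol g) :=
  (continuous_gradLength g φ).memLp_of_hasCompactSupport (HasCompactSupport.of_compactSpace _)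

omit [MeasurableSpace M] [BorelSpace M] [T2Space M] [CompactSpace M] in
theorem gradLength_sub (g : Metric n M) (φ ψ : Smooth n M) (x : M) :
    gradLength g (φ - ψ) x = tangentNorm g x (gradient g φ x - gradient g ψ x) := by
  rw [gradLength, gradient_sub]

theorem dirichlet_eq_sq (g : Metric n M) (φ : Smooth n M) :
    dirichlet g φ φ = (eLpNorm (gradLength g φ) 2 (vol g)).toReal ^ 2 := by
  rw [← integral_sq_eq_toReal_eLpNorm_sq (memLp_gradLength g φ), dirichlet_apply]
  exact integral_congr_ae (Eventually.of_forall fun x => (tangentNorm_sq g x _).symm)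

/-- The functions `φ_k` approximate `u` in `L²` and form a Cauchy sequence in `H¹`. -/
structure IsApprox (g : Metric n M) (u : Lp ℝ 2 (vol g)) (φ : ℕ → Smooth n M) : Prop where
  tendsto : Tendsto (fun k => toL2 g (φ k)) atTop (𝓝 u)
  cauchy : Tendsto (fun p : ℕ × ℕ => dirichlet g (φ p.1 - φ p.2) (φ p.1 - φ p.2)) atTop (𝓝 0)

/-- Green's formula moves the derivatives to the fixed function ψ, leaving an L² pairing with θ_k.
-/
theorem tendsto_dirichlet_zero (g : Metric n M) {θ : ℕ → Smooth n M}
    (hθ : Tendsto (fun k => toL2 g (θ k)) atTop (𝓝 0)) (ψ : Smooth n M) :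
    Tendsto (fun k => dirichlet g (θ k) ψ) atTop (𝓝 0) := by
  obtain ⟨L, hL, hgreen, -⟩ := exists_laplacian g ψ.contMDiff
  have hLm : MemLp L 2 (vol g) :=
    hL.memLp_of_hasCompactSupport (HasCompactSupport.of_compactSpace _)
  have e : ∀ k, dirichlet g (θ k) ψ = - inner ℝ (toL2 g (θ k)) (hLm.toLp L) := by
    intro k
    rw [dirichlet_apply, hgreen _ (θ k).contMDiff, L2.inner_def, neg_inj]
    refine integral_congr_ae ?_
    filter_upwards [coeFn_toL2 g (θ k), hLm.coeFn_toLp] with x h₁ h₂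
    rw [h₁, h₂]
    simp [mul_comm]
  simp only [e]
  have := (hθ.inner (tendsto_const_nhds (x := hLm.toLp L))).neg (G := ℝ)
  simpa using this

/-- Closability. Write D for the Dirichlet form; then D(θ_k,θ_k) ≤ D(θ_k−θ_m,θ_k−θ_m) + 2D(θ_m,θ_k).
The first term is small by the Cauchy property, and the second vanishes as m → ∞ because θ_m → 0 in
L². -/
theorem IsApprox.dirichlet_tendsto_zero {g : Metric n M} {θ : ℕ → Smooth n M}
    (h : IsApprox g 0 θ) : Tendsto (fun k => dirichlet g (θ k) (θ k)) atTop (𝓝 0) := by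
  rw [Metric.tendsto_atTop]
  intro ε hε
  have h₁ := h.cauchy.eventually (gt_mem_nhds (half_pos hε))
  rw [eventually_atTop_prod_self] at h₁
  obtain ⟨K, hK⟩ := h₁
  refine ⟨K, fun k hk => ?_⟩
  rw [Real.dist_0_eq_abs, abs_of_nonneg (dirichlet_self_nonneg g _)]
  have h₂ : ∀ m, dirichlet g (θ k) (θ k) ≤
      dirichlet g (θ k - θ m) (θ k - θ m) + 2 * dirichlet g (θ m) (θ k) := by
    intro m
    have := dirichlet_self_nonneg g (θ m)
    simp only [map_sub, LinearMap.sub_apply, dirichlet_comm g (θ k) (θ m)]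
    linarith
  have h₃ : dirichlet g (θ k) (θ k) ≤ ε / 2 + 2 * 0 := by
    refine ge_of_tendsto (tendsto_const_nhds.add
      ((tendsto_dirichlet_zero g h.tendsto (θ k)).const_mul 2)) ?_
    filter_upwards [eventually_ge_atTop K] with m hm
    exact (h₂ m).trans (by linarith [hK k m hk hm])
  linarith

theorem toL2_tendsto_iff (g : Metric n M) (u : Lp ℝ 2 (vol g)) (φ : ℕ → Smooth n M) :
    Tendsto (fun k => toL2 g (φ k)) atTop (𝓝 u) ↔
      Tendsto (fun k => eLpNorm (fun x => φ k x - u x) 2 (vol g)) atTop (𝓝 0) := by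
  rw [Lp.tendsto_Lp_iff_tendsto_eLpNorm']
  have e : ∀ k, eLpNorm (⇑(toL2 g (φ k)) - ⇑u) 2 (vol g)
      = eLpNorm (fun x => φ k x - u x) 2 (vol g) := by
    intro k
    refine eLpNorm_congr_ae ?_
    filter_upwards [coeFn_toL2 g (φ k)] with x hx
    rw [Pi.sub_apply, hx]
  simp only [e]

theorem HasWeakGradient.exists_isApprox {g : Metric n M} {u : Lp ℝ 2 (vol g)}
    {X : Π x : M, TangentSpace (𝓡 n) x} (h : HasWeakGradient g u X) :
    ∃ φ, IsApprox g u φ ∧ Tendsto (fun k => dirichlet g (φ k) (φ k)) atTop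
      (𝓝 (∫ x, g.inner x (X x) (X x) ∂vol g)) := by
  obtain ⟨φ₀, hφ₀, hu, hmem, hlim⟩ := h
  let φ : ℕ → Smooth n M := fun k => ⟨φ₀ k, hφ₀ k⟩
  let T : ℕ → M → ℝ := fun k x => tangentNorm g x (gradient g (φ k) x - X x)
  change ∀ k, MemLp (T k) 2 (vol g) at hmem
  change Tendsto (fun k => eLpNorm (T k) 2 (vol g)) atTop (𝓝 0) at hlim
  refine ⟨φ, ⟨(toL2_tendsto_iff g u φ).2 hu, ?_⟩, ?_⟩
  · have hle : ∀ p : ℕ × ℕ, eLpNorm (gradLength g (φ p.1 - φ p.2)) 2 (vol g) ≤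
        eLpNorm (T p.1) 2 (vol g) + eLpNorm (T p.2) 2 (vol g) := by
      intro p
      refine (eLpNorm_mono_real (g := fun x => T p.1 x + T p.2 x) fun x => ?_).trans
        (eLpNorm_add_le (hmem _).1 (hmem _).1 (by norm_num))
      rw [gradLength_sub, Real.norm_of_nonneg (tangentNorm_nonneg _ _ _)]
      refine (tangentNorm_sub_le g x _ (X x) _).trans_eq ?_
      rw [tangentNorm_sub_comm g x (X x)]
    have hz : Tendsto (fun p : ℕ × ℕ => eLpNorm (T p.1) 2 (vol g) + eLpNorm (T p.2) 2 (vol g))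
        atTop (𝓝 0) := by
      rw [← prod_atTop_atTop_eq]
      simpa using (hlim.comp tendsto_fst).add (hlim.comp tendsto_snd)
    have hN : Tendsto (fun p : ℕ × ℕ => eLpNorm (gradLength g (φ p.1 - φ p.2)) 2 (vol g)) atTop
        (𝓝 0) := tendsto_of_tendsto_of_tendsto_of_le_of_le tendsto_const_nhds hz
      (fun _ => zero_le) hle
    simp only [dirichlet_eq_sq]
    simpa using ((ENNReal.tendsto_toReal ENNReal.zero_ne_top).comp hN).pow 2
  · have hle : ∀ k x, |gradLength g (φ k) x - tangentNorm g x (X x)| ≤ T k x := fun k x =>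
      abs_tangentNorm_sub_le g x _ _
    -- The field X is not assumed measurable; its length is measurable as an almost everywhere limit
    -- of gradient lengths along a subsequence.
    have hXm : AEStronglyMeasurable (fun x => tangentNorm g x (X x)) (vol g) := by
      have hTm : TendstoInMeasure (vol g) T atTop (fun _ => (0 : ℝ)) := by
        refine tendstoInMeasure_of_tendsto_eLpNorm (p := 2) (by norm_num) (fun k => (hmem k).1)
          aestronglyMeasurable_const ?_
        refine hlim.congr fun k => ?_
        congr 1
        funext x
        simp
      obtain ⟨ns, -, hns⟩ := hTm.exists_seq_tendsto_ae
      refine aestronglyMeasurable_of_tendsto_ae atTop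
        (f := fun j => gradLength g (φ (ns j))) (fun j => (memLp_gradLength g _).1) ?_
      filter_upwards [hns] with x hx
      rw [tendsto_iff_dist_tendsto_zero]
      exact squeeze_zero (fun _ => dist_nonneg) (fun j => hle (ns j) x) hx
    have hX : MemLp (fun x => tangentNorm g x (X x)) 2 (vol g) := by
      refine ((memLp_gradLength g (φ 0)).add (hmem 0)).mono' hXm (Eventually.of_forall fun x => ?_)
      have := abs_sub_le_iff.1 (hle 0 x)
      rw [Real.norm_of_nonneg (tangentNorm_nonneg _ _ _), Pi.add_apply]
      linarith [this.2]
    have hl : Tendsto (fun k => (memLp_gradLength g (φ k)).toLp _) atTop (𝓝 (hX.toLp _)) := by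
      rw [Lp.tendsto_Lp_iff_tendsto_eLpNorm'']
      refine tendsto_of_tendsto_of_tendsto_of_le_of_le tendsto_const_nhds hlim
        (fun _ => zero_le) fun k => eLpNorm_mono_real fun x => ?_
      exact hle k x
    have hn := hl.norm.pow 2
    simp only [Lp.norm_toLp, ← dirichlet_eq_sq, ← integral_sq_eq_toReal_eLpNorm_sq hX,
      tangentNorm_sq] at hn
    exact hn

/-- On a finite measure space the L¹ norms of the increments are also bounded by a geometric series,
so the sum of the increments has finite integral and is finite almost everywhere. -/
theorem ae_summable_tangentNorm {g : Metric n M} {ψ : ℕ → Smooth n M}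
    (hψ : ∀ j m, j ≤ m →
      eLpNorm (gradLength g (ψ j - ψ m)) 2 (vol g) ≤ ENNReal.ofReal ((1 / 2) ^ j)) :
    ∀ᵐ x ∂vol g, Summable fun j =>
      tangentNorm g x (gradient g (ψ (j + 1)) x - gradient g (ψ j) x) := by
  have hfin : ∫⁻ x, ∑' j, ENNReal.ofReal (gradLength g (ψ j - ψ (j + 1)) x) ∂vol g ≠ ⊤ := by
    rw [lintegral_tsum fun j =>
      (continuous_gradLength g _).measurable.ennreal_ofReal.aemeasurable]
    have hj : ∀ j, ∫⁻ x, ENNReal.ofReal (gradLength g (ψ j - ψ (j + 1)) x) ∂vol g ≤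
        ENNReal.ofReal ((1 / 2) ^ j) * vol g Set.univ ^ (1 / (1 : ℝ≥0∞).toReal
          - 1 / (2 : ℝ≥0∞).toReal) := by
      intro j
      have h₁ := eLpNorm_le_eLpNorm_mul_rpow_measure_univ (p := 1) (q := 2) (by norm_num)
        (memLp_gradLength g (ψ j - ψ (j + 1))).1
      rw [eLpNorm_one_eq_lintegral_enorm] at h₁
      calc ∫⁻ x, ENNReal.ofReal (gradLength g (ψ j - ψ (j + 1)) x) ∂vol g
          = ∫⁻ x, ‖gradLength g (ψ j - ψ (j + 1)) x‖ₑ ∂vol g :=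
            lintegral_congr fun x => (Real.enorm_of_nonneg (tangentNorm_nonneg _ _ _)).symm
        _ ≤ _ := h₁.trans (by gcongr; exact hψ j (j + 1) (Nat.le_succ j))
    refine ((ENNReal.tsum_le_tsum hj).trans_lt ?_).ne
    rw [ENNReal.tsum_mul_right]
    refine ENNReal.mul_lt_top ?_ (ENNReal.rpow_lt_top_of_nonneg (by norm_num)
      (measure_ne_top _ _))
    rw [← ENNReal.ofReal_tsum_of_nonneg (fun _ => by positivity) summable_geometric_two]
    exact ENNReal.ofReal_lt_top
  filter_upwards [ae_lt_top' (AEMeasurable.ennreal_tsum fun j =>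
    (continuous_gradLength g _).measurable.ennreal_ofReal.aemeasurable) hfin] with x hx
  have := ENNReal.summable_toReal hx.ne
  refine this.congr fun j => ?_
  rw [gradLength_sub, ENNReal.toReal_ofReal (tangentNorm_nonneg _ _ _), tangentNorm_sub_comm]

/-- The Riesz–Fischer argument, carried out by hand for vector fields: along a rapidly Cauchy
subsequence the gradients converge at almost every point, and Fatou's lemma upgrades this to L²
convergence. -/
theorem IsApprox.exists_hasWeakGradient {g : Metric n M} {u : Lp ℝ 2 (vol g)}
    {φ : ℕ → Smooth n M} (h : IsApprox g u φ) : ∃ X, HasWeakGradient g u X := by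
  classical
  have hev : ∀ j : ℕ, ∀ᶠ k in atTop, ∀ l ≥ k,
      eLpNorm (gradLength g (φ k - φ l)) 2 (vol g) ≤ ENNReal.ofReal ((1 / 2) ^ j) := by
    intro j
    have h₁ := h.cauchy.eventually (gt_mem_nhds (show (0 : ℝ) < ((1 / 2) ^ j) ^ 2 by positivity))
    rw [eventually_atTop_prod_self] at h₁
    obtain ⟨K, hK⟩ := h₁
    filter_upwards [eventually_ge_atTop K] with k hk l hl
    have := hK k l hk (hk.trans hl)
    rw [dirichlet_eq_sq] at this
    rw [ENNReal.le_ofReal_iff_toReal_le (memLp_gradLength g _).2.ne (by positivity)]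
    exact (lt_of_pow_lt_pow_left₀ 2 (by positivity) this).le
  obtain ⟨s, hs, hsb⟩ := extraction_forall_of_eventually hev
  let ψ : ℕ → Smooth n M := fun j => φ (s j)
  have hψ : ∀ j m, j ≤ m →
      eLpNorm (gradLength g (ψ j - ψ m)) 2 (vol g) ≤ ENNReal.ofReal ((1 / 2) ^ j) :=
    fun j m hjm => hsb j _ (hs.monotone hjm)
  have hsum := ae_summable_tangentNorm hψ
  -- X must be defined everywhere; on the null set without summability it is set to zero.
  have hex : ∀ x, ∃ Y : TangentSpace (𝓡 n) x, (Summable fun j =>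
      tangentNorm g x (gradient g (ψ (j + 1)) x - gradient g (ψ j) x)) →
      ∀ b : TangentSpace (𝓡 n) x, Tendsto (fun j => tangentNorm g x (b - gradient g (ψ j) x)) atTop
        (𝓝 (tangentNorm g x (b - Y))) := by
    intro x
    by_cases hx : Summable fun j =>
      tangentNorm g x (gradient g (ψ (j + 1)) x - gradient g (ψ j) x)
    · obtain ⟨Y, hY⟩ := exists_tangentNorm_tendsto g x (fun j => gradient g (ψ j) x) hx
      exact ⟨Y, fun _ => hY⟩
    · exact ⟨0, fun h => absurd h hx⟩
  choose X hX using hex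
  have hlim : ∀ j, ∀ᵐ x ∂vol g, Tendsto (fun m => gradLength g (ψ j - ψ m) x) atTop
      (𝓝 (tangentNorm g x (gradient g (ψ j) x - X x))) := by
    intro j
    filter_upwards [hsum] with x hx
    simp only [gradLength_sub]
    exact hX x hx _
  have hmeas : ∀ j, AEStronglyMeasurable
      (fun x => tangentNorm g x (gradient g (ψ j) x - X x)) (vol g) := fun j =>
    aestronglyMeasurable_of_tendsto_ae atTop (fun m => (memLp_gradLength g (ψ j - ψ m)).1) (hlim j)
  have hbd : ∀ j, eLpNorm (fun x => tangentNorm g x (gradient g (ψ j) x - X x)) 2 (vol g) ≤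
      ENNReal.ofReal ((1 / 2) ^ j) := by
    intro j
    refine (Lp.eLpNorm_lim_le_liminf_eLpNorm (fun m => (memLp_gradLength g (ψ j - ψ m)).1) _
      (hlim j)).trans ?_
    refine liminf_le_of_frequently_le' (Eventually.frequently ?_)
    filter_upwards [eventually_ge_atTop j] with m hm
    exact hψ j m hm
  refine ⟨X, fun j => ψ j, fun j => (ψ j).contMDiff,
    (toL2_tendsto_iff g u ψ).1 (h.tendsto.comp hs.tendsto_atTop),
    fun j => ⟨hmeas j, (hbd j).trans_lt ENNReal.ofReal_lt_top⟩, ?_⟩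
  refine tendsto_of_tendsto_of_tendsto_of_le_of_le tendsto_const_nhds ?_ (fun _ => zero_le) hbd
  have := ENNReal.tendsto_ofReal (tendsto_pow_atTop_nhds_zero_of_lt_one (r := (1 / 2 : ℝ))
    (by norm_num) (by norm_num))
  simpa using this

/-- This removes weak gradients from the description of H¹, where only smooth approximations are
used from now on. -/
theorem mem_H1_iff {g : Metric n M} {u : Lp ℝ 2 (vol g)} : u ∈ H1 g ↔ ∃ φ, IsApprox g u φ :=
  ⟨fun ⟨_, hX⟩ => let ⟨φ, hφ, _⟩ := hX.exists_isApprox; ⟨φ, hφ⟩,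
    fun ⟨_, hφ⟩ => hφ.exists_hasWeakGradient⟩

theorem dirichlet_add_smul (g : Metric n M) (φ ψ : Smooth n M) (t : ℝ) :
    dirichlet g (φ + t • ψ) (φ + t • ψ) = dirichlet g φ φ + t * (2 * dirichlet g φ ψ)
      + t ^ 2 * dirichlet g ψ ψ := by
  simp only [map_add, map_smul, LinearMap.add_apply, LinearMap.smul_apply, smul_eq_mul,
    dirichlet_comm g ψ φ]
  ring

theorem sqrt_dirichlet_add_le (g : Metric n M) (φ ψ : Smooth n M) :
    √(dirichlet g (φ + ψ) (φ + ψ)) ≤ √(dirichlet g φ φ) + √(dirichlet g ψ ψ) := by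
  have h := sqrt_add_le_of_forall_nonneg (a := dirichlet g φ φ) (b := 2 * dirichlet g φ ψ)
    (c := dirichlet g ψ ψ) fun t => by
      rw [← dirichlet_add_smul]
      exact dirichlet_self_nonneg g _
  have e := dirichlet_add_smul g φ ψ 1
  rw [one_smul, one_mul, one_pow, one_mul] at e
  rwa [e]

theorem dirichlet_neg (g : Metric n M) (φ : Smooth n M) :
    dirichlet g (-φ) (-φ) = dirichlet g φ φ := by simp

theorem dirichlet_add_le (g : Metric n M) (φ ψ : Smooth n M) :
    dirichlet g (φ + ψ) (φ + ψ) ≤ 2 * dirichlet g φ φ + 2 * dirichlet g ψ ψ := by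
  have := dirichlet_self_nonneg g (φ + (-1 : ℝ) • ψ)
  have e := dirichlet_add_smul g φ ψ 1
  rw [one_smul, one_mul, one_pow, one_mul] at e
  rw [dirichlet_add_smul] at this
  linarith

theorem IsApprox.add_smul {g : Metric n M} {u v : Lp ℝ 2 (vol g)} {φ ψ : ℕ → Smooth n M}
    (hu : IsApprox g u φ) (hv : IsApprox g v ψ) (t : ℝ) :
    IsApprox g (u + t • v) (fun k => φ k + t • ψ k) where
  tendsto := by
    simp only [map_add, map_smul]
    exact hu.tendsto.add (hv.tendsto.const_smul t)
  cauchy := by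
    have hz : Tendsto (fun p : ℕ × ℕ => 2 * dirichlet g (φ p.1 - φ p.2) (φ p.1 - φ p.2)
        + 2 * (t ^ 2 * dirichlet g (ψ p.1 - ψ p.2) (ψ p.1 - ψ p.2))) atTop (𝓝 0) := by
      simpa using (hu.cauchy.const_mul 2).add ((hv.cauchy.const_mul (t ^ 2)).const_mul 2)
    refine squeeze_zero (fun _ => dirichlet_self_nonneg g _) (fun p => ?_) hz
    have e : φ p.1 + t • ψ p.1 - (φ p.2 + t • ψ p.2) = (φ p.1 - φ p.2) + t • (ψ p.1 - ψ p.2) := by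
      module
    rw [e]
    refine (dirichlet_add_le g _ _).trans_eq ?_
    simp only [map_smul, LinearMap.smul_apply, smul_eq_mul]
    ring

theorem isApprox_const (g : Metric n M) (φ : Smooth n M) :
    IsApprox g (toL2 g φ) fun _ => φ where
  tendsto := tendsto_const_nhds
  cauchy := by simp

theorem energy_eq (g : Metric n M) (φ : Smooth n M) :
    energy g φ = 4 * ((n : ℝ) - 1) / ((n : ℝ) - 2) * dirichlet g φ φ
      + potential g (toL2 g φ) (toL2 g φ) := by
  rw [energy, dirichlet_apply, potential_apply]
  congr 1
  refine integral_congr_ae ?_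
  filter_upwards [coeFn_toL2 g φ] with x hx
  rw [hx]

theorem tendsto_potential (g : Metric n M) {ι : Type*} {l : Filter ι} {u : Lp ℝ 2 (vol g)}
    {v : ι → Lp ℝ 2 (vol g)} (h : Tendsto v l (𝓝 u)) :
    Tendsto (fun k => potential g (v k) (v k)) l (𝓝 (potential g u u)) :=
    tendsto_apply_self (potential g) h

/-- The quadratic form is the limit of the energies of any approximating sequence. -/
theorem IsApprox.tendsto_energy {g : Metric n M} {u : Lp ℝ 2 (vol g)} {φ : ℕ → Smooth n M}
    (h : IsApprox g u φ) : Tendsto (fun k => energy g (φ k)) atTop (𝓝 (form g u u)) := by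
  have hX : HasWeakGradient g u (weakGradient g u) := by
    rw [weakGradient, dif_pos h.exists_hasWeakGradient]
    exact h.exists_hasWeakGradient.choose_spec
  obtain ⟨ψ, hψ, hl⟩ := hX.exists_isApprox
  -- The given sequence and the one attached to the chosen weak gradient differ by a sequence
  -- approximating zero, whose Dirichlet energy vanishes by closability. So the limit does not
  -- depend on the choice.
  have hd : IsApprox g 0 (fun k => φ k + (-1 : ℝ) • ψ k) := by
    have := h.add_smul hψ (-1)
    rwa [neg_one_smul, add_neg_cancel] at this
  have hz := (hd.dirichlet_tendsto_zero).sqrt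
  rw [Real.sqrt_zero] at hz
  have hs : Tendsto (fun k => √(dirichlet g (φ k) (φ k))) atTop
      (𝓝 (√(∫ x, g.inner x (weakGradient g u x) (weakGradient g u x) ∂vol g))) := by
    have h₀ : Tendsto (fun k => √(dirichlet g (φ k) (φ k)) - √(dirichlet g (ψ k) (ψ k))) atTop
        (𝓝 0) := by
      refine squeeze_zero_norm (fun k => ?_) hz
      have h₁ := sqrt_dirichlet_add_le g (φ k + (-1 : ℝ) • ψ k) (ψ k)
      have h₂ := sqrt_dirichlet_add_le g (-(φ k + (-1 : ℝ) • ψ k)) (φ k)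
      rw [dirichlet_neg] at h₂
      rw [show φ k + (-1 : ℝ) • ψ k + ψ k = φ k by module] at h₁
      rw [show -(φ k + (-1 : ℝ) • ψ k) + φ k = ψ k by module] at h₂
      exact abs_sub_le_iff.2 ⟨by linarith, by linarith⟩
    simpa using h₀.add hl.sqrt
  have hD := hs.pow 2
  rw [Real.sq_sqrt (integral_nonneg fun x => inner_self_nonneg g x _)] at hD
  simp only [Real.sq_sqrt (dirichlet_self_nonneg g _)] at hD
  have hP := tendsto_potential g h.tendsto
  have := (hD.const_mul (4 * ((n : ℝ) - 1) / ((n : ℝ) - 2))).add hP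
  rw [form, ← potential_apply]
  refine this.congr fun k => ?_
  rw [energy_eq]

end Approximation

/-! ### The quadratic form on H¹ and its completeness -/

section QuadraticForm

variable {n : ℕ} {M : Type*} [TopologicalSpace M] [ChartedSpace (EuclideanSpace ℝ (Fin n)) M]
  [IsManifold (𝓡 n) ∞ M] [MeasurableSpace M] [BorelSpace M] [T2Space M] [CompactSpace M]
  {g : Metric n M} {u v : Lp ℝ 2 (vol g)}

theorem add_smul_mem_H1 (hu : u ∈ H1 g) (hv : v ∈ H1 g) (t : ℝ) : u + t • v ∈ H1 g := by
  obtain ⟨φ, hφ⟩ := mem_H1_iff.1 hu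
  obtain ⟨ψ, hψ⟩ := mem_H1_iff.1 hv
  exact mem_H1_iff.2 ⟨_, hφ.add_smul hψ t⟩

theorem add_mem_H1 (hu : u ∈ H1 g) (hv : v ∈ H1 g) : u + v ∈ H1 g := by
  simpa using add_smul_mem_H1 hu hv 1

theorem sub_mem_H1 (hu : u ∈ H1 g) (hv : v ∈ H1 g) : u - v ∈ H1 g := by
  simpa [sub_eq_add_neg] using add_smul_mem_H1 hu hv (-1)

theorem toL2_mem_H1 (φ : Smooth n M) : toL2 g φ ∈ H1 g := mem_H1_iff.2 ⟨_, isApprox_const g φ⟩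

theorem form_toL2 (φ : Smooth n M) : form g (toL2 g φ) (toL2 g φ) = energy g φ :=
  tendsto_nhds_unique (isApprox_const g φ).tendsto_energy tendsto_const_nhds |>.symm ▸ rfl

theorem smul_mem_H1 (hu : u ∈ H1 g) (t : ℝ) : t • u ∈ H1 g := by
  have := add_smul_mem_H1 (toL2_mem_H1 (g := g) 0) hu t
  simpa using this

theorem energy_add_smul (φ ψ : Smooth n M) (t : ℝ) :
    energy g ⇑(φ + t • ψ) = energy g φ + t * (energy g ⇑(φ + ψ) - energy g φ - energy g ψ)
      + t ^ 2 * energy g ψ := by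
  simp only [energy_eq, map_smul, map_add, LinearMap.add_apply, LinearMap.smul_apply,
    FunLike.coe_smul, Pi.smul_apply, FunLike.coe_add, Pi.add_apply, smul_eq_mul,
    dirichlet_comm g ψ φ, potential_comm g (toL2 g ψ) (toL2 g φ)]
  ring

/-- Linearity of the chosen weak gradient is never needed: the identity holds for the energies of
smooth functions and passes to the limit. Only diagonal values of `form` occur, with the mixed term
expressed by polarization. -/
theorem form_add_smul (hu : u ∈ H1 g) (hv : v ∈ H1 g) (t : ℝ) :
    form g (u + t • v) (u + t • v) = form g u u
      + t * (form g (u + v) (u + v) - form g u u - form g v v) + t ^ 2 * form g v v := by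
  obtain ⟨φ, hφ⟩ := mem_H1_iff.1 hu
  obtain ⟨ψ, hψ⟩ := mem_H1_iff.1 hv
  have h₁ := (hφ.add_smul hψ 1).tendsto_energy
  simp only [one_smul] at h₁
  refine tendsto_nhds_unique (hφ.add_smul hψ t).tendsto_energy ?_
  simp only [energy_add_smul]
  exact (hφ.tendsto_energy.add (((h₁.sub hφ.tendsto_energy).sub hψ.tendsto_energy).const_mul t)).add
    (hψ.tendsto_energy.const_mul _)

theorem form_smul (hu : u ∈ H1 g) (t : ℝ) : form g (t • u) (t • u) = t ^ 2 * form g u u := by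
  have hz : energy g ⇑(0 : Smooth n M) = 0 := by
    rw [energy_eq]
    simp
  have h := form_add_smul (toL2_mem_H1 (g := g) 0) hu t
  have h₀ := form_toL2 (g := g) 0
  rw [hz, map_zero] at h₀
  simp only [h₀, map_zero, zero_add] at h
  rw [h]
  ring

theorem form_sub_comm (hu : u ∈ H1 g) (hv : v ∈ H1 g) :
    form g (u - v) (u - v) = form g (v - u) (v - u) := by
  have := form_smul (sub_mem_H1 hu hv) (-1)
  rw [neg_one_smul, neg_sub] at this
  rw [this]
  ring

theorem form_parallelogram (hu : u ∈ H1 g) (hv : v ∈ H1 g) :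
    form g (u + v) (u + v) + form g (u - v) (u - v) = 2 * form g u u + 2 * form g v v := by
  have := form_add_smul hu hv (-1)
  rw [neg_one_smul, ← sub_eq_add_neg] at this
  rw [this]
  ring

theorem sqrt_form_add_le (hp : ∀ w ∈ H1 g, 0 ≤ form g w w) (hu : u ∈ H1 g) (hv : v ∈ H1 g) :
    √(form g (u + v) (u + v)) ≤ √(form g u u) + √(form g v v) := by
  have h := sqrt_add_le_of_forall_nonneg (a := form g u u)
    (b := form g (u + v) (u + v) - form g u u - form g v v) (c := form g v v) fun t => by
      rw [← form_add_smul hu hv]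
      exact hp _ (add_smul_mem_H1 hu hv t)
  rwa [show form g u u + (form g (u + v) (u + v) - form g u u - form g v v) + form g v v
    = form g (u + v) (u + v) by ring] at h

theorem form_add_le (hp : ∀ w ∈ H1 g, 0 ≤ form g w w) (hu : u ∈ H1 g) (hv : v ∈ H1 g) :
    form g (u + v) (u + v) ≤ 2 * form g u u + 2 * form g v v := by
  have := form_parallelogram hu hv
  linarith [hp _ (sub_mem_H1 hu hv)]

theorem IsApprox.tendsto_energy_sub {φ : ℕ → Smooth n M} (h : IsApprox g u φ) :
    Tendsto (fun p : ℕ × ℕ => energy g ⇑(φ p.1 - φ p.2)) atTop (𝓝 0) := by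
  have h₁ : Tendsto (fun p : ℕ × ℕ => toL2 g (φ p.1 - φ p.2)) atTop (𝓝 0) := by
    rw [← prod_atTop_atTop_eq]
    simp only [map_sub]
    simpa using (h.tendsto.comp tendsto_fst).sub (h.tendsto.comp tendsto_snd)
  have h₂ := tendsto_potential g h₁
  simp only [energy_eq]
  simpa using (h.cauchy.const_mul (4 * ((n : ℝ) - 1) / ((n : ℝ) - 2))).add h₂

/-- For fixed j the value is the limit over i of the energies of φ_i − φ_j, and these are small by
the Cauchy property. -/
theorem IsApprox.tendsto_form_sub {φ : ℕ → Smooth n M} (h : IsApprox g u φ) :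
    Tendsto (fun j => form g (u - toL2 g (φ j)) (u - toL2 g (φ j))) atTop (𝓝 0) := by
  rw [Metric.tendsto_atTop]
  intro ε hε
  have h₁ := h.tendsto_energy_sub.eventually (Metric.ball_mem_nhds 0 (half_pos hε))
  rw [eventually_atTop_prod_self] at h₁
  obtain ⟨K, hK⟩ := h₁
  refine ⟨K, fun j hj => ?_⟩
  have h₂ := (h.add_smul (isApprox_const g (φ j)) (-1)).tendsto_energy
  simp only [neg_one_smul, ← sub_eq_add_neg] at h₂
  refine lt_of_le_of_lt ?_ (half_lt_self hε)
  refine le_of_tendsto (h₂.dist tendsto_const_nhds) ?_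
  filter_upwards [eventually_ge_atTop K] with i hi
  exact (Metric.mem_ball.1 (hK i j hi hj)).le

/-- Completeness of `H¹` for a coercive form. -/
theorem exists_tendsto_form (hn : 3 ≤ n) {c : ℝ} (hc : 0 < c)
    (hco : ∀ w ∈ H1 g, c * ‖w‖ ^ 2 ≤ form g w w) {v : ℕ → Lp ℝ 2 (vol g)} (hv : ∀ k, v k ∈ H1 g)
    (hcau : Tendsto (fun p : ℕ × ℕ => form g (v p.1 - v p.2) (v p.1 - v p.2)) atTop (𝓝 0)) :
    ∃ w ∈ H1 g, Tendsto v atTop (𝓝 w) ∧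
      Tendsto (fun k => form g (v k) (v k)) atTop (𝓝 (form g w w)) := by
  have hp : ∀ w ∈ H1 g, 0 ≤ form g w w := fun w hw => le_trans (by positivity) (hco w hw)
  have hA : (0 : ℝ) < 4 * ((n : ℝ) - 1) / ((n : ℝ) - 2) := by
    have : (3 : ℝ) ≤ n := by exact_mod_cast hn
    exact div_pos (by linarith) (by linarith)
  -- Each v_k is replaced by a smooth function within 1/(k+1) in the form; these functions will be
  -- the approximating sequence of the limit.
  have hex : ∀ k, ∃ ψ : Smooth n M,
      form g (v k - toL2 g ψ) (v k - toL2 g ψ) < 1 / ((k : ℝ) + 1) := by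
    intro k
    obtain ⟨φ, hφ⟩ := mem_H1_iff.1 (hv k)
    obtain ⟨j, hj⟩ := (hφ.tendsto_form_sub.eventually (gt_mem_nhds
      (show (0 : ℝ) < 1 / ((k : ℝ) + 1) by positivity))).exists
    exact ⟨φ j, hj⟩
  choose ψ hψ using hex
  have hs : ∀ k, toL2 g (ψ k) ∈ H1 g := fun k => toL2_mem_H1 _
  have hd : ∀ k, v k - toL2 g (ψ k) ∈ H1 g := fun k => sub_mem_H1 (hv k) (hs k)
  have hψ₀ : Tendsto (fun k => form g (v k - toL2 g (ψ k)) (v k - toL2 g (ψ k))) atTop (𝓝 0) :=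
    squeeze_zero (fun k => hp _ (hd k)) (fun k => (hψ k).le) tendsto_one_div_add_atTop_nhds_zero_nat
  have hψc : Tendsto (fun p : ℕ × ℕ => energy g ⇑(ψ p.1 - ψ p.2)) atTop (𝓝 0) := by
    have hz : Tendsto (fun p : ℕ × ℕ => 2 * form g (v p.1 - v p.2) (v p.1 - v p.2)
        + 2 * (2 * form g (v p.1 - toL2 g (ψ p.1)) (v p.1 - toL2 g (ψ p.1))
          + 2 * form g (v p.2 - toL2 g (ψ p.2)) (v p.2 - toL2 g (ψ p.2)))) atTop (𝓝 0) := by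
      rw [← prod_atTop_atTop_eq] at hcau ⊢
      have := (hcau.const_mul 2).add ((((hψ₀.comp tendsto_fst).const_mul 2).add
        ((hψ₀.comp tendsto_snd).const_mul 2)).const_mul 2)
      simpa using this
    refine squeeze_zero (fun p => ?_) (fun p => ?_) hz
    · rw [← form_toL2]
      exact hp _ (toL2_mem_H1 _)
    · rw [← form_toL2, map_sub]
      have e : toL2 g (ψ p.1) - toL2 g (ψ p.2) = (v p.1 - v p.2)
          + ((v p.2 - toL2 g (ψ p.2)) - (v p.1 - toL2 g (ψ p.1))) := by abel
      rw [e]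
      refine (form_add_le hp (sub_mem_H1 (hv _) (hv _)) (sub_mem_H1 (hd _) (hd _))).trans ?_
      have h₁ := form_parallelogram (hd p.2) (hd p.1)
      have h₂ := hp _ (add_mem_H1 (hd p.2) (hd p.1))
      linarith
  have hL : Tendsto (fun p : ℕ × ℕ => toL2 g (ψ p.1 - ψ p.2)) atTop (𝓝 0) := by
    rw [tendsto_zero_iff_norm_tendsto_zero]
    have h₁ : Tendsto (fun p : ℕ × ℕ => √(energy g ⇑(ψ p.1 - ψ p.2) / c)) atTop (𝓝 0) := by
      simpa using (hψc.div_const c).sqrt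
    refine squeeze_zero (fun _ => norm_nonneg _) (fun p => Real.le_sqrt_of_sq_le ?_) h₁
    rw [le_div_iff₀' hc, ← form_toL2]
    exact hco _ (toL2_mem_H1 _)
  have hcs : CauchySeq fun k => toL2 g (ψ k) := by
    rw [cauchySeq_iff_tendsto_dist_atTop_0]
    have h₁ := hL.norm
    rw [norm_zero] at h₁
    simpa only [map_sub, dist_eq_norm] using h₁
  obtain ⟨w, hw⟩ := cauchySeq_tendsto_of_complete hcs
  -- The energy and the potential of the differences both tend to zero, hence so does the Dirichlet
  -- part, whose coefficient is positive.
  have happ : IsApprox g w ψ := by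
    refine ⟨hw, ?_⟩
    have h₁ := (hψc.sub (tendsto_potential g hL)).div_const (4 * ((n : ℝ) - 1) / ((n : ℝ) - 2))
    simp only [energy_eq, add_sub_cancel_right, mul_div_cancel_left₀ _ hA.ne'] at h₁
    simpa using h₁
  have hwm : w ∈ H1 g := mem_H1_iff.2 ⟨ψ, happ⟩
  have hdiff : Tendsto (fun k => form g (v k - w) (v k - w)) atTop (𝓝 0) := by
    have hz := (hψ₀.const_mul 2).add (happ.tendsto_form_sub.const_mul 2)
    rw [mul_zero, add_zero] at hz
    refine squeeze_zero (fun k => hp _ (sub_mem_H1 (hv k) hwm)) (fun k => ?_) hz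
    have e : v k - w = (v k - toL2 g (ψ k)) + (toL2 g (ψ k) - w) := by abel
    rw [e, form_sub_comm hwm (hs k)]
    exact form_add_le hp (hd k) (sub_mem_H1 (hs k) hwm)
  refine ⟨w, hwm, ?_, ?_⟩
  · rw [tendsto_iff_norm_sub_tendsto_zero]
    have h₁ : Tendsto (fun k => √(form g (v k - w) (v k - w) / c)) atTop (𝓝 0) := by
      simpa using (hdiff.div_const c).sqrt
    refine squeeze_zero (fun _ => norm_nonneg _) (fun k => Real.le_sqrt_of_sq_le ?_) h₁
    rw [le_div_iff₀' hc]
    exact hco _ (sub_mem_H1 (hv k) hwm)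
  · have hsq : Tendsto (fun k => √(form g (v k) (v k))) atTop (𝓝 √(form g w w)) := by
      rw [tendsto_iff_norm_sub_tendsto_zero]
      have h₁ := hdiff.sqrt
      rw [Real.sqrt_zero] at h₁
      refine squeeze_zero (fun _ => norm_nonneg _) (fun k => ?_) h₁
      have h₂ := sqrt_form_add_le hp (sub_mem_H1 (hv k) hwm) hwm
      have h₃ := sqrt_form_add_le hp (sub_mem_H1 hwm (hv k)) (hv k)
      rw [sub_add_cancel] at h₂ h₃
      rw [form_sub_comm hwm (hv k)] at h₃
      exact abs_sub_le_iff.2 ⟨by linarith, by linarith⟩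
    have h₁ := hsq.pow 2
    simp only [Real.sq_sqrt (hp _ (hv _)), Real.sq_sqrt (hp _ hwm)] at h₁
    exact h₁

end QuadraticForm

/-! ### From the Yamabe invariant to coercivity -/

section Coercivity

variable {n : ℕ} {M : Type*} [TopologicalSpace M] [ChartedSpace (EuclideanSpace ℝ (Fin n)) M]
  [IsManifold (𝓡 n) ∞ M] [MeasurableSpace M] [BorelSpace M] [T2Space M] [CompactSpace M]

omit [T2Space M] [CompactSpace M] [BorelSpace M] in
-- The infimum of a set of reals unbounded below is 0 by convention, so positivity of the invariant
-- itself provides the lower bound.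
theorem yamabeInvariant_le {g : Metric n M} (hY : 0 < yamabeInvariant g) {u : Lp ℝ 2 (vol g)}
    (hu : u ∈ H1pos g) : yamabeInvariant g ≤ yamabeFunctional g u := by
  have hb : BddBelow (Set.range fun u : H1pos g => yamabeFunctional g u) := by
    by_contra h
    rw [yamabeInvariant, iInf, Real.sInf_of_not_bddBelow h] at hY
    exact lt_irrefl _ hY
  exact ciInf_le hb ⟨u, hu⟩

omit [T2Space M] [CompactSpace M] [BorelSpace M] in
-- A vanishing norm would make the quotient 0 by the convention for division, against the positive
-- lower bound.
theorem yamabeInvariant_mul_le {g : Metric n M} (hY : 0 < yamabeInvariant g) {u : Lp ℝ 2 (vol g)}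
    (hu : u ∈ H1pos g) : normLp g (critExp n) u ≠ 0 ∧
      yamabeInvariant g * normLp g (critExp n) u ^ 2 ≤ form g u u := by
  have h := yamabeInvariant_le hY hu
  have h0 := hY.trans_le h
  have hne : normLp g (critExp n) u ≠ 0 := by
    intro hz
    rw [yamabeFunctional, hz] at h0
    simp at h0
  refine ⟨hne, ?_⟩
  rwa [yamabeFunctional, le_div_iff₀ (by positivity)] at h

/-- A smooth positive regularization of the absolute value. -/
def regAbs (ε : ℝ) (t : ℝ) : ℝ := √(t ^ 2 + ε ^ 2)

theorem contDiff_regAbs {ε : ℝ} (hε : 0 < ε) : ContDiff ℝ ∞ (regAbs ε) :=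
  ContDiff.sqrt (by fun_prop) fun t => by positivity

theorem abs_deriv_regAbs_le {ε : ℝ} (hε : 0 < ε) (t : ℝ) : |deriv (regAbs ε) t| ≤ 1 := by
  have h₁ : HasDerivAt (fun t : ℝ => t ^ 2 + ε ^ 2) (2 * t) t := by
    simpa using (hasDerivAt_pow 2 t).add_const (ε ^ 2)
  have h₂ : HasDerivAt (regAbs ε) _ t := h₁.sqrt (by positivity)
  rw [h₂.deriv, mul_div_mul_left _ _ two_ne_zero, abs_div, abs_of_nonneg (Real.sqrt_nonneg _)]
  exact div_le_one_of_le₀ (Real.abs_le_sqrt (by nlinarith)) (Real.sqrt_nonneg _)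

/-- The Sobolev inequality for smooth functions, without a sign condition. -/
theorem yamabeInvariant_mul_le_energy (hn : 3 ≤ n) {g : Metric n M} (hY : 0 < yamabeInvariant g)
    (φ : Smooth n M) :
    yamabeInvariant g * lpNorm φ (ENNReal.ofReal (critExp n)) (vol g) ^ 2 ≤ energy g φ := by
  set q := ENNReal.ofReal (critExp n)
  have hA : (0 : ℝ) < 4 * ((n : ℝ) - 1) / ((n : ℝ) - 2) := by
    have : (3 : ℝ) ≤ n := by exact_mod_cast hn
    exact div_pos (by linarith) (by linarith)
  have key : ∀ ε : ℝ, 0 < ε → yamabeInvariant g * lpNorm φ q (vol g) ^ 2 ≤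
      energy g φ + ε ^ 2 * ∫ x, scalarCurvature g x ∂vol g := by
    intro ε hε
    -- √(φ² + ε²) is an admissible positive test function. It dominates |φ|, its gradient is no
    -- longer than that of φ, and its square exceeds φ² by ε².
    let ψ : Smooth n M := ⟨fun x => regAbs ε (φ x), (contDiff_regAbs hε).contMDiff.comp φ.contMDiff⟩
    have hψx : ∀ x, ψ x = regAbs ε (φ x) := fun _ => rfl
    have hψpos : ∀ x, 0 < ψ x := fun x => Real.sqrt_pos.2 (by positivity)
    have hmem : toL2 g ψ ∈ H1pos g := by
      refine ⟨toL2_mem_H1 ψ, ?_⟩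
      filter_upwards [coeFn_toL2 g ψ] with x hx
      rw [hx]
      exact hψpos x
    have h₁ := (yamabeInvariant_mul_le hY hmem).2
    rw [form_toL2] at h₁
    have h₂ : lpNorm φ q (vol g) ≤ normLp g (critExp n) (toL2 g ψ) := by
      rw [normLp, ← toReal_eLpNorm (φ.memLp g q).1,
        ← toReal_eLpNorm (Lp.aestronglyMeasurable _), eLpNorm_congr_ae (coeFn_toL2 g ψ)]
      refine ENNReal.toReal_mono (ψ.memLp g q).2.ne (eLpNorm_mono_real fun x => ?_)
      exact Real.abs_le_sqrt (by nlinarith)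
    have h₃ : energy g ψ ≤ energy g φ + ε ^ 2 * ∫ x, scalarCurvature g x ∂vol g := by
      have hR := continuous_scalarCurvature g
      have hφc : Continuous φ := φ.contMDiff.continuous
      have e₁ : ∫ x, scalarCurvature g x * ψ x * ψ x ∂vol g =
          ∫ x, scalarCurvature g x * φ x * φ x ∂vol g
            + ε ^ 2 * ∫ x, scalarCurvature g x ∂vol g := by
        have hi : Integrable (fun x => scalarCurvature g x * φ x * φ x) (vol g) :=
          ((hR.mul hφc).mul hφc).integrable_vol g
        rw [← integral_const_mul, ← integral_add hi ((hR.integrable_vol g).const_mul _)]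
        refine integral_congr_ae (Eventually.of_forall fun x => ?_)
        have : ψ x * ψ x = φ x ^ 2 + ε ^ 2 := by
          rw [hψx, regAbs]
          exact Real.mul_self_sqrt (by positivity)
        simp only [mul_assoc, this]
        ring
      have e₂ : ∫ x, gradInner g ψ ψ x ∂vol g ≤ ∫ x, gradInner g φ φ x ∂vol g := by
        refine integral_mono ((continuous_gradInner g ψ.contMDiff ψ.contMDiff).integrable_vol g)
          ((continuous_gradInner g φ.contMDiff φ.contMDiff).integrable_vol g) fun x => ?_
        have e : ∀ f : M → ℝ, ContMDiff (𝓡 n) 𝓘(ℝ, ℝ) ∞ f →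
            gradInner g ψ f x = deriv (regAbs ε) (φ x) * gradInner g φ f x := fun f hf =>
          gradInner_comp_left g (contDiff_regAbs hε) φ.contMDiff hf x
        change gradInner g ψ ψ x ≤ gradInner g φ φ x
        rw [e _ ψ.contMDiff, gradInner_comm, e _ φ.contMDiff, ← mul_assoc]
        refine mul_le_of_le_one_left (inner_self_nonneg g x _) ?_
        rw [← abs_mul_abs_self]
        exact mul_le_one₀ (abs_deriv_regAbs_le hε _) (abs_nonneg _) (abs_deriv_regAbs_le hε _)
      rw [energy, energy, e₁, ← add_assoc]
      gcongr
    have h₄ : lpNorm φ q (vol g) ^ 2 ≤ normLp g (critExp n) (toL2 g ψ) ^ 2 :=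
      pow_le_pow_left₀ lpNorm_nonneg h₂ 2
    exact (mul_le_mul_of_nonneg_left h₄ hY.le).trans (h₁.trans h₃)
  have hlim : Tendsto (fun ε : ℝ => energy g φ + ε ^ 2 * ∫ x, scalarCurvature g x ∂vol g)
      (𝓝[>] 0) (𝓝 (energy g φ)) := by
    have hc : Continuous fun ε : ℝ => energy g φ + ε ^ 2 * ∫ x, scalarCurvature g x ∂vol g := by
      fun_prop
    have := hc.tendsto 0
    simp only [ne_eq, OfNat.ofNat_ne_zero, not_false_eq_true, zero_pow, zero_mul, add_zero] at this
    exact this.mono_left nhdsWithin_le_nhds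
  refine ge_of_tendsto hlim ?_
  filter_upwards [self_mem_nhdsWithin] with ε hε
  exact key ε hε

omit [MeasurableSpace M] [BorelSpace M] [T2Space M] [CompactSpace M] in
theorem exists_exp_of_mem_conformalClass {g h : Metric n M} (hh : h ∈ conformalClass g) :
    ∃ f : M → ℝ, ContMDiff (𝓡 n) 𝓘(ℝ, ℝ) ∞ f ∧ ∀ (x : M) (a b : TangentSpace (𝓡 n) x),
      h.inner x a b = Real.exp (2 * f x) * g.inner x a b := by
  obtain ⟨w, hw, hpos, hin⟩ := hh
  -- Chosen so that e^{2f} = w^{4/(n-2)}.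
  refine ⟨fun x => 2 / ((n : ℝ) - 2) * Real.log (w x), fun x => ?_, fun x a b => ?_⟩
  · have : ContDiffAt ℝ ∞ (fun t : ℝ => 2 / ((n : ℝ) - 2) * Real.log t) (w x) :=
      contDiffAt_const.mul (Real.contDiffAt_log.2 (hpos x).ne')
    exact this.contMDiffAt.comp x (hw x)
  · rw [hin, Real.rpow_def_of_pos (hpos x)]
    congr 2
    ring

/-- By compactness f is bounded, so the volumes are comparable and the weight e^{kf} is bounded
below. -/
theorem eLpNorm_vol_conformal_le {g h : Metric n M} {f : M → ℝ} (hf : Continuous f)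
    (hh : ∀ (x : M) (a b : TangentSpace (𝓡 n) x),
      h.inner x a b = Real.exp (2 * f x) * g.inner x a b) (k : ℝ) {q : ℝ≥0∞} (hq : q ≠ ⊤) :
    ∃ C : ℝ, 0 ≤ C ∧ ∀ φ : M → ℝ, eLpNorm φ q (vol h) ≤
      ENNReal.ofReal C * eLpNorm (fun x => Real.exp (k * f x) * φ x) q (vol g) := by
  obtain ⟨B, hB⟩ := (isCompact_univ (X := M)).exists_bound_of_continuousOn hf.continuousOn
  have hB' : ∀ x, |f x| ≤ B := fun x => hB x trivial
  have hle : vol h ≤ ENNReal.ofReal (Real.exp (n * B)) • vol g := by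
    rw [vol_conformal hf hh, ← withDensity_const]
    refine withDensity_mono (Eventually.of_forall fun x => ENNReal.ofReal_le_ofReal ?_)
    exact Real.exp_le_exp.2 (mul_le_mul_of_nonneg_left ((le_abs_self _).trans (hB' x))
      (Nat.cast_nonneg n))
  set D : ℝ≥0∞ := ENNReal.ofReal (Real.exp (n * B)) ^ (1 / q).toReal with hD
  have hDt : D ≠ ⊤ := ENNReal.rpow_ne_top_of_nonneg ENNReal.toReal_nonneg ENNReal.ofReal_ne_top
  refine ⟨D.toReal * Real.exp (|k| * B), by positivity, fun φ => ?_⟩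
  refine (eLpNorm_mono_measure φ hle).trans ?_
  rw [eLpNorm_smul_measure_of_ne_top hq, smul_eq_mul, ENNReal.ofReal_mul ENNReal.toReal_nonneg,
    ENNReal.ofReal_toReal hDt, mul_assoc]
  refine mul_le_mul_right (eLpNorm_le_mul_eLpNorm_of_ae_le_mul (Eventually.of_forall fun x => ?_) q) _
  rw [norm_mul, Real.norm_of_nonneg (Real.exp_pos _).le, ← mul_assoc, ← Real.exp_add]
  refine le_mul_of_one_le_left (norm_nonneg _) (Real.one_le_exp ?_)
  have h₁ : |k * f x| ≤ |k| * B := by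
    rw [abs_mul]
    exact mul_le_mul_of_nonneg_left (hB' x) (abs_nonneg _)
  linarith [neg_abs_le (k * f x)]

/-- The Sobolev inequality in any metric of the conformal class. -/
theorem exists_eLpNorm_le_sqrt_energy (hn : 3 ≤ n) {g h : Metric n M}
    (hY : 0 < yamabeInvariant g) (hh : h ∈ conformalClass g) :
    ∃ C : ℝ, 0 < C ∧ ∀ φ : Smooth n M, 0 ≤ energy h φ ∧
      eLpNorm φ (ENNReal.ofReal (critExp n)) (vol h) ≤ ENNReal.ofReal (C * √(energy h φ)) := by
  obtain ⟨f, hf, hin⟩ := exists_exp_of_mem_conformalClass hh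
  obtain ⟨C, hC, hle⟩ := eLpNorm_vol_conformal_le hf.continuous hin (((n : ℝ) - 2) / 2)
    (q := ENNReal.ofReal (critExp n)) ENNReal.ofReal_ne_top
  set Y := yamabeInvariant g
  -- C may be zero; adding 1 keeps the constant positive.
  refine ⟨(C + 1) / √Y, by positivity, fun φ => ?_⟩
  let ψ : Smooth n M := ⟨fun x => Real.exp (((n : ℝ) - 2) / 2 * f x) * φ x,
    (contMDiff_exp_mul hf _).mul φ.contMDiff⟩
  have e : energy h φ = energy g ψ := energy_conformal hn hf hin φ.contMDiff
  have h₁ := yamabeInvariant_mul_le_energy hn hY ψ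
  have h₀ : 0 ≤ energy g ψ := le_trans (by positivity) h₁
  rw [e]
  refine ⟨h₀, (hle φ).trans ?_⟩
  change _ * eLpNorm ψ _ _ ≤ _
  rw [← ofReal_lpNorm (ψ.memLp g _), ← ENNReal.ofReal_mul hC]
  refine ENNReal.ofReal_le_ofReal ?_
  have h₂ : lpNorm ψ (ENNReal.ofReal (critExp n)) (vol g) ≤ √(energy g ψ) / √Y := by
    rw [← Real.sqrt_div h₀]
    refine Real.le_sqrt_of_sq_le ?_
    rwa [le_div_iff₀' hY]
  calc C * lpNorm ψ (ENNReal.ofReal (critExp n)) (vol g)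
      ≤ (C + 1) * (√(energy g ψ) / √Y) :=
        mul_le_mul (by linarith) h₂ lpNorm_nonneg (by linarith)
    _ = _ := by ring

/-- Estimates by the energy extend from smooth functions to `H¹`. -/
theorem eLpNorm_le_sqrt_form {g : Metric n M} {q : ℝ≥0∞} {C : ℝ}
    (hC : ∀ φ : Smooth n M, eLpNorm φ q (vol g) ≤ ENNReal.ofReal (C * √(energy g φ)))
    {u : Lp ℝ 2 (vol g)} (hu : u ∈ H1 g) :
    eLpNorm u q (vol g) ≤ ENNReal.ofReal (C * √(form g u u)) := by
  obtain ⟨φ, hφ⟩ := mem_H1_iff.1 hu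
  obtain ⟨ns, hns, hae⟩ := (tendstoInMeasure_of_tendsto_Lp hφ.tendsto).exists_seq_tendsto_ae
  -- Fatou along an almost everywhere convergent subsequence; u need not be known to have a finite
  -- norm of exponent q.
  refine (Lp.eLpNorm_lim_le_liminf_eLpNorm
    (fun m => Lp.aestronglyMeasurable (toL2 g (φ (ns m)))) _ hae).trans ?_
  have hlim : Tendsto (fun m => ENNReal.ofReal (C * √(energy g (φ (ns m))))) atTop
      (𝓝 (ENNReal.ofReal (C * √(form g u u)))) :=
    ENNReal.tendsto_ofReal (((hφ.tendsto_energy.comp hns.tendsto_atTop).sqrt).const_mul C)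
  rw [← hlim.liminf_eq]
  refine liminf_le_liminf (Eventually.of_forall fun m => ?_)
  simp only [eLpNorm_congr_ae (coeFn_toL2 g (φ (ns m)))]
  exact hC _

omit [TopologicalSpace M] [ChartedSpace (EuclideanSpace ℝ (Fin n)) M] [IsManifold (𝓡 n) ∞ M]
  [MeasurableSpace M] [BorelSpace M] [T2Space M] [CompactSpace M] in
theorem two_le_critExp (hn : 3 ≤ n) : 2 ≤ critExp n := by
  have : (3 : ℝ) ≤ n := by exact_mod_cast hn
  rw [critExp, le_div_iff₀ (by linarith)]
  linarith

theorem memLp_of_mem_H1 (hn : 3 ≤ n) {g h : Metric n M} (hY : 0 < yamabeInvariant g)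
    (hh : h ∈ conformalClass g) {u : Lp ℝ 2 (vol h)} (hu : u ∈ H1 h) :
    MemLp u (ENNReal.ofReal (critExp n)) (vol h) := by
  obtain ⟨C, -, hC⟩ := exists_eLpNorm_le_sqrt_energy hn hY hh
  exact ⟨Lp.aestronglyMeasurable u,
    (eLpNorm_le_sqrt_form (fun φ => (hC φ).2) hu).trans_lt ENNReal.ofReal_lt_top⟩

/-- Coercivity of the form. -/
theorem exists_coercive (hn : 3 ≤ n) {g h : Metric n M} (hY : 0 < yamabeInvariant g)
    (hh : h ∈ conformalClass g) :
    ∃ c : ℝ, 0 < c ∧ ∀ w ∈ H1 h, c * ‖w‖ ^ 2 ≤ form h w w := by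
  obtain ⟨C, hC₀, hC⟩ := exists_eLpNorm_le_sqrt_energy hn hY hh
  set q := ENNReal.ofReal (critExp n)
  have hq : (2 : ℝ≥0∞) ≤ q := by
    rw [← ENNReal.ofReal_ofNat]
    exact ENNReal.ofReal_le_ofReal (two_le_critExp hn)
  -- The Hölder constant of the embedding of L^{2*} into L² on a space of finite volume.
  set V : ℝ≥0∞ := vol h Set.univ ^ (1 / (2 : ℝ≥0∞).toReal - 1 / q.toReal)
  have hV : V ≠ ⊤ := by
    refine ENNReal.rpow_ne_top_of_nonneg ?_ (measure_ne_top _ _)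
    have h2 : (2 : ℝ) ≤ q.toReal := by
      rw [ENNReal.toReal_ofReal (by linarith [two_le_critExp hn])]
      exact two_le_critExp hn
    have := one_div_le_one_div_of_le two_pos h2
    simpa using this
  have hform : ∀ w ∈ H1 h, 0 ≤ form h w w := by
    intro w hw
    obtain ⟨φ, hφ⟩ := mem_H1_iff.1 hw
    exact ge_of_tendsto' hφ.tendsto_energy fun k => (hC (φ k)).1
  set K : ℝ := C * V.toReal + 1
  have hK : 0 < K := by positivity
  have h2 : ∀ φ : Smooth n M, eLpNorm φ 2 (vol h) ≤ ENNReal.ofReal (K * √(energy h φ)) := by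
    intro φ
    refine (eLpNorm_le_eLpNorm_mul_rpow_measure_univ hq (φ.memLp h q).1).trans ?_
    refine (mul_le_mul_left (hC φ).2 _).trans ?_
    change _ * V ≤ _
    rw [← ENNReal.ofReal_toReal hV, ← ENNReal.ofReal_mul (by positivity)]
    refine ENNReal.ofReal_le_ofReal ?_
    have := Real.sqrt_nonneg (energy h φ)
    simp only [K]
    nlinarith
  refine ⟨1 / K ^ 2, by positivity, fun w hw => ?_⟩
  have h₁ : ‖w‖ ≤ K * √(form h w w) := by
    rw [Lp.norm_def]
    exact ENNReal.toReal_le_of_le_ofReal (by positivity) (eLpNorm_le_sqrt_form h2 hw)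
  have h₃ := pow_le_pow_left₀ (norm_nonneg _) h₁ 2
  rw [mul_pow, Real.sq_sqrt (hform w hw)] at h₃
  rw [one_div, inv_mul_le_iff₀ (by positivity)]
  exact h₃

/-- With zero volume the constant 1 would be an admissible function of norm 0, which the positive
invariant excludes. The conformal density is positive, so the two volumes have the same null sets.
This also rules out the empty manifold. -/
theorem vol_ne_zero_of_conformal {g h : Metric n M} (hY : 0 < yamabeInvariant g)
    (hh : h ∈ conformalClass g) : vol h ≠ 0 := by
  have hg : vol g ≠ 0 := by
    intro h0
    have hm : toL2 g (1 : Smooth n M) ∈ H1pos g := by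
      refine ⟨toL2_mem_H1 _, ?_⟩
      filter_upwards [coeFn_toL2 g 1] with x hx
      rw [hx]
      exact one_pos
    refine (yamabeInvariant_mul_le hY hm).1 ?_
    have : ∀ μ : Measure M, μ = 0 → ∀ u : M → ℝ, lpNorm u (ENNReal.ofReal (critExp n)) μ = 0 := by
      rintro _ rfl u
      simp
    exact this _ h0 _
  obtain ⟨f, hf, hin⟩ := exists_exp_of_mem_conformalClass hh
  have hfc := hf.continuous
  intro h0
  have hac : vol g ≪ vol h := by
    rw [vol_conformal hfc hin]
    refine withDensity_absolutelyContinuous' ?_ (Eventually.of_forall fun x => ?_)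
    · exact (by fun_prop : Measurable fun x => ENNReal.ofReal (Real.exp (n * f x))).aemeasurable
    · exact (ENNReal.ofReal_pos.2 (Real.exp_pos _)).ne'
  rw [h0, Measure.absolutelyContinuous_zero_iff] at hac
  exact hg hac

end Coercivity

/-! ### The obstacle problem -/

section Obstacle

variable {n : ℕ} {M : Type*} [TopologicalSpace M] [ChartedSpace (EuclideanSpace ℝ (Fin n)) M]
  [IsManifold (𝓡 n) ∞ M] [MeasurableSpace M] [BorelSpace M] [T2Space M] [CompactSpace M]
  {h : Metric n M} {u v w : Lp ℝ 2 (vol h)} {c : ℝ}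

omit [BorelSpace M] [T2Space M] [CompactSpace M] in
-- Positivity is inherited from the obstacle, so the admissible set is simply the set of functions
-- in H¹ above u, which is convex and closed.
theorem mem_H1pos_of_le (hu : u ∈ H1pos h) (hv : v ∈ H1 h) (huv : u ≤ v) : v ∈ H1pos h := by
  refine ⟨hv, ?_⟩
  filter_upwards [hu.2, (Lp.coeFn_le u v).2 huv] with x h₁ h₂
  exact h₁.trans_le h₂

omit [BorelSpace M] [T2Space M] [CompactSpace M] in
theorem le_midpoint (hv : u ≤ v) (hw : u ≤ w) : u ≤ (1 / 2 : ℝ) • (v + w) := by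
  rw [← Lp.coeFn_le] at hv hw ⊢
  filter_upwards [hv, hw, Lp.coeFn_smul (1 / 2 : ℝ) (v + w), Lp.coeFn_add v w] with x h₁ h₂ h₃ h₄
  rw [h₃, Pi.smul_apply, h₄, Pi.add_apply, smul_eq_mul]
  linarith

/-- The parallelogram law around the midpoint. The midpoint is admissible, so near-minimality of v
and w forces them to be close. -/
theorem form_sub_eq (hv : v ∈ H1 h) (hw : w ∈ H1 h) :
    form h (v - w) (v - w) = 2 * form h v v + 2 * form h w w
      - 4 * form h ((1 / 2 : ℝ) • (v + w)) ((1 / 2 : ℝ) • (v + w)) := by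
  have := form_parallelogram hv hw
  rw [form_smul (add_mem_H1 hv hw)]
  linarith

theorem exists_isObstacleSolution (hn : 3 ≤ n) (hc : 0 < c)
    (hco : ∀ w ∈ H1 h, c * ‖w‖ ^ 2 ≤ form h w w) (hu : u ∈ H1pos h) :
    ∃ v, IsObstacleSolution h u v := by
  have hp : ∀ w ∈ H1 h, 0 ≤ form h w w := fun w hw => le_trans (by positivity) (hco w hw)
  let S : Set ℝ := {a | ∃ z, z ∈ H1 h ∧ u ≤ z ∧ form h z z = a}
  have hbdd : BddBelow S := ⟨0, by rintro _ ⟨z, hz, -, rfl⟩; exact hp z hz⟩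
  have hne : S.Nonempty := ⟨_, u, hu.1, le_rfl, rfl⟩
  have hm : ∀ z, z ∈ H1 h → u ≤ z → sInf S ≤ form h z z := fun z hz huz =>
    csInf_le hbdd ⟨z, hz, huz, rfl⟩
  have hex : ∀ k : ℕ, ∃ z, z ∈ H1 h ∧ u ≤ z ∧ form h z z < sInf S + 1 / ((k : ℝ) + 1) := by
    intro k
    obtain ⟨_, ⟨z, hz, huz, rfl⟩, hlt⟩ := exists_lt_of_csInf_lt hne
      (lt_add_of_pos_right (sInf S) (show (0 : ℝ) < 1 / ((k : ℝ) + 1) by positivity))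
    exact ⟨z, hz, huz, hlt⟩
  choose z hz huz hlt using hex
  have hcau : Tendsto (fun p : ℕ × ℕ => form h (z p.1 - z p.2) (z p.1 - z p.2)) atTop (𝓝 0) := by
    have h₀ := tendsto_one_div_add_atTop_nhds_zero_nat (𝕜 := ℝ)
    have hz0 : Tendsto (fun p : ℕ × ℕ => 2 * (1 / ((p.1 : ℝ) + 1)) + 2 * (1 / ((p.2 : ℝ) + 1)))
        atTop (𝓝 0) := by
      rw [← prod_atTop_atTop_eq]
      simpa using ((h₀.comp tendsto_fst).const_mul 2).add ((h₀.comp tendsto_snd).const_mul 2)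
    refine squeeze_zero (fun p => hp _ (sub_mem_H1 (hz _) (hz _))) (fun p => ?_) hz0
    rw [form_sub_eq (hz _) (hz _)]
    have := hm _ (smul_mem_H1 (add_mem_H1 (hz p.1) (hz p.2)) (1 / 2)) (le_midpoint (huz _) (huz _))
    linarith [hlt p.1, hlt p.2]
  obtain ⟨v, hv, hzv, hform⟩ := exists_tendsto_form hn hc hco hz hcau
  -- The order of L² is closed, so the constraint survives the limit.
  have huv : u ≤ v := ge_of_tendsto' hzv huz
  refine ⟨v, ⟨mem_H1pos_of_le hu hv huv, huv⟩, fun y hy huy => ?_⟩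
  refine le_trans ?_ (hm y hy.1 huy)
  have h₁ : Tendsto (fun k : ℕ => sInf S + 1 / ((k : ℝ) + 1)) atTop (𝓝 (sInf S)) := by
    simpa using (tendsto_one_div_add_atTop_nhds_zero_nat (𝕜 := ℝ)).const_add (sInf S)
  exact le_of_tendsto_of_tendsto' hform h₁ fun k => (hlt k).le

theorem IsObstacleSolution.eq (hc : 0 < c) (hco : ∀ w ∈ H1 h, c * ‖w‖ ^ 2 ≤ form h w w)
    (hv : IsObstacleSolution h u v) (hw : IsObstacleSolution h u w) (hu : u ∈ H1pos h) : v = w := by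
  have hm := smul_mem_H1 (add_mem_H1 hv.1.1.1 hw.1.1.1) (1 / 2)
  have hle := le_midpoint hv.1.2 hw.1.2
  have h₁ := hv.2 _ (mem_H1pos_of_le hu hm hle) hle
  have h₂ := hw.2 _ (mem_H1pos_of_le hu hm hle) hle
  have h₃ := hco _ (sub_mem_H1 hv.1.1.1 hw.1.1.1)
  rw [form_sub_eq hv.1.1.1 hw.1.1.1] at h₃
  have h₄ : ‖v - w‖ ^ 2 ≤ 0 := by
    by_contra hlt
    push Not at hlt
    have := mul_pos hc hlt
    linarith
  rw [← sub_eq_zero, ← norm_eq_zero]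
  exact pow_eq_zero_iff two_ne_zero |>.1 (le_antisymm h₄ (by positivity))

theorem isObstacleSolution_obstacleMap (hn : 3 ≤ n) (hc : 0 < c)
    (hco : ∀ w ∈ H1 h, c * ‖w‖ ^ 2 ≤ form h w w) (hu : u ∈ H1pos h) :
    IsObstacleSolution h u (obstacleMap h u) :=
  Classical.epsilon_spec (exists_isObstacleSolution hn hc hco hu)

omit [BorelSpace M] [T2Space M] [CompactSpace M] in
-- Raising the obstacle from u to v shrinks the set of competitors but keeps v in it.
theorem IsObstacleSolution.self (hv : IsObstacleSolution h u v) : IsObstacleSolution h v v :=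
  ⟨⟨hv.1.1, le_rfl⟩, fun z hz hvz => hv.2 z hz (hv.1.2.trans hvz)⟩

theorem obstacleMap_obstacleMap (hn : 3 ≤ n) (hc : 0 < c)
    (hco : ∀ w ∈ H1 h, c * ‖w‖ ^ 2 ≤ form h w w) (hu : u ∈ H1pos h) :
    obstacleMap h (obstacleMap h u) = obstacleMap h u := by
  have h₁ := isObstacleSolution_obstacleMap hn hc hco hu
  exact (isObstacleSolution_obstacleMap hn hc hco h₁.1.1).eq hc hco h₁.self h₁.1.1

end Obstacle

end ConformalObstacle

end

/-! ### The monotonicity formula and rigidity -/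

open ConformalObstacle
theorem lemma6p1 {n : ℕ} (hn : 3 ≤ n) {M : Type*} [TopologicalSpace M] [T2Space M] [CompactSpace M]
    [ChartedSpace (EuclideanSpace ℝ (Fin n)) M] [IsManifold (𝓡 n) ∞ M]
    [MeasurableSpace M] [BorelSpace M]
    (g h : ConformalObstacle.Metric n M) (hY : 0 < yamabeInvariant g) (hh : h ∈ conformalClass g)
    (p : ℝ) (hp : 1 ≤ p) (hp' : p ≤ critExp n - 1)
    (u : Lp ℝ 2 (vol h)) (hu : u ∈ H1pos h) :
    -- `T_h(u)` is the unique solution of the obstacle problem, and its norm is finite and nonzero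
    (IsObstacleSolution h u (obstacleMap h u) ∧
      ∀ v, IsObstacleSolution h u v → v = obstacleMap h u) ∧
    MemLp (obstacleMap h u) (ENNReal.ofReal (p + 1)) (vol h) ∧
    0 < normLp h (p + 1) (obstacleMap h u) ∧
    -- the monotonicity formula
    controlFunctional h p u - controlFunctional h p (obstacleMap h u)
      = 1 / normLp h (p + 1) (obstacleMap h u) ^ 2
        * (formNorm h u ^ 2 - formNorm h (obstacleMap h u) ^ 2) ∧
    0 ≤ 1 / normLp h (p + 1) (obstacleMap h u) ^ 2
        * (formNorm h u ^ 2 - formNorm h (obstacleMap h u) ^ 2) ∧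
    -- rigidity
    (controlFunctional h p u = controlFunctional h p (obstacleMap h u) → obstacleMap h u = u) := by
  obtain ⟨c, hc, hco⟩ := exists_coercive hn hY hh
  have hnonneg : ∀ w ∈ H1 h, 0 ≤ form h w w := fun w hw => le_trans (by positivity) (hco w hw)
  have hT := isObstacleSolution_obstacleMap hn hc hco hu
  have hTT := obstacleMap_obstacleMap hn hc hco hu
  have hmem : MemLp (obstacleMap h u) (ENNReal.ofReal (p + 1)) (vol h) :=
    (memLp_of_mem_H1 hn hY hh hT.1.1.1).mono_exponent (ENNReal.ofReal_le_ofReal (by linarith))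
  have hpos : 0 < normLp h (p + 1) (obstacleMap h u) := by
    -- A zero norm would make the solution vanish almost everywhere although it is positive almost
    -- everywhere, which is impossible on a space of nonzero volume.
    refine lt_of_le_of_ne lpNorm_nonneg fun h0 => ?_
    have hz := (lpNorm_eq_zero hmem (ENNReal.ofReal_pos.2 (by linarith)).ne').1 h0.symm
    refine vol_ne_zero_of_conformal hY hh (ae_eq_bot.1 (eventually_false_iff_eq_bot.1 ?_))
    filter_upwards [hz, hT.1.1.2] with x h₁ h₂
    exact h₂.ne' h₁
  have hle : form h (obstacleMap h u) (obstacleMap h u) ≤ form h u u := hT.2 u hu le_rfl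
  have hsq : ∀ w ∈ H1 h, formNorm h w ^ 2 = form h w w := fun w hw => Real.sq_sqrt (hnonneg w hw)
  have hdiff : controlFunctional h p u - controlFunctional h p (obstacleMap h u)
      = 1 / normLp h (p + 1) (obstacleMap h u) ^ 2
        * (formNorm h u ^ 2 - formNorm h (obstacleMap h u) ^ 2) := by
    -- Idempotence of the state map gives both quotients the same denominator.
    rw [controlFunctional, controlFunctional, hTT, hsq _ hu.1, hsq _ hT.1.1.1]
    ring
  refine ⟨⟨hT, fun v hv => hv.eq hc hco hT hu⟩, hmem, hpos, hdiff, ?_, fun heq => ?_⟩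
  · rw [hsq _ hu.1, hsq _ hT.1.1.1]
    exact mul_nonneg (by positivity) (sub_nonneg.2 hle)
  · rw [heq, sub_self, hsq _ hu.1, hsq _ hT.1.1.1] at hdiff
    have hne : 1 / normLp h (p + 1) (obstacleMap h u) ^ 2 ≠ 0 := by positivity
    have hf : form h u u = form h (obstacleMap h u) (obstacleMap h u) :=
      sub_eq_zero.1 ((mul_eq_zero.1 hdiff.symm).resolve_left hne)
    -- As u is admissible and has the minimal energy, it solves the obstacle problem, and uniqueness
    -- applies.
    refine hT.eq hc hco ⟨⟨hu, le_rfl⟩, fun z hz huz => ?_⟩ hu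
    rw [hf]
    exact hT.2 z hz huz
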